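/- Let $n\ge 1$ and let $\Omega\subset\mathbb R^n$ be a bounded domain with $C^2$ boundary and outer unit normal $\boldsymbol\nu$; $\mathrm dS$ denotes surface measure on $\partial\Omega$ (counting measure if $n=1$). Let $a,b_1,\dots,b_n,c\in C^2(\overline\Omega\times\mathbb R_{\ge0})$, $h\in C^2(\overline\Omega\times\mathbb R_{\ge0}\times\mathbb R\times\mathbb R^n)$, $\psi\in C^2(\overline\Omega\times\mathbb R_{\ge0}\times\mathbb R)$, $\boldsymbol b=(b_1,\dots,b_n)$, and consider $$w_t-\operatorname{div}(a\nabla w)+\boldsymbol b\cdot\nabla w+cw+h(x,t,w,\nabla w)=f\ \text{ in }\Omega\times\mathbb R_+,$$ $$a\frac{\partial w}{\partial\boldsymbol\nu}+\psi(x,t,w)=d\ \text{ on }\partial\Omega\times\mathbb R_+,\qquad w(\cdot,0)=w^0,$$ where the inputs $d,f\in C^2(\overline\Omega\times\mathbb R_{\ge0})$ and $w^0\in C^2(\overline\Omega)$ satisfy the compatibility condition $a\,\partial w^0/\partial\boldsymbol\nu+\psi(x,0,w^0)=d(x,0)$ on $\partial\Omega$. By a solution on $[0,T]$ we mean a classical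 one: $w\in C^{2,1}(\Omega\times(0,T))\cap C(\overline\Omega\times[0,T])$, with $\nabla w$ continuous on $\overline\Omega\times(0,T)$. Let $\phi\in C([0,\infty);[0,\infty))\cap C^1((0,\infty);(0,\infty))$ with $\phi(0)=0$ and $\delta_0\le s\phi'(s)/\phi(s)\le\delta_1$ for all $s>0$, where $\delta_0,\delta_1>0$ are constants, and put $\Phi(s)=\int_0^s\phi(r)\,\mathrm dr$. Assume: - $\underline a\le a\le\overline a$ on $\overline\Omega\times\mathbb R_{\ge0}$ with constants $\underline a,\overline a>0$; - $|h|+|h_t|+|h_s|+(1+|\eta|)\sum_i|h_{\eta_i}|\le\mu_1(|s|)(1+|\eta|^2)$ for all $(x,t,s,\eta)\in\overline\Omega\times\mathbb R_{\ge0}\times\mathbb R\times\mathbb R^n$, with $\mu_1\in C(\mathbb R_{\ge0};\mathbb R_{\ge0})$ increasing; and $-\psi(x,t,s)s\le\mu_3(x,t)(s^2+1)$ for all $(x,t,s)\in\partial\Omega\times\mathbb R_{\ge0}\times\mathbb R$, with $\mu_3\in C(\partial\Omega\times\mathbb R_{\ge0})$; - there are $\mu\in C(\overline\Omega\times\mathbb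 R_{\ge0})$ and a constant $\underline c>0$ such that $-h(x,t,s,\eta)s\le\mu(x,t)s^2$ and $\underline c\le c-\mu-\max\big\{\frac{\operatorname{div}\boldsymbol b}{1+\delta_0},\frac{\operatorname{div}\boldsymbol b}{1+\delta_1}\big\}$ for all $(x,t)\in\Omega\times\mathbb R_+$, $s\in\mathbb R$, $\eta\in\mathbb R^n$; - $\psi_0(x,t):=\inf_{s\ne0}\frac1s\Big(\psi(x,t,s)+s\min\big\{\frac{\boldsymbol b\cdot\boldsymbol\nu}{1+\delta_0},\frac{\boldsymbol b\cdot\boldsymbol\nu}{1+\delta_1}\big\}\Big)$ exists and is $\ge\underline{\psi_0}$ on $\partial\Omega\times\mathbb R_+$, for a constant $\underline{\psi_0}>0$. For $q\in[1,\infty]$ write $\mathcal I_q(d,\partial\Omega)=\big(\int_0^T(\int_{\partial\Omega}\Phi(|d|)\,\mathrm dS)^q\mathrm dt\big)^{1/q}$ and $\mathcal I_q(f,\Omega)=\big(\int_0^T(\int_{\Omega}\Phi(|f|)\,\mathrm dx)^q\mathrm dt\big)^{1/q}$ (essential supremum over $(0,T)$ if $q=\infty$), and let $q'$ be the conjugate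 exponent of $q$. 1. For all sufficiently small $\varepsilon>0$ (that is, for $0<\varepsilon<\varepsilon_0$, where $\varepsilon_0>0$ depends only on $\Omega,a,\boldsymbol b,c,h,\psi,\phi$ and the constants $\delta_0,\delta_1,\underline c$), with $$\lambda=\underline c(1+\delta_0)-\varepsilon>0,\qquad C(\varepsilon)=\frac{\delta_1(1+\delta_0)}{\delta_0(1+\delta_1)}\Big(\frac{1+\delta_0}{1+\delta_1}\varepsilon\Big)^{-\frac{1+\delta_0}{\delta_0(1+\delta_1)}},$$ for every $q\in[1,\infty]$, all inputs $w^0,d,f$ as above, every $T>0$ and every solution $w$ on $[0,T]$, $$\int_\Omega\Phi(|w(x,T)|)\,\mathrm dx\le e^{-\lambda T}\int_\Omega\Phi(|w^0|)\,\mathrm dx+C(\varepsilon)\Big(\frac1{\lambda q'}\Big)^{1/q'}\big(\mathcal I_q(d,\partial\Omega)+\mathcal I_q(f,\Omega)\big),$$ where $(1/(\lambda q'))^{1/q'}:=1$ if $q=1$. 2. For every $q\in[1,\infty]$ the system is exponentially $L^q$-ISS in $K_\Phi$-class and in $L^\Phi$-norm with inputs from the $K_\Phi$-classes: there are constants $M_0,\lambda_1>0$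 and $\gamma_0,\gamma_1$ of class $\mathcal K$ such that, for all inputs, all $T>0$ and all solutions $w$ on $[0,T]$, $$\int_\Omega\Phi(|w(x,T)|)\,\mathrm dx\le M_0e^{-\lambda_1T}\int_\Omega\Phi(|w^0|)\,\mathrm dx+\gamma_0(\mathcal I_q(d,\partial\Omega))+\gamma_1(\mathcal I_q(f,\Omega));$$ and there are (possibly different) such constants and functions for which $$\|w(\cdot,T)\|_{L^\Phi(\Omega)}\le M_0e^{-\lambda_1T}\|w^0\|_{L^\Phi(\Omega)}+\gamma_0(\mathcal I_q(d,\partial\Omega))+\gamma_1(\mathcal I_q(f,\Omega)),$$ where $\|u\|_{L^\Phi(\Omega)}=\inf\{k>0:\int_\Omega\Phi(|u|/k)\,\mathrm dx\le1\}$ is the Luxemburg norm. -/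

import Mathlib

open MeasureTheory Set
open scoped ENNReal

noncomputable section

namespace ParabolicISS

/-- `n`-dimensional Euclidean space. -/
abbrev E (n : ℕ) : Type := EuclideanSpace ℝ (Fin n)

/-! ### Domains with `C²` boundary, surface measure, outer normal -/

/-- `r` is a local `C²` defining function of `Ω` at `x`: on the open neighbourhood `U` of `x`, the
set `Ω` is the sublevel set `{r < 0}`, and the gradient of `r` does not vanish at `x`. -/
def IsLocalDefiningFunction {n : ℕ} (Ω : Set (E n)) (x : E n) (U : Set (E n)) (r : E n → ℝ) :
    Prop :=
  IsOpen U ∧ x ∈ U ∧ ContDiffOn ℝ 2 r U ∧ gradient r x ≠ 0 ∧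
    Ω ∩ U = {y ∈ U | r y < 0}

/-- A bounded domain (nonempty connected open set) with `C²` boundary. -/
structure IsC2Domain {n : ℕ} (Ω : Set (E n)) : Prop where
  isOpen : IsOpen Ω
  isConnected : IsConnected Ω
  isBounded : Bornology.IsBounded Ω
  boundary : ∀ x ∈ frontier Ω, ∃ U r, IsLocalDefiningFunction Ω x U r

/-- `v` is the outer unit normal of `Ω` at the boundary point `x`. -/
def IsOuterUnitNormal {n : ℕ} (Ω : Set (E n)) (x v : E n) : Prop :=
  ∃ U r, IsLocalDefiningFunction Ω x U r ∧ v = ‖gradient r x‖⁻¹ • gradient r x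

/-- The outer unit normal field on the boundary (it is unique at every boundary point of a `C²`
domain; the value elsewhere is irrelevant). -/
def outerNormal {n : ℕ} (Ω : Set (E n)) (x : E n) : E n :=
  Classical.epsilon (IsOuterUnitNormal Ω x)

/-- Surface measure on the boundary: the `(n-1)`-dimensional Hausdorff measure, normalised so
that it agrees with Lebesgue measure on `(n-1)`-dimensional Euclidean space (for `n = 1` it is
the counting measure). -/
def surfaceMeasure {n : ℕ} (Ω : Set (E n)) : Measure (E n) :=
  (Measure.euclideanHausdorffMeasure (n - 1)).restrict (frontier Ω)

/-- Divergence of a vector field. -/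
def divergence {n : ℕ} (F : E n → E n) (x : E n) : ℝ :=
  ∑ i, fderiv ℝ F x (EuclideanSpace.single i 1) i

/-- The normal derivative at a boundary point `x` of a function that is differentiable up to the
boundary. -/
def normalDeriv {n : ℕ} (Ω : Set (E n)) (u : E n → ℝ) (x : E n) : ℝ :=
  fderivWithin ℝ u (closure Ω) x (outerNormal Ω x)

/-! ### The equation -/

/-- The data of the equation `w_t - div (a ∇w) + b·∇w + c w + h(x,t,w,∇w) = f` in `Ω × (0,∞)`,
with boundary condition `a ∂w/∂ν + ψ(x,t,w) = d`. Regularity is imposed separately. -/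
structure System (n : ℕ) where
  Ω : Set (E n)
  a : E n → ℝ → ℝ
  b : E n → ℝ → E n
  c : E n → ℝ → ℝ
  h : E n → ℝ → ℝ → E n → ℝ
  ψ : E n → ℝ → ℝ → ℝ

namespace System

variable {n : ℕ} (S : System n)

/-- All coefficients are of class `C²` up to the boundary and up to `t = 0`. -/
structure Regular : Prop where
  contDiff_a : ContDiffOn ℝ 2 (fun p : E n × ℝ => S.a p.1 p.2) (closure S.Ω ×ˢ Ici 0)
  contDiff_b : ContDiffOn ℝ 2 (fun p : E n × ℝ => S.b p.1 p.2) (closure S.Ω ×ˢ Ici 0)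
  contDiff_c : ContDiffOn ℝ 2 (fun p : E n × ℝ => S.c p.1 p.2) (closure S.Ω ×ˢ Ici 0)
  contDiff_h : ContDiffOn ℝ 2 (fun p : E n × ℝ × ℝ × E n => S.h p.1 p.2.1 p.2.2.1 p.2.2.2)
    (closure S.Ω ×ˢ Ici 0 ×ˢ univ ×ˢ univ)
  contDiff_ψ : ContDiffOn ℝ 2 (fun p : E n × ℝ × ℝ => S.ψ p.1 p.2.1 p.2.2)
    (closure S.Ω ×ˢ Ici 0 ×ˢ univ)

/-- Ellipticity, and the growth conditions on `h` and `ψ`. -/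
structure GrowthConditions : Prop where
  elliptic : ∃ aLow aUp : ℝ, 0 < aLow ∧ 0 < aUp ∧
    ∀ x ∈ closure S.Ω, ∀ t, 0 ≤ t → aLow ≤ S.a x t ∧ S.a x t ≤ aUp
  growth_h : ∃ μ₁ : ℝ → ℝ, ContinuousOn μ₁ (Ici 0) ∧ MonotoneOn μ₁ (Ici 0) ∧
    (∀ s, 0 ≤ s → 0 ≤ μ₁ s) ∧
    ∀ x ∈ closure S.Ω, ∀ t, 0 ≤ t → ∀ (s : ℝ) (η : E n),
      |S.h x t s η| + |derivWithin (fun t' => S.h x t' s η) (Ici 0) t|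
          + |deriv (fun s' => S.h x t s' η) s|
          + (1 + ‖η‖) * ∑ i, |fderiv ℝ (fun η' => S.h x t s η') η (EuclideanSpace.single i 1)|
        ≤ μ₁ |s| * (1 + ‖η‖ ^ 2)
  growth_ψ : ∃ μ₃ : E n → ℝ → ℝ,
    ContinuousOn (fun p : E n × ℝ => μ₃ p.1 p.2) (frontier S.Ω ×ˢ Ici 0) ∧
    ∀ x ∈ frontier S.Ω, ∀ t, 0 ≤ t → ∀ s : ℝ, -S.ψ x t s * s ≤ μ₃ x t * (s ^ 2 + 1)

/-- The one-sided condition `-h s ≤ μ s²`, and `cLow ≤ c - μ - max_i (div b / (1 + δᵢ))` with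
`cLow > 0`. -/
def InteriorCondition (δ₀ δ₁ cLow : ℝ) : Prop :=
  0 < cLow ∧ ∃ μ : E n → ℝ → ℝ,
    ContinuousOn (fun p : E n × ℝ => μ p.1 p.2) (closure S.Ω ×ˢ Ici 0) ∧
    (∀ x ∈ S.Ω, ∀ t, 0 < t → ∀ (s : ℝ) (η : E n), -S.h x t s η * s ≤ μ x t * s ^ 2) ∧
    ∀ x ∈ S.Ω, ∀ t, 0 < t →
      cLow ≤ S.c x t - μ x t -
        max (divergence (fun y => S.b y t) x / (1 + δ₀))
          (divergence (fun y => S.b y t) x / (1 + δ₁))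

/-- The quotients whose infimum over `s ≠ 0` is `ψ₀(x,t)`. -/
def psiQuotients (δ₀ δ₁ : ℝ) (x : E n) (t : ℝ) : Set ℝ :=
  (fun s : ℝ => (S.ψ x t s + s * min (inner ℝ (S.b x t) (outerNormal S.Ω x) / (1 + δ₀))
    (inner ℝ (S.b x t) (outerNormal S.Ω x) / (1 + δ₁))) / s) '' {s | s ≠ 0}

/-- `ψ₀` exists (as a finite infimum) and is bounded below by a positive constant. -/
def BoundaryCondition (δ₀ δ₁ : ℝ) : Prop :=
  ∃ ψLow : ℝ, 0 < ψLow ∧ ∀ x ∈ frontier S.Ω, ∀ t, 0 < t →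
    BddBelow (S.psiQuotients δ₀ δ₁ x t) ∧ ψLow ≤ sInf (S.psiQuotients δ₀ δ₁ x t)

/-- The boundary operator `a ∂u/∂ν + ψ(x,t,u)` at time `t`, applied to a function `u` on the
closure of `Ω`. -/
def boundaryOp (u : E n → ℝ) (x : E n) (t : ℝ) : ℝ :=
  S.a x t * normalDeriv S.Ω u x + S.ψ x t (u x)

/-- Admissible inputs: `f`, `d`, `w⁰` of class `C²`, subject to the compatibility condition
`a ∂w⁰/∂ν + ψ(x,0,w⁰) = d(x,0)` on the boundary. -/
structure IsInput (w0 : E n → ℝ) (d f : E n → ℝ → ℝ) : Prop where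
  contDiff_w0 : ContDiffOn ℝ 2 w0 (closure S.Ω)
  contDiff_d : ContDiffOn ℝ 2 (fun p : E n × ℝ => d p.1 p.2) (closure S.Ω ×ˢ Ici 0)
  contDiff_f : ContDiffOn ℝ 2 (fun p : E n × ℝ => f p.1 p.2) (closure S.Ω ×ˢ Ici 0)
  compatible : ∀ x ∈ frontier S.Ω, S.boundaryOp w0 x 0 = d x 0

/-- `w` is a classical solution on `Q_T = Ω × (0,T)`: it lies in `C^{2,1}(Q_T)`, it is continuous
on the closure of `Q_T`, its spatial gradient is continuous up to the lateral boundary (so that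
the normal derivative makes sense), and the equation, the boundary condition and the initial
condition hold pointwise. -/
structure IsSolution (w0 : E n → ℝ) (d f : E n → ℝ → ℝ) (T : ℝ) (w : E n → ℝ → ℝ) : Prop where
  continuousOn : ContinuousOn (fun p : E n × ℝ => w p.1 p.2) (closure S.Ω ×ˢ Icc 0 T)
  differentiable_time : ∀ x ∈ S.Ω, DifferentiableOn ℝ (w x) (Ioo 0 T)
  continuous_deriv_time :
    ContinuousOn (fun p : E n × ℝ => deriv (w p.1) p.2) (S.Ω ×ˢ Ioo 0 T)
  contDiff_space : ∀ t ∈ Ioo 0 T, ContDiffOn ℝ 2 (fun x => w x t) S.Ω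
  continuous_hessian :
    ContinuousOn (fun p : E n × ℝ => fderiv ℝ (fderiv ℝ (fun x => w x p.2)) p.1)
      (S.Ω ×ˢ Ioo 0 T)
  differentiable_closure : ∀ t ∈ Ioo 0 T, DifferentiableOn ℝ (fun x => w x t) (closure S.Ω)
  continuous_gradient :
    ContinuousOn (fun p : E n × ℝ => fderivWithin ℝ (fun x => w x p.2) (closure S.Ω) p.1)
      (closure S.Ω ×ˢ Ioo 0 T)
  equation : ∀ x ∈ S.Ω, ∀ t ∈ Ioo 0 T,
    deriv (w x) t - divergence (fun y => S.a y t • gradient (fun z => w z t) y) x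
      + inner ℝ (S.b x t) (gradient (fun z => w z t) x) + S.c x t * w x t
      + S.h x t (w x t) (gradient (fun z => w z t) x) = f x t
  boundary : ∀ x ∈ frontier S.Ω, ∀ t ∈ Ioo 0 T, S.boundaryOp (fun z => w z t) x t = d x t
  initial : ∀ x ∈ closure S.Ω, w x 0 = w0 x

end System

/-! ### Young functions, modulars, Luxemburg norm -/

/-- `φ` is continuous on `[0,∞)`, `C¹` and positive on `(0,∞)`, vanishes at `0`, and satisfies
Tolksdorf's condition `δ₀ ≤ s φ'(s) / φ(s) ≤ δ₁`. -/
structure IsTolksdorf (φ : ℝ → ℝ) (δ₀ δ₁ : ℝ) : Prop where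
  δ₀_pos : 0 < δ₀
  δ₁_pos : 0 < δ₁
  continuousOn : ContinuousOn φ (Ici 0)
  contDiffOn : ContDiffOn ℝ 1 φ (Ioi 0)
  pos : ∀ s, 0 < s → 0 < φ s
  zero : φ 0 = 0
  tolksdorf : ∀ s, 0 < s → δ₀ ≤ s * deriv φ s / φ s ∧ s * deriv φ s / φ s ≤ δ₁

/-- `Φ(s) = ∫₀ˢ φ`. -/
def youngFunction (φ : ℝ → ℝ) (s : ℝ) : ℝ := ∫ r in (0 : ℝ)..s, φ r

/-- The modular `∫ Φ(|u|) dσ`. -/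
def modular {X : Type*} [MeasurableSpace X] (Φ : ℝ → ℝ) (σ : Measure X) (u : X → ℝ) : ℝ :=
  ∫ x, Φ |u x| ∂σ

/-- The `L^q(0,T)`-norm of `t ↦ ∫ Φ(|v(·,t)|) dσ`, that is
`(∫₀ᵀ (∫ Φ(|v|) dσ)^q dt)^(1/q)`, and the essential supremum for `q = ∞`. -/
def timeModular {X : Type*} [MeasurableSpace X] (Φ : ℝ → ℝ) (σ : Measure X) (q : ℝ≥0∞) (T : ℝ)
    (v : X → ℝ → ℝ) : ℝ :=
  (eLpNorm (fun t => modular Φ σ (fun x => v x t)) q (volume.restrict (Ioo 0 T))).toReal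

/-- The Luxemburg norm. -/
def luxemburgNorm {X : Type*} [MeasurableSpace X] (Φ : ℝ → ℝ) (σ : Measure X) (u : X → ℝ) : ℝ :=
  sInf {k : ℝ | 0 < k ∧ ∫⁻ x, ENNReal.ofReal (Φ (|u x| / k)) ∂σ ≤ 1}

/-! ### Input-to-state stability -/

/-- Comparison functions of class `K` on `[0,∞)`. -/
structure IsClassK (γ : ℝ → ℝ) : Prop where
  continuousOn : ContinuousOn γ (Ici 0)
  strictMonoOn : StrictMonoOn γ (Ici 0)
  zero : γ 0 = 0

/-- Exponential `L^q`-ISS in `K_Φ`-class, with inputs measured by their modulars. -/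
def ExpISSClass {n : ℕ} (S : System n) (Φ : ℝ → ℝ) (q : ℝ≥0∞) : Prop :=
  ∃ (M₀ lam : ℝ) (γ₀ γ₁ : ℝ → ℝ), 0 < M₀ ∧ 0 < lam ∧ IsClassK γ₀ ∧ IsClassK γ₁ ∧
    ∀ (w0 : E n → ℝ) (d f : E n → ℝ → ℝ), S.IsInput w0 d f →
    ∀ T : ℝ, 0 < T → ∀ w : E n → ℝ → ℝ, S.IsSolution w0 d f T w →
      modular Φ (volume.restrict S.Ω) (fun x => w x T) ≤
        M₀ * modular Φ (volume.restrict S.Ω) w0 * Real.exp (-lam * T)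
          + γ₀ (timeModular Φ (surfaceMeasure S.Ω) q T d)
          + γ₁ (timeModular Φ (volume.restrict S.Ω) q T f)

/-- Exponential `L^q`-ISS in `L^Φ`-norm, with inputs from the `K_Φ`-classes (measured by their
modulars). -/
def ExpISSNorm {n : ℕ} (S : System n) (Φ : ℝ → ℝ) (q : ℝ≥0∞) : Prop :=
  ∃ (M₀ lam : ℝ) (γ₀ γ₁ : ℝ → ℝ), 0 < M₀ ∧ 0 < lam ∧ IsClassK γ₀ ∧ IsClassK γ₁ ∧
    ∀ (w0 : E n → ℝ) (d f : E n → ℝ → ℝ), S.IsInput w0 d f →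
    ∀ T : ℝ, 0 < T → ∀ w : E n → ℝ → ℝ, S.IsSolution w0 d f T w →
      luxemburgNorm Φ (volume.restrict S.Ω) (fun x => w x T) ≤
        M₀ * luxemburgNorm Φ (volume.restrict S.Ω) w0 * Real.exp (-lam * T)
          + γ₀ (timeModular Φ (surfaceMeasure S.Ω) q T d)
          + γ₁ (timeModular Φ (volume.restrict S.Ω) q T f)

/-- The constant `C(ε)`. -/
def youngConst (δ₀ δ₁ ε : ℝ) : ℝ :=
  δ₁ * (1 + δ₀) / (δ₀ * (1 + δ₁)) *
    ((1 + δ₀) / (1 + δ₁) * ε) ^ (-((1 + δ₀) / (δ₀ * (1 + δ₁))))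

/-- The factor `(1 / (lam q'))^(1/q')`, where `q'` is the exponent conjugate to `q`; it is `1` for
`q' = ∞`, that is for `q = 1`. -/
def gainFactor (lam : ℝ) (q' : ℝ≥0∞) : ℝ :=
  if q' = ∞ then 1 else (1 / (lam * q'.toReal)) ^ (1 / q'.toReal)

end ParabolicISS

end

open ParabolicISS

namespace ParabolicISS

open Filter Topology

/-! ### Functions satisfying Tolksdorf's condition -/

/-! The Lyapunov functional is V(t) = ∫ Φ(|w|). With g the odd extension of φ, V' = ∫ g(w) w_t.
Inserting the equation, the diffusion gives a dissipation in g'(w)|∇w|², and the advection is the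
divergence of Φ(|w|) b up to the term Φ(|w|) div b. Tolksdorf's condition yields (1+δ₀)Φ(|s|) ≤ s
g(s) ≤ (1+δ₁)Φ(|s|), which explains the maximum and minimum in the hypotheses, and the interior
condition gives the decay rate `cLow * (1 + δ₀)`.

Young's inequality for the inputs f and d costs small multiples of w g(w). They are absorbed without
loss of rate: b is replaced by b - κx, whose divergence is smaller by κn, so a damping κnΦ appears.
The drift κ x·∇w is dominated by the diffusion at a cost of order κ², and the boundary term κΦ x·ν
by the positive lower bound of ψ₀ (`exists_coupling_constants`). Hence the full rate `cLow * (1 +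
δ₀)` holds with a fixed constant C. Since C(ε) → ∞ as ε → 0, the asserted estimate follows for all
small ε (`exists_forall_le_youngConst`).

Because the value of C is irrelevant, the exact boundary integral is not needed, only domination of
the boundary contribution by a multiple of the surface integral of Φ(|d|). The equation is tested
with cutoffs built from a global defining function ρ; their gradients live in layers of width 1/j.
The flux is continuous up to the lateral boundary and bounded there by the data, hence almost
bounded in thin layers (`eventually_integral_flux_le`). The layer measures have a weak limit carried
by the boundary, with mass at most C r^(n-1) in balls of radius r, hence dominated by Hausdorff
measure (`exists_layerMeasure_limit`). Integrating with the factor exp(λt) gives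
`exists_exp_mul_modular_le`, and Hölder in time gives `exists_modular_le`.

For the norm estimate, φ is replaced by φ(·/k)/k, whose Young function is Φ(·/k). It satisfies
Tolksdorf's condition with the same δ₀, δ₁, and C depends on φ only through these, so the modular
estimate holds uniformly in k. It remains to choose k so that its right-hand side is at most 1
(`expISSNorm`). -/

/-- The differential inequality makes x^(-p) f(x) nonincreasing; compare its values at s and Λs. As
f may have any sign, the reverse estimate follows by passing to -f. -/
lemma apply_mul_le_rpow_mul {f f' : ℝ → ℝ} {p : ℝ} (hf : ∀ s, 0 < s → HasDerivAt f (f' s) s)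
    (h : ∀ s, 0 < s → s * f' s ≤ p * f s) {s Λ : ℝ} (hs : 0 < s) (hΛ : 1 ≤ Λ) :
    f (Λ * s) ≤ Λ ^ p * f s := by
  have hd : ∀ x ∈ Ioi (0 : ℝ), HasDerivAt (fun x => x ^ (-p) * f x)
      (x ^ (-p - 1) * (x * f' x - p * f x)) x := by
    intro x hx
    have hx : 0 < x := hx
    refine ((Real.hasDerivAt_rpow_const (p := -p) (Or.inl hx.ne')).mul (hf x hx)).congr_deriv ?_
    have : x ^ (-p) = x ^ (-p - 1) * x := by
      rw [← Real.rpow_add_one hx.ne']; ring_nf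
    rw [this]; ring
  have hanti : AntitoneOn (fun x => x ^ (-p) * f x) (Ioi 0) := by
    apply antitoneOn_of_hasDerivWithinAt_nonpos (convex_Ioi 0)
      (fun x hx => (hd x hx).continuousAt.continuousWithinAt)
      (f' := fun x => x ^ (-p - 1) * (x * f' x - p * f x))
    · intro x hx
      rw [interior_Ioi] at hx
      exact (hd x hx).hasDerivWithinAt
    · intro x hx
      rw [interior_Ioi] at hx
      have hx : 0 < x := hx
      exact mul_nonpos_of_nonneg_of_nonpos (by positivity) (by linarith [h x hx])
  have hΛ0 : 0 < Λ := by linarith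
  have := hanti (show s ∈ Ioi 0 from hs) (show Λ * s ∈ Ioi 0 from by simp; positivity)
    (by nlinarith)
  simp only at this
  rw [Real.mul_rpow hΛ0.le hs.le, Real.rpow_neg hΛ0.le, Real.rpow_neg hs.le] at this
  have h1 : 0 < Λ ^ p := by positivity
  have h2 : 0 < s ^ p := by positivity
  have h3 := mul_le_mul_of_nonneg_left this (mul_pos h1 h2).le
  field_simp at h3
  linarith

lemma rpow_mul_le_apply_mul {f f' : ℝ → ℝ} {p : ℝ} (hf : ∀ s, 0 < s → HasDerivAt f (f' s) s)
    (h : ∀ s, 0 < s → p * f s ≤ s * f' s) {s Λ : ℝ} (hs : 0 < s) (hΛ : 1 ≤ Λ) :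
    Λ ^ p * f s ≤ f (Λ * s) := by
  have := apply_mul_le_rpow_mul (f := fun x => -f x) (f' := fun x => -f' x) (p := p)
    (fun s hs => (hf s hs).neg) (fun s hs => by linarith [h s hs]) hs hΛ
  linarith

/-- The odd extension of a function on `[0,∞)`, with value `0` at `0`. -/
noncomputable def oddExt (φ : ℝ → ℝ) (s : ℝ) : ℝ := s * (φ |s| / |s|)

lemma oddExt_of_pos {φ : ℝ → ℝ} {s : ℝ} (hs : 0 < s) : oddExt φ s = φ s := by
  rw [oddExt, abs_of_pos hs]; field_simp

lemma oddExt_neg (φ : ℝ → ℝ) (s : ℝ) : oddExt φ (-s) = -oddExt φ s := by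
  simp [oddExt]

lemma oddExt_zero (φ : ℝ → ℝ) : oddExt φ 0 = 0 := by simp [oddExt]

namespace IsTolksdorf

variable {φ : ℝ → ℝ} {δ₀ δ₁ : ℝ} (hφ : IsTolksdorf φ δ₀ δ₁)

include hφ

lemma nonneg {s : ℝ} (hs : 0 ≤ s) : 0 ≤ φ s := by
  rcases hs.eq_or_lt with rfl | h
  · exact hφ.zero.ge
  · exact (hφ.pos s h).le

lemma hasDerivAt {s : ℝ} (hs : 0 < s) : HasDerivAt φ (deriv φ s) s :=
  ((hφ.contDiffOn.differentiableOn (by norm_num)).differentiableAt (Ioi_mem_nhds hs)).hasDerivAt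

lemma continuousOn_deriv : ContinuousOn (deriv φ) (Ioi 0) :=
  hφ.contDiffOn.continuousOn_deriv_of_isOpen isOpen_Ioi (by norm_num)

lemma mul_le_mul_deriv {s : ℝ} (hs : 0 < s) : δ₀ * φ s ≤ s * deriv φ s := by
  have := (hφ.tolksdorf s hs).1
  rwa [le_div_iff₀ (hφ.pos s hs)] at this

lemma mul_deriv_le {s : ℝ} (hs : 0 < s) : s * deriv φ s ≤ δ₁ * φ s := by
  have := (hφ.tolksdorf s hs).2
  rwa [div_le_iff₀ (hφ.pos s hs)] at this

lemma deriv_pos {s : ℝ} (hs : 0 < s) : 0 < deriv φ s := by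
  have h1 := hφ.mul_le_mul_deriv hs
  have h2 := mul_pos hφ.δ₀_pos (hφ.pos s hs)
  exact pos_of_mul_pos_right (lt_of_lt_of_le h2 h1) hs.le

lemma le_delta : δ₀ ≤ δ₁ := (hφ.tolksdorf 1 one_pos).1.trans (hφ.tolksdorf 1 one_pos).2

lemma monotoneOn : MonotoneOn φ (Ici 0) := by
  apply monotoneOn_of_deriv_nonneg (convex_Ici 0) hφ.continuousOn
  · rw [interior_Ici]
    exact fun x hx => (hφ.hasDerivAt hx).differentiableAt.differentiableWithinAt
  · rw [interior_Ici]
    exact fun x hx => (hφ.deriv_pos hx).le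

lemma continuous_comp_abs : Continuous fun s => φ |s| :=
  hφ.continuousOn.comp_continuous continuous_abs (fun s => abs_nonneg s)

lemma abs_oddExt (s : ℝ) : |oddExt φ s| = φ |s| := by
  rcases eq_or_ne s 0 with rfl | hs
  · simp [oddExt, hφ.zero]
  · have := abs_pos.2 hs
    rw [oddExt, abs_mul, abs_div, abs_abs, abs_of_nonneg (hφ.nonneg (abs_nonneg s))]
    field_simp

omit hφ in
lemma mul_oddExt (s : ℝ) : s * oddExt φ s = |s| * φ |s| := by
  rcases eq_or_ne s 0 with rfl | hs
  · simp
  · have := abs_pos.2 hs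
    rw [oddExt, ← mul_assoc, ← sq, ← sq_abs]
    field_simp

lemma mul_oddExt_nonneg (s : ℝ) : 0 ≤ s * oddExt φ s := by
  rw [mul_oddExt]
  exact mul_nonneg (abs_nonneg s) (hφ.nonneg (abs_nonneg s))

lemma continuous_oddExt : Continuous (oddExt φ) := by
  rw [continuous_iff_continuousAt]
  intro s
  rcases eq_or_ne s 0 with rfl | hs
  · rw [ContinuousAt, oddExt_zero, tendsto_zero_iff_abs_tendsto_zero]
    have := hφ.continuous_comp_abs.tendsto 0
    rw [abs_zero, hφ.zero] at this
    exact this.congr (fun s => (hφ.abs_oddExt s).symm)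
  · exact continuousAt_id.mul (hφ.continuous_comp_abs.continuousAt.div
      continuous_abs.continuousAt (abs_ne_zero.2 hs))

lemma youngFunction_eq_integral {s : ℝ} (hs : 0 ≤ s) :
    youngFunction φ s = ∫ r in (0 : ℝ)..s, oddExt φ r := by
  apply intervalIntegral.integral_congr
  intro r hr
  rw [uIcc_of_le hs] at hr
  rcases hr.1.eq_or_lt with h | h
  · simp [← h, oddExt_zero, hφ.zero]
  · simp [oddExt_of_pos h]

lemma youngFunction_abs_eq_integral (s : ℝ) :
    youngFunction φ |s| = ∫ r in (0 : ℝ)..s, oddExt φ r := by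
  rw [hφ.youngFunction_eq_integral (abs_nonneg s)]
  rcases le_total 0 s with h | h
  · rw [abs_of_nonneg h]
  · rw [abs_of_nonpos h]
    have := intervalIntegral.integral_comp_neg (a := 0) (b := s) (oddExt φ)
    simp only [oddExt_neg, intervalIntegral.integral_neg, neg_zero] at this
    rw [intervalIntegral.integral_symm, ← this, neg_neg]

/-- The odd extension is continuous, including at 0, so its primitive Φ(|·|) is C¹ on the whole line
and the zero set of w needs no special treatment. -/
lemma hasDerivAt_youngFunction_abs (s : ℝ) :
    HasDerivAt (fun s => youngFunction φ |s|) (oddExt φ s) s := by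
  have := intervalIntegral.integral_hasDerivAt_right
    (hφ.continuous_oddExt.intervalIntegrable 0 s)
    (hφ.continuous_oddExt.stronglyMeasurableAtFilter _ _) hφ.continuous_oddExt.continuousAt
  exact this.congr_of_eventuallyEq (.of_forall hφ.youngFunction_abs_eq_integral)

lemma hasDerivAt_youngFunction {s : ℝ} (hs : 0 < s) :
    HasDerivAt (youngFunction φ) (φ s) s := by
  have := hφ.hasDerivAt_youngFunction_abs s
  rw [oddExt_of_pos hs] at this
  refine this.congr_of_eventuallyEq ?_
  filter_upwards [Ioi_mem_nhds hs] with x hx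
  rw [abs_of_pos hx]

lemma continuous_youngFunction_abs : Continuous fun s => youngFunction φ |s| :=
  continuous_iff_continuousAt.2 fun s => (hφ.hasDerivAt_youngFunction_abs s).continuousAt

omit hφ in
lemma youngFunction_zero : youngFunction φ 0 = 0 := by simp [youngFunction]

lemma youngFunction_nonneg {s : ℝ} (hs : 0 ≤ s) : 0 ≤ youngFunction φ s :=
  intervalIntegral.integral_nonneg hs fun _ hr => hφ.nonneg hr.1

lemma continuousOn_youngFunction : ContinuousOn (youngFunction φ) (Ici 0) :=
  hφ.continuous_youngFunction_abs.continuousOn.congr fun s hs => by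
    simp only [abs_of_nonneg (show 0 ≤ s from hs)]

/-- The difference of the two sides vanishes at 0 and has derivative sφ' - δ₀φ ≥ 0. The upper
comparison is proved in the same way with δ₁. -/
lemma youngFunction_le {s : ℝ} (hs : 0 ≤ s) : (1 + δ₀) * youngFunction φ s ≤ s * φ s := by
  have : MonotoneOn (fun s => s * φ s - (1 + δ₀) * youngFunction φ s) (Ici 0) := by
    have hd : ∀ s, 0 < s → HasDerivAt (fun s => s * φ s - (1 + δ₀) * youngFunction φ s)
        (s * deriv φ s - δ₀ * φ s) s := fun s hs =>
      (((hasDerivAt_id s).mul (hφ.hasDerivAt hs)).sub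
        ((hφ.hasDerivAt_youngFunction hs).const_mul _)).congr_deriv (by simp; ring)
    apply monotoneOn_of_hasDerivWithinAt_nonneg (convex_Ici 0)
      ((continuousOn_id.mul hφ.continuousOn).sub
        (continuousOn_const.mul hφ.continuousOn_youngFunction))
      (f' := fun s => s * deriv φ s - δ₀ * φ s)
    · rw [interior_Ici]
      exact fun s hs => (hd s hs).hasDerivWithinAt
    · rw [interior_Ici]
      exact fun s hs => by linarith [hφ.mul_le_mul_deriv hs]
  have := this (self_mem_Ici) hs hs
  simp only [zero_mul, youngFunction_zero] at this
  linarith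

lemma le_youngFunction {s : ℝ} (hs : 0 ≤ s) : s * φ s ≤ (1 + δ₁) * youngFunction φ s := by
  have : MonotoneOn (fun s => (1 + δ₁) * youngFunction φ s - s * φ s) (Ici 0) := by
    have hd : ∀ s, 0 < s → HasDerivAt (fun s => (1 + δ₁) * youngFunction φ s - s * φ s)
        (δ₁ * φ s - s * deriv φ s) s := fun s hs =>
      (((hφ.hasDerivAt_youngFunction hs).const_mul _).sub
        ((hasDerivAt_id s).mul (hφ.hasDerivAt hs))).congr_deriv (by simp; ring)
    apply monotoneOn_of_hasDerivWithinAt_nonneg (convex_Ici 0)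
      ((continuousOn_const.mul hφ.continuousOn_youngFunction).sub
        (continuousOn_id.mul hφ.continuousOn))
      (f' := fun s => δ₁ * φ s - s * deriv φ s)
    · rw [interior_Ici]
      exact fun s hs => (hd s hs).hasDerivWithinAt
    · rw [interior_Ici]
      exact fun s hs => by linarith [hφ.mul_deriv_le hs]
  have := this (self_mem_Ici) hs hs
  simp only [zero_mul, youngFunction_zero] at this
  linarith

lemma youngFunction_abs_le (s : ℝ) : (1 + δ₀) * youngFunction φ |s| ≤ s * oddExt φ s := by
  rw [mul_oddExt]; exact hφ.youngFunction_le (abs_nonneg s)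

lemma le_youngFunction_abs (s : ℝ) : s * oddExt φ s ≤ (1 + δ₁) * youngFunction φ |s| := by
  rw [mul_oddExt]; exact hφ.le_youngFunction (abs_nonneg s)

lemma apply_mul_le {s Λ : ℝ} (hs : 0 ≤ s) (hΛ : 1 ≤ Λ) : φ (Λ * s) ≤ Λ ^ δ₁ * φ s := by
  rcases hs.eq_or_lt with rfl | hs
  · simp [hφ.zero]
  · exact apply_mul_le_rpow_mul (fun s hs => hφ.hasDerivAt hs) (fun s hs => hφ.mul_deriv_le hs)
      hs hΛ

/-- Young's inequality, with a constant depending on `δ₁` only. -/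
lemma mul_oddExt_le {τ : ℝ} (hτ : 0 < τ) (y s : ℝ) :
    y * oddExt φ s ≤ τ * (s * oddExt φ s) +
      (max 1 τ⁻¹) ^ δ₁ * (1 + δ₁) * youngFunction φ |y| := by
  have h0 : y * oddExt φ s ≤ |y| * φ |s| := by
    rw [← hφ.abs_oddExt s, ← abs_mul]; exact le_abs_self _
  have hΦ := hφ.youngFunction_nonneg (abs_nonneg y)
  have hδ := hφ.δ₁_pos
  have hM : (0 : ℝ) < max 1 τ⁻¹ := by positivity
  have hy := abs_nonneg y
  have hs := abs_nonneg s
  have hφs := hφ.nonneg hs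
  rw [mul_oddExt]
  -- Either |y| is at most τ|s| and the first term suffices, or |s| is at most a multiple of |y| and
  -- φ(|s|) is controlled by φ(|y|). The maximum with 1 keeps the dilation factor in the range
  -- allowed by `apply_mul_le`.
  rcases le_total |y| (τ * |s|) with h | h
  · have : |y| * φ |s| ≤ τ * (|s| * φ |s|) := by
      rw [← mul_assoc]; exact mul_le_mul_of_nonneg_right h hφs
    have : 0 ≤ (max 1 τ⁻¹) ^ δ₁ * (1 + δ₁) * youngFunction φ |y| := by positivity
    linarith
  · have h1 : |s| ≤ max 1 τ⁻¹ * |y| := by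
      calc |s| = τ⁻¹ * (τ * |s|) := by field_simp
        _ ≤ τ⁻¹ * |y| := by gcongr
        _ ≤ max 1 τ⁻¹ * |y| := by gcongr; exact le_max_right _ _
    have h2 : φ |s| ≤ (max 1 τ⁻¹) ^ δ₁ * φ |y| :=
      (hφ.monotoneOn hs (show _ ∈ Ici (0:ℝ) from by simp only [mem_Ici]; positivity) h1).trans
        (hφ.apply_mul_le hy (le_max_left _ _))
    have h3 : |y| * φ |s| ≤ (max 1 τ⁻¹) ^ δ₁ * (|y| * φ |y|) := by
      calc |y| * φ |s| ≤ |y| * ((max 1 τ⁻¹) ^ δ₁ * φ |y|) := by gcongr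
        _ = _ := by ring
    have h4 : (max 1 τ⁻¹) ^ δ₁ * (|y| * φ |y|) ≤
        (max 1 τ⁻¹) ^ δ₁ * ((1 + δ₁) * youngFunction φ |y|) := by
      exact mul_le_mul_of_nonneg_left (hφ.le_youngFunction hy) (by positivity)
    have : 0 ≤ τ * (|s| * φ |s|) := by positivity
    linarith

/-- Φ grows at rates between the powers 1+δ₀ and 1+δ₁. Which power is the binding one depends on
whether k lies below or above 1; the maximum covers both cases. -/
lemma youngFunction_div_le {s k : ℝ} (hs : 0 ≤ s) (hk : 0 < k) :
    youngFunction φ (s / k) ≤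
      max (k⁻¹ ^ (1 + δ₀)) (k⁻¹ ^ (1 + δ₁)) * youngFunction φ s := by
  rcases hs.eq_or_lt with rfl | hs
  · simp [youngFunction_zero]
  have hΦ := hφ.youngFunction_nonneg hs.le
  rcases le_total k 1 with h | h
  · have := apply_mul_le_rpow_mul (fun s hs => hφ.hasDerivAt_youngFunction hs)
      (fun s hs => hφ.le_youngFunction hs.le) hs ((one_le_inv₀ hk).2 h)
    rw [div_eq_inv_mul]
    refine this.trans ?_
    gcongr
    exact le_max_right _ _
  · have := rpow_mul_le_apply_mul (fun s hs => hφ.hasDerivAt_youngFunction hs)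
      (fun s hs => hφ.youngFunction_le hs.le) (div_pos hs hk) h
    rw [mul_div_cancel₀ _ hk.ne'] at this
    have hk' : 0 < k ^ (1 + δ₀) := by positivity
    calc youngFunction φ (s / k) = k⁻¹ ^ (1 + δ₀) * (k ^ (1 + δ₀) * youngFunction φ (s / k)) := by
          rw [Real.inv_rpow hk.le]; field_simp
      _ ≤ k⁻¹ ^ (1 + δ₀) * youngFunction φ s := by gcongr
      _ ≤ _ := by gcongr; exact le_max_left _ _

/-- The rescaled function, whose Young function is `s ↦ Φ(s / k)`. -/
lemma rescale {k : ℝ} (hk : 0 < k) : IsTolksdorf (fun s => φ (s / k) / k) δ₀ δ₁ where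
  δ₀_pos := hφ.δ₀_pos
  δ₁_pos := hφ.δ₁_pos
  continuousOn := by
    refine ContinuousOn.div_const (hφ.continuousOn.comp (by fun_prop) ?_) k
    intro s hs
    exact div_nonneg hs hk.le
  contDiffOn := by
    refine ContDiffOn.div_const (hφ.contDiffOn.comp (by fun_prop) ?_) k
    intro s hs
    exact div_pos hs hk
  pos s hs := div_pos (hφ.pos _ (div_pos hs hk)) hk
  zero := by simp [hφ.zero]
  tolksdorf s hs := by
    have hsk := div_pos hs hk
    have hd : deriv (fun s => φ (s / k) / k) s = deriv φ (s / k) / k / k := by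
      have := (((hφ.hasDerivAt hsk).comp s ((hasDerivAt_id s).div_const k)).div_const k).deriv
      simp only [Function.comp_def, id] at this
      rw [this]; ring
    have h := hφ.tolksdorf _ hsk
    have hp := hφ.pos _ hsk
    have e : s * deriv (fun s => φ (s / k) / k) s / (φ (s / k) / k) =
        s / k * deriv φ (s / k) / φ (s / k) := by
      rw [hd]; field_simp
    rw [e]
    exact h

omit hφ in
lemma youngFunction_rescale {k : ℝ} (s : ℝ) (hk : 0 < k) :
    youngFunction (fun s => φ (s / k) / k) s = youngFunction φ (s / k) := by
  rw [youngFunction, youngFunction, intervalIntegral.integral_div,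
    intervalIntegral.integral_comp_div φ hk.ne']
  simp; field_simp

end IsTolksdorf

/-- The smooth approximation `s ↦ s φ(√(s² + δ)) / √(s² + δ)` of the odd extension of `φ`. -/
noncomputable def oddReg (φ : ℝ → ℝ) (δ s : ℝ) : ℝ :=
  s * (φ √(s ^ 2 + δ) / √(s ^ 2 + δ))

/-! ### Properties of the regularised test function -/

namespace IsTolksdorf

variable {φ : ℝ → ℝ} {δ₀ δ₁ : ℝ} (hφ : IsTolksdorf φ δ₀ δ₁)

include hφ

/-- With r = √(s²+δ), q = φ(r)/r and θ = s²/(s²+δ), the derivative is (1-θ)q + θφ'(r), a convex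
combination of q and a number that is at least δ₀q. The bound is expressed through the same factor q
that occurs in `oddReg φ δ s` = sq, so that dissipation and drift can be compared pointwise. -/
lemma exists_hasDerivAt_oddReg {δ : ℝ} (hδ : 0 < δ) : ∃ g' : ℝ → ℝ, Continuous g' ∧
    (∀ s, HasDerivAt (oddReg φ δ) (g' s) s) ∧
    ∀ s, min 1 δ₀ * (φ √(s ^ 2 + δ) / √(s ^ 2 + δ)) ≤ g' s := by
  have hpos : ∀ s : ℝ, 0 < s ^ 2 + δ := fun s => by positivity
  have hr : ∀ s : ℝ, 0 < √(s ^ 2 + δ) := fun s => Real.sqrt_pos.2 (hpos s)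
  have hrc : Continuous fun s : ℝ => √(s ^ 2 + δ) := by fun_prop
  have hc1 : Continuous fun s : ℝ => φ √(s ^ 2 + δ) :=
    hφ.continuousOn.comp_continuous hrc fun s => (hr s).le
  have hc2 : Continuous fun s : ℝ => deriv φ √(s ^ 2 + δ) :=
    hφ.continuousOn_deriv.comp_continuous hrc fun s => hr s
  refine ⟨fun s => φ √(s ^ 2 + δ) / √(s ^ 2 + δ) + s ^ 2 / (s ^ 2 + δ) *
    (deriv φ √(s ^ 2 + δ) - φ √(s ^ 2 + δ) / √(s ^ 2 + δ)), ?_, ?_, ?_⟩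
  · have hq := hc1.div hrc fun s => (hr s).ne'
    exact hq.add (((continuous_pow 2).div (by fun_prop) fun s => (hpos s).ne').mul (hc2.sub hq))
  · intro s
    have h1 : HasDerivAt (fun s : ℝ => √(s ^ 2 + δ)) (s / √(s ^ 2 + δ)) s := by
      have := (((hasDerivAt_pow 2 s).add_const δ).sqrt (hpos s).ne')
      refine this.congr_deriv ?_
      have := hr s
      simp; field_simp
    have h2 := (hφ.hasDerivAt (hr s)).comp s h1
    have h3 := (hasDerivAt_id s).mul (h2.div h1 (hr s).ne')
    refine h3.congr_deriv ?_
    have h4 := hr s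
    have h5 : √(s ^ 2 + δ) ^ 2 = s ^ 2 + δ := Real.sq_sqrt (hpos s).le
    simp only [Function.comp_def, id, Pi.div_apply]
    have h6 : s ^ 2 / (s ^ 2 + δ) = s ^ 2 / √(s ^ 2 + δ) ^ 2 := by rw [h5]
    rw [h6]
    generalize √(s ^ 2 + δ) = r at h4 ⊢
    field_simp
  · intro s
    have h4 := hr s
    have h5 : √(s ^ 2 + δ) ^ 2 = s ^ 2 + δ := Real.sq_sqrt (hpos s).le
    have h6 := hφ.mul_le_mul_deriv h4
    have h7 := hφ.pos _ h4
    set r := √(s ^ 2 + δ)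
    set q := φ r / r with hq
    have hq0 : 0 < q := by positivity
    have h8 : δ₀ * q ≤ deriv φ r := by
      rw [hq, ← mul_div_assoc, div_le_iff₀ h4]; linarith
    have hθ0 : 0 ≤ s ^ 2 / (s ^ 2 + δ) := by positivity
    have hθ1 : s ^ 2 / (s ^ 2 + δ) ≤ 1 := by
      rw [div_le_one (hpos s)]; linarith
    set θ := s ^ 2 / (s ^ 2 + δ)
    have hm1 : min 1 δ₀ * q ≤ q := by
      have := min_le_left 1 δ₀; nlinarith
    have hm2 : min 1 δ₀ * q ≤ deriv φ r := le_trans (by gcongr; exact min_le_right _ _) h8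
    nlinarith

lemma abs_oddReg_le (δ : ℝ) (s : ℝ) (hδ : 0 ≤ δ) : |oddReg φ δ s| ≤ φ √(s ^ 2 + δ) := by
  have h1 : |s| ≤ √(s ^ 2 + δ) := Real.abs_le_sqrt (by linarith)
  have h2 := hφ.nonneg (Real.sqrt_nonneg (s ^ 2 + δ))
  rw [oddReg, abs_mul, abs_of_nonneg (by positivity : 0 ≤ φ √(s ^ 2 + δ) / √(s ^ 2 + δ))]
  rcases (Real.sqrt_nonneg (s ^ 2 + δ)).eq_or_lt with h | h
  · rw [← h]; simp [hφ.zero]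
  · rw [mul_div_assoc', div_le_iff₀ h, mul_comm]; gcongr

lemma tendsto_oddReg (s : ℝ) : Tendsto (fun δ => oddReg φ δ s) (𝓝[>] 0) (𝓝 (oddExt φ s)) := by
  have h0 : oddExt φ s = oddReg φ 0 s := by simp [oddExt, oddReg, Real.sqrt_sq_eq_abs]
  rcases eq_or_ne s 0 with rfl | hs
  · simp [oddReg, oddExt]
  rw [h0]
  refine Tendsto.mono_left (ContinuousAt.tendsto ?_) nhdsWithin_le_nhds
  have h1 : 0 < √(s ^ 2 + 0) := Real.sqrt_pos.2 (by positivity)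
  have h2 : ContinuousAt (fun δ => √(s ^ 2 + δ)) 0 := by fun_prop
  have h3 : ContinuousAt (fun δ => φ √(s ^ 2 + δ)) 0 :=
    ContinuousAt.comp (f := fun δ => √(s ^ 2 + δ)) (hφ.hasDerivAt h1).continuousAt h2
  exact continuousAt_const.mul (h3.div h2 h1.ne')

end IsTolksdorf

end ParabolicISS

namespace ParabolicISS

open Filter Topology

/-! ### A global defining function -/

/-- An open half-space contained in a closed half-space through the same origin forces parallel
normals. The direction -p gives the sign of c. -/
lemma exists_nonneg_smul_eq_of_forall_inner_nonpos {V : Type*} [NormedAddCommGroup V]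
    [InnerProductSpace ℝ V] {p p' : V} (hp : p ≠ 0)
    (h : ∀ v, inner ℝ p v < 0 → inner ℝ p' v ≤ 0) : ∃ c : ℝ, 0 ≤ c ∧ p' = c • p := by
  have hp2 : 0 < ‖p‖ ^ 2 := by positivity
  refine ⟨inner ℝ p' p / ‖p‖ ^ 2, ?_, ?_⟩
  · have := h (-p) (by rw [inner_neg_right, real_inner_self_eq_norm_sq]; linarith)
    rw [inner_neg_right] at this
    exact div_nonneg (by linarith) hp2.le
  · set c := inner ℝ p' p / ‖p‖ ^ 2 with hc
    have hcp : c * ‖p‖ ^ 2 = inner ℝ p' p := div_mul_cancel₀ _ hp2.ne'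
    have hpu : inner ℝ p (p' - c • p) = 0 := by
      rw [inner_sub_right, inner_smul_right, real_inner_self_eq_norm_sq, hcp, real_inner_comm,
        sub_self]
    have hpu' : inner ℝ p' (p' - c • p) = ‖p' - c • p‖ ^ 2 := by
      rw [← real_inner_self_eq_norm_sq, inner_sub_left (p') (c • p) (p' - c • p),
        real_inner_smul_left, hpu]
      ring
    -- Tilting the component of p' orthogonal to p slightly by -s p makes it admissible; letting s →
    -- 0 shows that this component vanishes.
    have key : ∀ s : ℝ, 0 < s → ‖p' - c • p‖ ^ 2 ≤ s * inner ℝ p' p := by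
      intro s hs
      have := h (p' - c • p - s • p) (by
        rw [inner_sub_right, hpu, inner_smul_right, real_inner_self_eq_norm_sq]
        nlinarith)
      rw [inner_sub_right, hpu', inner_smul_right] at this
      linarith
    have h0 : ‖p' - c • p‖ ^ 2 ≤ 0 := by
      have ht : Tendsto (fun s : ℝ => s * inner ℝ p' p) (𝓝[>] 0) (𝓝 (0 * inner ℝ p' p)) :=
        ((continuous_id.mul continuous_const).tendsto 0).mono_left nhdsWithin_le_nhds
      rw [zero_mul] at ht
      exact ge_of_tendsto ht (eventually_mem_nhdsWithin.mono fun s hs => key s hs)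
    have : ‖p' - c • p‖ = 0 := by nlinarith [norm_nonneg (p' - c • p)]
    exact sub_eq_zero.1 (norm_eq_zero.1 this)

variable {n : ℕ} {Ω : Set (E n)}

lemma eq_zero_of_mem_frontier (hΩ : IsOpen Ω) {U : Set (E n)} (hU : IsOpen U) {r : E n → ℝ}
    (hr : ContinuousOn r U) (h : Ω ∩ U = {y ∈ U | r y < 0}) {x : E n} (hx : x ∈ frontier Ω)
    (hxU : x ∈ U) : r x = 0 := by
  have hx' : x ∈ closure Ω ∧ x ∉ Ω := by rwa [hΩ.frontier_eq] at hx
  apply le_antisymm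
  · have hc : ContinuousAt r x := hr.continuousAt (hU.mem_nhds hxU)
    by_contra! hlt
    have h1 : ∀ᶠ y in 𝓝 x, 0 < r y ∧ y ∈ U := (hc.eventually_const_lt hlt).and (hU.mem_nhds hxU)
    obtain ⟨y, hy, hyΩ⟩ := (mem_closure_iff_frequently.1 hx'.1).and_eventually h1 |>.exists
    have : y ∈ {y ∈ U | r y < 0} := h ▸ ⟨hy, hyΩ.2⟩
    linarith [this.2, hyΩ.1]
  · by_contra! hlt
    exact hx'.2 (h.symm ▸ (⟨hxU, hlt⟩ : x ∈ {y ∈ U | r y < 0}) : x ∈ Ω ∩ U).1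

/-- A direction along which r decreases enters Ω, so r' is negative there and its difference
quotients are nonpositive. The half-space lemma then applies; this is the independence of the outer
normal from the defining function. -/
lemma exists_smul_gradient_eq (hΩ : IsOpen Ω) {U U' : Set (E n)} (hU : IsOpen U)
    (hU' : IsOpen U') {r r' : E n → ℝ} (hr : ContDiffOn ℝ 2 r U) (hr' : ContDiffOn ℝ 2 r' U')
    (h : Ω ∩ U = {y ∈ U | r y < 0}) (h' : Ω ∩ U' = {y ∈ U' | r' y < 0}) {x : E n}
    (hx : x ∈ frontier Ω) (hxU : x ∈ U) (hxU' : x ∈ U') (hg : gradient r x ≠ 0) :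
    ∃ c : ℝ, 0 ≤ c ∧ gradient r' x = c • gradient r x := by
  apply exists_nonneg_smul_eq_of_forall_inner_nonpos hg
  intro v hv
  have hd : DifferentiableAt ℝ r x :=
    (hr.contDiffAt (hU.mem_nhds hxU)).differentiableAt (by norm_num)
  have hd' : DifferentiableAt ℝ r' x :=
    (hr'.contDiffAt (hU'.mem_nhds hxU')).differentiableAt (by norm_num)
  have h0 := eq_zero_of_mem_frontier hΩ hU hr.continuousOn h hx hxU
  have h0' := eq_zero_of_mem_frontier hΩ hU' hr'.continuousOn h' hx hxU'
  have e : ∀ f : E n → ℝ, DifferentiableAt ℝ f x →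
      HasDerivAt (fun s : ℝ => f (x + s • v)) (inner ℝ (gradient f x) v) 0 := by
    intro f hf
    have h1 : HasDerivAt (fun s : ℝ => x + s • v) v 0 := by
      simpa using ((hasDerivAt_id (0 : ℝ)).smul_const v).const_add x
    have h2 : HasFDerivAt f (fderiv ℝ f x) (x + (0 : ℝ) • v) := by
      simpa using hf.hasFDerivAt
    have := h2.comp_hasDerivAt (0 : ℝ) h1
    have h3 : fderiv ℝ f x v = inner ℝ (gradient f x) v := by
      rw [gradient, InnerProductSpace.toDual_symm_apply]
    rw [h3] at this
    exact this
  have hline : ContinuousAt (fun s : ℝ => x + s • v) 0 := by fun_prop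
  have hlim : Tendsto (fun s : ℝ => x + s • v) (𝓝[>] 0) (𝓝 x) := by
    have := hline.tendsto
    simp only [zero_smul, add_zero] at this
    exact this.mono_left nhdsWithin_le_nhds
  have s1 := (hasDerivAt_iff_tendsto_slope.1 (e r hd)).mono_left
    (nhdsWithin_mono (0 : ℝ)
      (show Ioi (0 : ℝ) ⊆ {0}ᶜ from fun s hs => ne_of_gt hs))
  have s2 := (hasDerivAt_iff_tendsto_slope.1 (e r' hd')).mono_left
    (nhdsWithin_mono (0 : ℝ)
      (show Ioi (0 : ℝ) ⊆ {0}ᶜ from fun s hs => ne_of_gt hs))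
  refine le_of_tendsto s2 ?_
  filter_upwards [s1.eventually_lt_const hv, hlim (hU.mem_nhds hxU), hlim (hU'.mem_nhds hxU'),
    self_mem_nhdsWithin] with s hs hsU hsU' hpos
  have hpos : 0 < s := hpos
  simp only [slope_def_field, zero_smul, add_zero, h0, sub_zero] at hs
  have hneg : r (x + s • v) < 0 := by
    by_contra! hc
    exact absurd hs (not_lt.2 (div_nonneg hc hpos.le))
  have hmem : x + s • v ∈ Ω :=
    (h.symm ▸ (⟨hsU, hneg⟩ : x + s • v ∈ {y ∈ U | r y < 0}) : x + s • v ∈ Ω ∩ U).1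
  have hmem' : x + s • v ∈ {y ∈ U' | r' y < 0} := h' ▸ ⟨hmem, hsU'⟩
  simp only [slope_def_field, zero_smul, add_zero, h0', sub_zero]
  exact div_nonpos_of_nonpos_of_nonneg hmem'.2.le hpos.le

lemma IsC2Domain.isOuterUnitNormal (hΩ : IsC2Domain Ω) {x : E n} (hx : x ∈ frontier Ω) :
    IsOuterUnitNormal Ω x (outerNormal Ω x) := by
  obtain ⟨U, r, h⟩ := hΩ.boundary x hx
  exact Classical.epsilon_spec (p := IsOuterUnitNormal Ω x) ⟨_, U, r, h, rfl⟩

lemma IsC2Domain.norm_outerNormal (hΩ : IsC2Domain Ω) {x : E n} (hx : x ∈ frontier Ω) :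
    ‖outerNormal Ω x‖ = 1 := by
  obtain ⟨U, r, h, hv⟩ := hΩ.isOuterUnitNormal hx
  rw [hv, norm_smul, norm_inv, norm_norm, inv_mul_cancel₀ (norm_ne_zero_iff.2 h.2.2.2.1)]

lemma IsC2Domain.gradient_eq (hΩ : IsC2Domain Ω) {U : Set (E n)} (hU : IsOpen U)
    {r : E n → ℝ} (hr : ContDiffOn ℝ 2 r U) (h : Ω ∩ U = {y ∈ U | r y < 0}) {x : E n}
    (hx : x ∈ frontier Ω) (hxU : x ∈ U) :
    gradient r x = ‖gradient r x‖ • outerNormal Ω x := by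
  obtain ⟨V, s, hs, hv⟩ := hΩ.isOuterUnitNormal hx
  obtain ⟨c, hc, hcs⟩ := exists_smul_gradient_eq hΩ.isOpen hs.1 hU hs.2.2.1 hr hs.2.2.2.2 h hx
    hs.2.1 hxU hs.2.2.2.1
  have := norm_ne_zero_iff.2 hs.2.2.2.1
  rw [hv, hcs, norm_smul, smul_smul, Real.norm_of_nonneg hc]
  congr 1
  field_simp

open scoped Manifold ContDiff in
/-- A bounded `C²` domain has a global `C¹` defining function. -/
theorem IsC2Domain.exists_defining_function (hΩ : IsC2Domain Ω) :
    ∃ ρ : E n → ℝ, ContDiff ℝ 1 ρ ∧ (∀ x ∈ Ω, ρ x < 0) ∧ ∀ x ∈ frontier Ω, ρ x = 0 ∧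
      ∃ c : ℝ, 0 < c ∧ HasFDerivAt ρ (c • innerSL ℝ (outerNormal Ω x)) x := by
  -- Local functions are prepared at every point of the closure: the constant -1 inside Ω, a
  -- defining function at the boundary, with the neighbourhood shrunk so that the gradient vanishes
  -- nowhere in it.
  have hloc : ∀ x ∈ closure Ω, ∃ (U : Set (E n)) (r : E n → ℝ), IsOpen U ∧ x ∈ U ∧
      ContDiffOn ℝ 2 r U ∧ Ω ∩ U = {y ∈ U | r y < 0} ∧
      ∀ y ∈ U, y ∈ frontier Ω → gradient r y ≠ 0 := by
    intro x hx
    by_cases hxΩ : x ∈ Ω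
    · refine ⟨Ω, fun _ => -1, hΩ.isOpen, hxΩ, contDiffOn_const, ?_, ?_⟩
      · simp
      · intro y hy hy'
        rw [hΩ.isOpen.frontier_eq] at hy'
        exact absurd hy hy'.2
    · have hxf : x ∈ frontier Ω := by rw [hΩ.isOpen.frontier_eq]; exact ⟨hx, hxΩ⟩
      obtain ⟨U, r, hU, hxU, hr, hg, h⟩ := hΩ.boundary x hxf
      have hcont : ContinuousOn (gradient r) U :=
        (InnerProductSpace.toDual ℝ (E n)).symm.continuous.comp_continuousOn
          (hr.continuousOn_fderiv_of_isOpen hU (by norm_num))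
      refine ⟨U ∩ gradient r ⁻¹' {0}ᶜ, r, hcont.isOpen_inter_preimage hU isOpen_compl_singleton,
        ⟨hxU, hg⟩, hr.mono inter_subset_left, ?_, fun y hy _ => hy.2⟩
      rw [← inter_assoc, h]
      ext y
      simp only [mem_inter_iff, mem_ofPred_eq]
      tauto
  choose! U r hU hxU hr h hg using hloc
  have hcpt : IsCompact (closure Ω) := hΩ.isBounded.isCompact_closure
  obtain ⟨t, ht, hcov⟩ := hcpt.elim_nhds_subcover U fun x hx => (hU x hx).mem_nhds (hxU x hx)
  obtain ⟨f, hf⟩ := SmoothPartitionOfUnity.exists_isSubordinate 𝓘(ℝ, E n)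
    (isClosed_closure (s := Ω)) (fun i : t => U i) (fun i => hU i (ht i i.2)) (by
      intro x hx
      obtain ⟨i, hi, hxi⟩ := mem_iUnion₂.1 (hcov hx)
      exact mem_iUnion.2 ⟨⟨i, hi⟩, hxi⟩)
  have hfr : ∀ x ∈ frontier Ω, x ∈ closure Ω := fun x hx => frontier_subset_closure hx
  refine ⟨fun x => ∑ᶠ i : t, f i x • r i x, ?_, ?_, ?_⟩
  · rw [← contMDiff_iff_contDiff]
    refine hf.contMDiff_finsum_smul (fun i => hU i (ht i i.2)) fun i => ?_
    rw [contMDiffOn_iff_contDiffOn]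
    exact (hr i (ht i i.2)).of_le (by norm_num)
  · intro x hx
    simp only [finsum_eq_sum_of_fintype, smul_eq_mul]
    have hle : ∀ i : t, f i x * r i x ≤ 0 ∧ (0 < f i x → f i x * r i x < 0) := by
      intro i
      by_cases hxi : x ∈ U i
      · have : x ∈ {y ∈ U i | r i y < 0} := h i (ht i i.2) ▸ ⟨hx, hxi⟩
        exact ⟨mul_nonpos_of_nonneg_of_nonpos (f.nonneg i x) this.2.le,
          fun hp => mul_neg_of_pos_of_neg hp this.2⟩
      · have : f i x = 0 := image_eq_zero_of_notMem_tsupport fun hc => hxi (hf i hc)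
        simp [this]
    obtain ⟨i, hi⟩ := f.exists_pos_of_mem (subset_closure hx)
    exact Finset.sum_neg' (fun i _ => (hle i).1) ⟨i, Finset.mem_univ _, (hle i).2 hi⟩
  · intro x hx
    -- At a boundary point each active local function vanishes, so the derivative of the partition
    -- function drops out of the product rule. Every term is a nonnegative multiple of the normal
    -- and at least one multiple is positive, so no cancellation can occur in the sum.
    have hterm : ∀ i : t, f i x * r i x = 0 ∧ ∃ c : ℝ, 0 ≤ c ∧ (0 < f i x → 0 < c) ∧
        HasFDerivAt (fun y => f i y * r i y) (c • innerSL ℝ (outerNormal Ω x)) x := by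
      intro i
      by_cases hxi : x ∈ U i
      · have h0 := eq_zero_of_mem_frontier hΩ.isOpen (hU i (ht i i.2))
          (hr i (ht i i.2)).continuousOn (h i (ht i i.2)) hx hxi
        have hgr := hΩ.gradient_eq (hU i (ht i i.2)) (hr i (ht i i.2)) (h i (ht i i.2)) hx hxi
        refine ⟨by simp [h0], f i x * ‖gradient (r i) x‖,
          mul_nonneg (f.nonneg i x) (norm_nonneg _),
          fun hp => mul_pos hp (norm_pos_iff.2 (hg i (ht i i.2) x hxi hx)), ?_⟩
        have hfd : DifferentiableAt ℝ (f i) x :=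
          (((f i).contMDiff.contDiff).differentiable (by simp)).differentiableAt
        have hrd : DifferentiableAt ℝ (r i) x :=
          ((hr i (ht i i.2)).contDiffAt ((hU i (ht i i.2)).mem_nhds hxi)).differentiableAt
            (by norm_num)
        refine (hfd.hasFDerivAt.mul hrd.hasFDerivAt).congr_fderiv ?_
        ext v
        have : fderiv ℝ (r i) x v = inner ℝ (gradient (r i) x) v := by
          rw [gradient, InnerProductSpace.toDual_symm_apply]
        simp only [h0, zero_smul, add_zero, smul_apply, smul_eq_mul, this,
          innerSL_apply_apply]
        conv_lhs => rw [hgr]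
        rw [real_inner_smul_left]
        ring
      · have hxs : x ∉ tsupport (f i) := fun hc => hxi (hf i hc)
        have : f i x = 0 := image_eq_zero_of_notMem_tsupport hxs
        refine ⟨by simp [this], 0, le_rfl, by simp [this], ?_⟩
        have he : (fun y => f i y * r i y) =ᶠ[𝓝 x] fun _ => 0 := by
          filter_upwards [notMem_tsupport_iff_eventuallyEq.1 hxs] with y hy
          simp [hy]
        rw [zero_smul]
        exact (hasFDerivAt_const (0 : ℝ) x).congr_of_eventuallyEq he
    choose h0 c hc hcp hder using hterm
    simp only [finsum_eq_sum_of_fintype, smul_eq_mul]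
    refine ⟨Finset.sum_eq_zero fun i _ => h0 i, ∑ i, c i, ?_, ?_⟩
    · obtain ⟨i, hi⟩ := f.exists_pos_of_mem (hfr x hx)
      exact Finset.sum_pos' (fun i _ => hc i) ⟨i, Finset.mem_univ _, hcp i hi⟩
    · rw [Finset.sum_smul]
      exact HasFDerivAt.fun_sum fun i _ => hder i

end ParabolicISS

namespace ParabolicISS

open Filter Topology

/-! ### Coordinates near a boundary point -/

variable {m : ℕ}

/-- Forgetting the `i`-th coordinate. -/
def forget (i : Fin (m + 1)) (x : E (m + 1)) : Fin m → ℝ := fun j => x (i.succAbove j)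

lemma norm_sub_smul_single_le (i : Fin (m + 1)) (x : E (m + 1)) :
    ‖x - x i • EuclideanSpace.single i (1 : ℝ)‖ ≤ m * ‖forget i x‖ := by
  have h : x - x i • EuclideanSpace.single i (1 : ℝ) =
      ∑ j : Fin m, x (i.succAbove j) • EuclideanSpace.single (i.succAbove j) (1 : ℝ) := by
    have hx : x = ∑ k, x k • EuclideanSpace.single k (1 : ℝ) := by
      ext l
      simp [Pi.single_apply]
    conv_lhs => lhs; rw [hx]
    rw [Fin.sum_univ_succAbove _ i]
    simp
  rw [h]
  refine (norm_sum_le _ _).trans ?_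
  have : ∀ j ∈ Finset.univ, ‖x (i.succAbove j) • EuclideanSpace.single (i.succAbove j) (1 : ℝ)‖ ≤
      ‖forget i x‖ := by
    intro j _
    rw [norm_smul]
    simpa [forget] using norm_le_pi_norm (forget i x) j
  simpa using Finset.sum_le_sum this

lemma forget_sub (i : Fin (m + 1)) (x y : E (m + 1)) :
    forget i (x - y) = forget i x - forget i y := rfl

lemma norm_le_abs_add (i : Fin (m + 1)) (x : E (m + 1)) :
    ‖x‖ ≤ |x i| + m * ‖forget i x‖ := by
  calc ‖x‖ = ‖x i • EuclideanSpace.single i (1 : ℝ) +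
        (x - x i • EuclideanSpace.single i (1 : ℝ))‖ := by congr 1; abel
    _ ≤ ‖x i • EuclideanSpace.single i (1 : ℝ)‖ + _ := norm_add_le _ _
    _ ≤ _ := by
      gcongr
      · simp [norm_smul]
      · exact norm_sub_smul_single_le i x

/-- A quantitative implicit function theorem: where ∂ᵢρ ≠ 0, the i-th coordinate is a Lipschitz
function of ρ and the remaining coordinates. It serves both for the thickness of the layers and for
the zero set of ρ as a Lipschitz graph. -/
lemma exists_coordinate {ρ : E (m + 1) → ℝ} {L : E (m + 1) →L[ℝ] ℝ} {z : E (m + 1)}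
    (h : HasStrictFDerivAt ρ L z) (hL : L ≠ 0) :
    ∃ (i : Fin (m + 1)) (A s : ℝ), 0 < A ∧ 0 < s ∧ ∀ x ∈ Metric.ball z s, ∀ y ∈ Metric.ball z s,
      |y i - x i| ≤ A * (|ρ y - ρ x| + ‖forget i y - forget i x‖) := by
  obtain ⟨i, hi⟩ : ∃ i, L (EuclideanSpace.single i 1) ≠ 0 := by
    by_contra! hc
    apply hL
    ext x
    have hx : x = ∑ k, x k • EuclideanSpace.single k (1 : ℝ) := by
      ext l
      simp [Pi.single_apply]
    rw [hx, map_sum]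
    simp [hc]
  set p := |L (EuclideanSpace.single i 1)| with hp
  have hp0 : 0 < p := abs_pos.2 hi
  -- An error of half the slope p leaves p/2 on the left after absorption, whence the factor 2/p in
  -- the constant.
  have hb := h.isLittleO.def (half_pos hp0)
  rw [nhds_prod_eq] at hb
  obtain ⟨s, hs, hb⟩ := Metric.nhds_basis_ball.prod_self.eventually_iff.1 hb
  refine ⟨i, 2 / p * (1 + (p / 2 + ‖L‖) * m), s, by positivity, hs, fun x hx y hy => ?_⟩
  have h1 := hb (show (y, x) ∈ Metric.ball z s ×ˢ Metric.ball z s from ⟨hy, hx⟩)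
  simp only [Real.norm_eq_abs] at h1
  set Δ := y - x with hΔ
  have hR := norm_sub_smul_single_le i Δ
  have hn := norm_le_abs_add i Δ
  rw [hΔ, forget_sub, ← hΔ] at hR hn
  have hΔi : Δ i = y i - x i := by simp [hΔ]
  set N := ‖forget i y - forget i x‖ with hN
  have hN0 : 0 ≤ N := norm_nonneg _
  have h2 : |Δ i| * p ≤ |L Δ| + ‖L‖ * (m * N) := by
    have e : Δ i * L (EuclideanSpace.single i 1) =
        L Δ - L (Δ - Δ i • EuclideanSpace.single i (1 : ℝ)) := by
      simp
    calc |Δ i| * p = |Δ i * L (EuclideanSpace.single i 1)| := by rw [abs_mul]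
      _ ≤ |L Δ| + |L (Δ - Δ i • EuclideanSpace.single i (1 : ℝ))| := by rw [e]; exact abs_sub _ _
      _ ≤ |L Δ| + ‖L‖ * ‖Δ - Δ i • EuclideanSpace.single i (1 : ℝ)‖ := by
        gcongr; exact L.le_opNorm _
      _ ≤ _ := by gcongr
  have h3 : |L Δ| ≤ |ρ y - ρ x| + p / 2 * ‖Δ‖ := by
    have := abs_sub (ρ y - ρ x) (ρ y - ρ x - L Δ)
    rw [sub_sub_cancel] at this
    linarith
  have h4 : |Δ i| * (p / 2) ≤ |ρ y - ρ x| + (p / 2 + ‖L‖) * m * N := by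
    nlinarith [norm_nonneg L]
  rw [← hΔi]
  have h5 : |Δ i| ≤ 2 / p * (|ρ y - ρ x| + (p / 2 + ‖L‖) * m * N) := by
    rw [div_mul_eq_mul_div, le_div_iff₀ hp0]; linarith
  refine h5.trans ?_
  rw [mul_assoc (2 / p) (1 + _)]
  have h6 : 0 ≤ (p / 2 + ‖L‖) * m := by positivity
  refine mul_le_mul_of_nonneg_left ?_ (by positivity : (0 : ℝ) ≤ 2 / p)
  nlinarith [abs_nonneg (ρ y - ρ x), mul_nonneg h6 (abs_nonneg (ρ y - ρ x))]

/-- Fubini in direction i: each line meets S in a set of diameter at most ℓ, and the projection of S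
lies in a sup-norm ball of volume (2r)^m. -/
lemma volume_le_of_slices (i : Fin (m + 1)) {S : Set (E (m + 1))} (hS : MeasurableSet S)
    {c : E (m + 1)} {r ℓ : ℝ} (hr : 0 ≤ r) (hSr : S ⊆ Metric.closedBall c r)
    (hℓ : ∀ x ∈ S, ∀ y ∈ S, forget i x = forget i y → |y i - x i| ≤ ℓ) :
    volume S ≤ ENNReal.ofReal ℓ * ENNReal.ofReal ((2 * r) ^ m) := by
  set e := (MeasurableEquiv.toLp 2 (Fin (m + 1) → ℝ)).symm.trans
    (MeasurableEquiv.piFinSuccAbove (fun _ => ℝ) i) with he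
  have hpres : MeasurePreserving e volume volume :=
    (volume_preserving_piFinSuccAbove (fun _ => ℝ) i).comp
      (EuclideanSpace.volume_preserving_symm_measurableEquiv_toLp (Fin (m + 1)))
  have hsymm : ∀ q, e.symm q = WithLp.toLp 2 (i.insertNth q.1 q.2) := fun q => rfl
  have hei : ∀ q, e.symm q i = q.1 := fun q => by simp [hsymm]
  have hef : ∀ q, forget i (e.symm q) = q.2 := fun q => by
    ext j
    simp [hsymm, forget]
  rw [← hpres.symm.measure_preimage_equiv S, Measure.volume_eq_prod,
    Measure.prod_apply_symm (e.symm.measurable hS)]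
  have hle : ∀ y : Fin m → ℝ, volume ((fun t => (t, y)) ⁻¹' (e.symm ⁻¹' S)) ≤
      (Metric.closedBall (forget i c) r).indicator (fun _ => ENNReal.ofReal ℓ) y := by
    intro y
    by_cases hy : y ∈ Metric.closedBall (forget i c) r
    · rw [indicator_of_mem hy]
      refine (Real.volume_le_diam _).trans (Metric.ediam_le fun t ht t' ht' => ?_)
      have := hℓ _ ht' _ ht (by rw [hef, hef])
      rw [hei, hei] at this
      rw [edist_dist, Real.dist_eq]
      exact ENNReal.ofReal_le_ofReal this
    · rw [indicator_of_notMem hy, nonpos_iff_eq_zero]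
      convert measure_empty (μ := (volume : Measure ℝ))
      rw [eq_empty_iff_forall_notMem]
      intro t ht
      apply hy
      have h1 := hSr ht
      rw [mem_closedBall_iff_norm] at h1 ⊢
      have hy2 : forget i (e.symm (t, y)) = y := hef (t, y)
      rw [← hy2, ← forget_sub, pi_norm_le_iff_of_nonneg hr]
      intro j
      exact (PiLp.norm_apply_le (e.symm (t, y) - c) _).trans h1
  refine (lintegral_mono hle).trans ?_
  rw [lintegral_indicator_const Metric.isClosed_closedBall.measurableSet,
    Real.volume_pi_closedBall _ hr]
  simp

/-- On such a Lipschitz graph the projection is antilipschitz, so the Hausdorff measure is bounded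
by a multiple of the Lebesgue measure of the bounded projection. -/
lemma hausdorffMeasure_lt_top_of_slices (i : Fin (m + 1)) {S : Set (E (m + 1))}
    (hS : Bornology.IsBounded S) {A : ℝ} (hA : 0 < A)
    (h : ∀ x ∈ S, ∀ y ∈ S, |y i - x i| ≤ A * ‖forget i y - forget i x‖) :
    Measure.hausdorffMeasure (m : ℝ) S < ∞ := by
  let K : NNReal := ⟨A + m, by positivity⟩
  have hanti : AntilipschitzWith K (fun x : S => forget i x) := by
    refine AntilipschitzWith.of_le_mul_dist fun x y => ?_
    rw [Subtype.dist_eq, dist_eq_norm, dist_eq_norm]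
    refine (norm_le_abs_add i _).trans ?_
    rw [forget_sub]
    have := h y y.2 x x.2
    simp only [PiLp.sub_apply]
    calc _ ≤ A * ‖forget i x - forget i y‖ + m * ‖forget i x - forget i y‖ := by gcongr
      _ = (A + m) * ‖forget i x - forget i y‖ := by ring
  have h1 := hanti.le_hausdorffMeasure_image (d := m) (by positivity) univ
  have h2 : Measure.hausdorffMeasure (m : ℝ) S =
      Measure.hausdorffMeasure (m : ℝ) (univ : Set S) := by
    rw [← isometry_subtype_coe.hausdorffMeasure_image (Or.inl (by positivity)) univ]
    simp
  have h3 : (Measure.hausdorffMeasure (m : ℝ) : Measure (Fin m → ℝ)) = volume := by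
    have := hausdorffMeasure_pi_real (ι := Fin m)
    rwa [Fintype.card_fin] at this
  rw [h2]
  refine h1.trans_lt (ENNReal.mul_lt_top (by finiteness) ?_)
  rw [h3]
  refine Bornology.IsBounded.measure_lt_top ?_
  obtain ⟨C, hC⟩ := hS.exists_norm_le
  refine isBounded_iff_forall_norm_le.2 ⟨C, ?_⟩
  rintro _ ⟨x, -, rfl⟩
  have hC0 : 0 ≤ C := (norm_nonneg _).trans (hC x x.2)
  rw [pi_norm_le_iff_of_nonneg hC0]
  exact fun j => (PiLp.norm_apply_le (x : E (m + 1)) _).trans (hC x x.2)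

end ParabolicISS

namespace ParabolicISS

open Filter Topology

/-! ### Boundary layers -/

/-- A continuous bump function supported in `[1,2]`. -/
def layerBump (r : ℝ) : ℝ := max 0 (6 * ((r - 1) * (2 - r)))

lemma continuous_layerBump : Continuous layerBump := by unfold layerBump; fun_prop

lemma layerBump_nonneg (r : ℝ) : 0 ≤ layerBump r := le_max_left _ _

lemma layerBump_le (r : ℝ) : layerBump r ≤ 6 := by
  rw [layerBump]
  exact max_le (by norm_num) (by nlinarith [sq_nonneg (2 * r - 3)])

lemma layerBump_eq_zero {r : ℝ} (h : r ∉ Icc 1 2) : layerBump r = 0 := by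
  rw [layerBump, max_eq_left]
  rw [mem_Icc, not_and_or, not_le, not_le] at h
  rcases h with h | h <;> nlinarith

/-- The measure `j β(-jρ) dx` on `Ω`, concentrated in a boundary layer of width `∼ 1/j`. -/
noncomputable def layerMeasure {n : ℕ} (Ω : Set (E n)) (ρ : E n → ℝ) (j : ℕ) : Measure (E n) :=
  (volume.restrict Ω).withDensity fun x => ENNReal.ofReal (j * layerBump (-(j * ρ x)))

section

variable {n : ℕ} {Ω : Set (E n)} {ρ : E n → ℝ}

lemma continuous_layer (hρ : Continuous ρ) (j : ℕ) :
    Continuous fun x => (j * layerBump (-(j * ρ x)) : ℝ) :=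
  continuous_const.mul (continuous_layerBump.comp (by fun_prop))

lemma integral_layerMeasure (hρ : Continuous ρ) (j : ℕ) (D : E n → ℝ) :
    ∫ x, D x ∂layerMeasure Ω ρ j = ∫ x in Ω, (j * layerBump (-(j * ρ x))) * D x := by
  rw [layerMeasure, integral_withDensity_eq_integral_toReal_smul
    (continuous_layer hρ j).measurable.ennreal_ofReal (.of_forall fun _ => ENNReal.ofReal_lt_top)]
  refine integral_congr_ae (.of_forall fun x => ?_)
  simp only [smul_eq_mul]
  rw [ENNReal.toReal_ofReal (mul_nonneg (Nat.cast_nonneg _) (layerBump_nonneg _))]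

lemma layerMeasure_le (hΩ : MeasurableSet Ω) (hρ : Continuous ρ) (j : ℕ) {S : Set (E n)}
    (hS : MeasurableSet S) : layerMeasure Ω ρ j S ≤
      ENNReal.ofReal (6 * j) * volume (S ∩ Ω ∩ {x | -(j * ρ x) ∈ Icc 1 2}) := by
  have hT : MeasurableSet {x | -(j * ρ x) ∈ Icc (1 : ℝ) 2} :=
    (isClosed_Icc.preimage (by fun_prop : Continuous fun x => -(j * ρ x))).measurableSet
  rw [layerMeasure, withDensity_apply _ hS, Measure.restrict_restrict hS,
    ← setLIntegral_const, ← lintegral_indicator (hS.inter hΩ),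
    ← lintegral_indicator ((hS.inter hΩ).inter hT)]
  refine lintegral_mono fun x => ?_
  by_cases hx : x ∈ S ∩ Ω
  · rw [indicator_of_mem hx]
    by_cases hx' : x ∈ {x | -(j * ρ x) ∈ Icc (1 : ℝ) 2}
    · rw [indicator_of_mem (mem_inter hx hx')]
      refine ENNReal.ofReal_le_ofReal ?_
      have := layerBump_le (-(j * ρ x))
      have hj : (0 : ℝ) ≤ j := Nat.cast_nonneg _
      nlinarith
    · rw [layerBump_eq_zero hx']; simp
  · rw [indicator_of_notMem hx]; simp

/-- By compactness ρ ≤ -η on the part of the closure outside O, while the layer lies in {-jρ ≤ 2};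
the two are disjoint as soon as jη > 2. -/
lemma layerMeasure_eventually_eq_zero (hΩ : IsOpen Ω) (hb : Bornology.IsBounded Ω)
    (hρ : Continuous ρ) (hneg : ∀ x ∈ Ω, ρ x < 0) {O : Set (E n)} (hO : IsOpen O)
    (hfr : frontier Ω ⊆ O) : ∀ᶠ j : ℕ in atTop, layerMeasure Ω ρ j Oᶜ = 0 := by
  have hcpt : IsCompact (closure Ω \ O) := hb.isCompact_closure.diff hO
  have hneg' : ∀ x ∈ closure Ω \ O, ρ x < 0 := by
    intro x hx
    refine hneg x ?_
    by_contra hc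
    exact hx.2 (hfr (by rw [hΩ.frontier_eq]; exact ⟨hx.1, hc⟩))
  obtain ⟨η, hη, hle⟩ : ∃ η : ℝ, 0 < η ∧ ∀ x ∈ closure Ω \ O, ρ x ≤ -η := by
    rcases (closure Ω \ O).eq_empty_or_nonempty with he | hne
    · exact ⟨1, one_pos, by simp [he]⟩
    · obtain ⟨x, hx, hmax⟩ := hcpt.exists_isMaxOn hne hρ.continuousOn
      exact ⟨-ρ x, by linarith [hneg' x hx], fun y hy => by simpa using hmax hy⟩
  filter_upwards [eventually_gt_atTop ⌈2 / η⌉₊] with j hj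
  have hj' : 2 / η < j := (Nat.le_ceil _).trans_lt (by exact_mod_cast hj)
  rw [div_lt_iff₀ hη] at hj'
  rw [← nonpos_iff_eq_zero]
  refine (layerMeasure_le hΩ.measurableSet hρ j hO.isClosed_compl.measurableSet).trans ?_
  convert le_of_eq (mul_zero (ENNReal.ofReal (6 * j)))
  convert measure_empty (μ := (volume : Measure (E n)))
  rw [eq_empty_iff_forall_notMem]
  rintro x ⟨⟨hxO, hxΩ⟩, hx⟩
  have := hle x ⟨subset_closure hxΩ, hxO⟩
  have h2 : -(j * ρ x) ≤ 2 := hx.2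
  have hj0 : (0 : ℝ) ≤ j := Nat.cast_nonneg _
  nlinarith

lemma isFiniteMeasure_layerMeasure (hΩ : MeasurableSet Ω)
    (hb : Bornology.IsBounded Ω) (hρ : Continuous ρ) (j : ℕ) :
    IsFiniteMeasure (layerMeasure Ω ρ j) := by
  refine ⟨(layerMeasure_le hΩ hρ j MeasurableSet.univ).trans_lt (ENNReal.mul_lt_top ENNReal.ofReal_lt_top ?_)⟩
  exact (measure_mono (fun x hx => hx.1.2)).trans_lt hb.measure_lt_top

end

/-! Growth of the layer measures on balls -/

variable {m : ℕ} {Ω : Set (E (m + 1))} {ρ : E (m + 1) → ℝ}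

/-- On the layer ρ varies by at most 1/j, so its thickness in direction i is at most A/j. The
density is at most 6j, the factors j cancel, and the bound is uniform in j. -/
lemma exists_layerMeasure_closedBall_inter_le (hΩ : MeasurableSet Ω) (hρ : ContDiff ℝ 1 ρ)
    {z : E (m + 1)} (hz : fderiv ℝ ρ z ≠ 0) :
    ∃ s C : ℝ, 0 < s ∧ 0 < C ∧ (∀ (j : ℕ) (c : E (m + 1)) (r : ℝ), 0 ≤ r →
      layerMeasure Ω ρ j (Metric.closedBall c r ∩ Metric.ball z s) ≤ ENNReal.ofReal (C * r ^ m)) ∧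
      Measure.hausdorffMeasure (m : ℝ) ({x | ρ x = 0} ∩ Metric.ball z s) < ∞ := by
  obtain ⟨i, A, s, hA, hs, h⟩ := exists_coordinate
    (hρ.contDiffAt.hasStrictFDerivAt (by norm_num)) hz
  refine ⟨s, 6 * (A * 2 ^ m), hs, by positivity, fun j c r hr => ?_, ?_⟩
  · rcases Nat.eq_zero_or_pos j with rfl | hj
    · simp [layerMeasure]
    have hj : (0 : ℝ) < j := by exact_mod_cast hj
    have hT : MeasurableSet {x | -(j * ρ x) ∈ Icc (1 : ℝ) 2} :=
      (isClosed_Icc.preimage (continuous_const.mul hρ.continuous).neg).measurableSet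
    have hball : MeasurableSet (Metric.closedBall c r ∩ Metric.ball z s) :=
      Metric.isClosed_closedBall.measurableSet.inter Metric.isOpen_ball.measurableSet
    refine (layerMeasure_le hΩ hρ.continuous j hball).trans ?_
    have := volume_le_of_slices i ((hball.inter hΩ).inter hT) (c := c) (ℓ := A * (1 / j)) hr
      (fun x hx => hx.1.1.1) (fun x hx y hy hxy => by
        have h1 := h x hx.1.1.2 y hy.1.1.2
        rw [hxy, sub_self, norm_zero, add_zero] at h1
        refine h1.trans ?_
        gcongr
        have hx2 : -(j * ρ x) ∈ Icc (1 : ℝ) 2 := hx.2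
        have hy2 : -(j * ρ y) ∈ Icc (1 : ℝ) 2 := hy.2
        rw [le_div_iff₀ hj]
        calc |ρ y - ρ x| * j = |(ρ y - ρ x) * j| := by rw [abs_mul, abs_of_pos hj]
          _ ≤ 1 := abs_le.2 ⟨by nlinarith [hx2.1, hx2.2, hy2.1, hy2.2],
            by nlinarith [hx2.1, hx2.2, hy2.1, hy2.2]⟩)
    refine (mul_le_mul_right this _).trans ?_
    rw [← ENNReal.ofReal_mul (by positivity), ← ENNReal.ofReal_mul (by positivity)]
    refine ENNReal.ofReal_le_ofReal (le_of_eq ?_)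
    rw [mul_pow]
    field_simp
  · refine hausdorffMeasure_lt_top_of_slices i (Metric.isBounded_ball.subset inter_subset_right) hA
      fun x hx y hy => ?_
    have h1 := h x hx.2 y hy.2
    rwa [show ρ x = 0 from hx.1, show ρ y = 0 from hy.1, sub_self, abs_zero, zero_add] at h1

/-- A Lebesgue number of a finite cover of the boundary makes the radius and the constant uniform in
the centre. -/
lemma exists_layerMeasure_closedBall_le (hΩ : MeasurableSet Ω) (hb : Bornology.IsBounded Ω)
    (hρ : ContDiff ℝ 1 ρ) (hz : ∀ z ∈ frontier Ω, fderiv ℝ ρ z ≠ 0) :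
    ∃ s C : ℝ, 0 < s ∧ 0 < C ∧ ∀ x ∈ frontier Ω, ∀ (j : ℕ) (r : ℝ), 0 ≤ r → r < s →
      layerMeasure Ω ρ j (Metric.closedBall x r) ≤ ENNReal.ofReal (C * r ^ m) := by
  have hcpt : IsCompact (frontier Ω) :=
    hb.isCompact_closure.of_isClosed_subset isClosed_frontier frontier_subset_closure
  choose! s C hs hC hle _ using fun z hzf => exists_layerMeasure_closedBall_inter_le hΩ hρ (hz z hzf)
  obtain ⟨t, ht, hcov⟩ := hcpt.elim_nhds_subcover (fun z => Metric.ball z (s z))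
    fun z hz => Metric.ball_mem_nhds z (hs z hz)
  have hcov : frontier Ω ⊆ ⋃ z : t, Metric.ball (z : E (m + 1)) (s z) := fun x hx => by
    obtain ⟨z, hzt, hxz⟩ := mem_iUnion₂.1 (hcov hx)
    exact mem_iUnion.2 ⟨⟨z, hzt⟩, hxz⟩
  obtain ⟨δ, hδ, hleb⟩ := lebesgue_number_lemma_of_metric hcpt
    (c := fun z : t => Metric.ball (z : E (m + 1)) (s z)) (fun _ => Metric.isOpen_ball) hcov
  refine ⟨δ, 1 + ∑ z ∈ t, C z, hδ, ?_, fun x hx j r hr hrs => ?_⟩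
  · have : 0 ≤ ∑ z ∈ t, C z := Finset.sum_nonneg fun z hz => (hC z (ht z hz)).le
    linarith
  · obtain ⟨z, hzx⟩ := hleb x hx
    have hsub : Metric.closedBall x r ⊆ Metric.closedBall x r ∩ Metric.ball (z : E (m + 1)) (s z) :=
      fun y hy => ⟨hy, hzx (Metric.closedBall_subset_ball hrs hy)⟩
    refine (measure_mono hsub).trans ((hle z (ht z z.2) j x r hr).trans ?_)
    refine ENNReal.ofReal_le_ofReal ?_
    have := Finset.single_le_sum (f := C) (fun z hz => (hC z (ht z hz)).le) z.2
    gcongr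
    linarith

lemma exists_layerMeasure_univ_le (hΩ : IsOpen Ω) (hb : Bornology.IsBounded Ω)
    (hρ : ContDiff ℝ 1 ρ) (hneg : ∀ x ∈ Ω, ρ x < 0) (hz : ∀ z ∈ frontier Ω, fderiv ℝ ρ z ≠ 0) :
    ∃ M : ℝ, 0 ≤ M ∧ ∀ᶠ j : ℕ in atTop, layerMeasure Ω ρ j univ ≤ ENNReal.ofReal M := by
  have hcpt : IsCompact (frontier Ω) :=
    hb.isCompact_closure.of_isClosed_subset isClosed_frontier frontier_subset_closure
  obtain ⟨s, C, hs, hC, hle⟩ := exists_layerMeasure_closedBall_le hΩ.measurableSet hb hρ hz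
  obtain ⟨t, ht, hcov⟩ := hcpt.elim_nhds_subcover (fun z => Metric.ball z (s / 2))
    fun z hz => Metric.ball_mem_nhds z (half_pos hs)
  refine ⟨∑ z ∈ t, C * (s / 2) ^ m, by positivity, ?_⟩
  have hO : IsOpen (⋃ z ∈ t, Metric.ball z (s / 2)) :=
    isOpen_iUnion fun z => isOpen_iUnion fun _ => Metric.isOpen_ball
  filter_upwards [layerMeasure_eventually_eq_zero hΩ hb hρ.continuous hneg hO hcov] with j hj
  calc layerMeasure Ω ρ j univ ≤ layerMeasure Ω ρ j (⋃ z ∈ t, Metric.ball z (s / 2)) +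
        layerMeasure Ω ρ j (⋃ z ∈ t, Metric.ball z (s / 2))ᶜ := by
        rw [← union_compl_self (⋃ z ∈ t, Metric.ball z (s / 2))]; exact measure_union_le _ _
    _ = layerMeasure Ω ρ j (⋃ z ∈ t, Metric.ball z (s / 2)) := by rw [hj, add_zero]
    _ ≤ ∑ z ∈ t, layerMeasure Ω ρ j (Metric.ball z (s / 2)) := measure_biUnion_finset_le _ _
    _ ≤ ∑ z ∈ t, ENNReal.ofReal (C * (s / 2) ^ m) := by
        refine Finset.sum_le_sum fun z hz => ?_
        exact (measure_mono Metric.ball_subset_closedBall).trans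
          (hle z (ht z hz) j _ (by positivity) (by linarith))
    _ = _ := by rw [ENNReal.ofReal_sum_of_nonneg (fun _ _ => by positivity)]

lemma isFiniteMeasure_surfaceMeasure (hb : Bornology.IsBounded Ω)
    (hΩ : MeasurableSet Ω) (hρ : ContDiff ℝ 1 ρ) (h0 : ∀ z ∈ frontier Ω, ρ z = 0)
    (hz : ∀ z ∈ frontier Ω, fderiv ℝ ρ z ≠ 0) : IsFiniteMeasure (surfaceMeasure Ω) := by
  have hcpt : IsCompact (frontier Ω) :=
    hb.isCompact_closure.of_isClosed_subset isClosed_frontier frontier_subset_closure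
  choose! s C hs hC _ hfin using fun z hzf => exists_layerMeasure_closedBall_inter_le hΩ hρ (hz z hzf)
  obtain ⟨t, ht, hcov⟩ := hcpt.elim_nhds_subcover (fun z => Metric.ball z (s z))
    fun z hz => Metric.ball_mem_nhds z (hs z hz)
  have hH : Measure.hausdorffMeasure (m : ℝ) (frontier Ω) < ∞ := by
    have hsub : frontier Ω ⊆ ⋃ z ∈ t, ({x | ρ x = 0} ∩ Metric.ball z (s z)) := by
      intro x hx
      obtain ⟨z, hzt, hxz⟩ := mem_iUnion₂.1 (hcov hx)
      exact mem_iUnion₂.2 ⟨z, hzt, h0 x hx, hxz⟩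
    refine (measure_mono hsub).trans_lt ((measure_biUnion_finset_le _ _).trans_lt ?_)
    exact ENNReal.sum_lt_top.2 fun z hzt => hfin z (ht z hzt)
  constructor
  rw [surfaceMeasure, Measure.restrict_apply_univ, Measure.euclideanHausdorffMeasure_def,
    Nat.add_sub_cancel, Measure.smul_apply]
  exact ENNReal.mul_lt_top (by simp) hH

end ParabolicISS

namespace ParabolicISS

open Filter Topology

/-! ### Comparison of the boundary layers with the surface measure -/

/-- The portmanteau inequality for open sets, by inner regularity and Urysohn functions between a
closed subset and V. -/
lemma measure_isOpen_le_of_tendsto {X ι : Type*} [MetricSpace X] [MeasurableSpace X]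
    [BorelSpace X] {L : Filter ι} [NeBot L] {μs : ι → FiniteMeasure X} {μ : FiniteMeasure X}
    (h : Tendsto μs L (𝓝 μ)) {V : Set X} (hV : IsOpen V) {c : ℝ} (hc : 0 ≤ c)
    (hle : ∀ᶠ i in L, (μs i : Measure X) V ≤ ENNReal.ofReal c) :
    (μ : Measure X) V ≤ ENNReal.ofReal c := by
  rw [hV.measure_eq_iSup_isClosed]
  refine iSup₂_le fun F hFV => iSup_le fun hF => ?_
  obtain ⟨f, hf0, hf1, hf⟩ := exists_bounded_zero_one_of_closed hV.isClosed_compl hF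
    (disjoint_left.2 fun x hx hxF => hx (hFV hxF))
  have hlim := (FiniteMeasure.tendsto_iff_forall_integral_tendsto.1 h) f
  have hle' : ∫ x, f x ∂(μ : Measure X) ≤ c := by
    refine le_of_tendsto hlim (hle.mono fun i hi => ?_)
    have h1 : ∫ x, f x ∂(μs i : Measure X) ≤ ∫ x, V.indicator (fun _ => (1 : ℝ)) x ∂(μs i : Measure X) := by
      refine integral_mono (f.integrable _) ((integrable_const 1).indicator hV.measurableSet)
        fun x => ?_
      by_cases hx : x ∈ V
      · simpa [hx] using (hf x).2
      · simpa [hx] using (hf0 hx).le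
    refine h1.trans ?_
    rw [integral_indicator_const _ hV.measurableSet, smul_eq_mul, mul_one]
    exact ENNReal.toReal_le_of_le_ofReal hc hi
  have h2 : (μ : Measure X).real F ≤ ∫ x, f x ∂(μ : Measure X) := by
    have := integral_indicator_const (μ := (μ : Measure X)) (1 : ℝ) hF.measurableSet
    rw [smul_eq_mul, mul_one] at this
    rw [← this]
    refine integral_mono ((integrable_const 1).indicator hF.measurableSet) (f.integrable _)
      fun x => ?_
    by_cases hx : x ∈ F
    · simpa [hx] using (hf1 hx).ge
    · simpa [hx] using (hf x).1
  rw [ENNReal.le_ofReal_iff_toReal_le (by finiteness) hc]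
  exact h2.trans hle'

variable {m : ℕ} {Ω : Set (E (m + 1))} {ρ : E (m + 1) → ℝ}

/-- The mass distribution principle: a set of small diameter δ meeting K lies in balls centred in K
of every radius above δ, so its mass is at most C δ^m. -/
lemma le_smul_hausdorffMeasure_of_closedBall_le {μ : Measure (E (m + 1))} {K : Set (E (m + 1))}
    (hK : μ Kᶜ = 0) {s C : ℝ} (hs : 0 < s) (hC : 0 < C)
    (h : ∀ x ∈ K, ∀ r, 0 ≤ r → r < s → μ (Metric.ball x r) ≤ ENNReal.ofReal (C * r ^ m)) :
    μ ≤ ENNReal.ofReal C • Measure.hausdorffMeasure (m : ℝ) := by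
  have hC0 : ENNReal.ofReal C ≠ 0 := by simpa using hC
  have key : (ENNReal.ofReal C)⁻¹ • μ ≤ Measure.hausdorffMeasure (m : ℝ) := by
    refine Measure.le_hausdorffMeasure _ _ (ENNReal.ofReal (s / 2)) (by simpa using hs)
      fun S hS => ?_
    rw [Measure.smul_apply, smul_eq_mul]
    rcases (S ∩ K).eq_empty_or_nonempty with he | ⟨x, hxS, hxK⟩
    · have : μ S = 0 := measure_mono_null (fun x hx hxK => (he ▸ (⟨hx, hxK⟩ : x ∈ S ∩ K) : x ∈ (∅ : Set _))) hK
      simp [this]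
    · have hfin : Metric.ediam S ≠ ∞ := ne_top_of_le_ne_top ENNReal.ofReal_ne_top hS
      set δ := (Metric.ediam S).toReal with hδ
      have hδ0 : 0 ≤ δ := ENNReal.toReal_nonneg
      have hδS : Metric.ediam S = ENNReal.ofReal δ := (ENNReal.ofReal_toReal hfin).symm
      have hδs : δ ≤ s / 2 := by
        rw [hδS] at hS
        exact (ENNReal.ofReal_le_ofReal_iff (by linarith)).1 hS
      have hle : ∀ r, δ < r → r < s → μ S ≤ ENNReal.ofReal (C * r ^ m) := by
        intro r hr hrs
        refine (measure_mono fun y hy => ?_).trans (h x hxK r (by linarith) hrs)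
        have := Metric.edist_le_ediam_of_mem hy hxS
        rw [hδS, edist_dist, ENNReal.ofReal_le_ofReal_iff hδ0] at this
        exact this.trans_lt hr
      have hlim : Tendsto (fun r : ℝ => ENNReal.ofReal (C * r ^ m)) (𝓝[>] δ)
          (𝓝 (ENNReal.ofReal (C * δ ^ m))) :=
        (((ENNReal.continuous_ofReal.comp (by fun_prop : Continuous fun r : ℝ => C * r ^ m)).tendsto
          δ)).mono_left nhdsWithin_le_nhds
      have h1 : μ S ≤ ENNReal.ofReal (C * δ ^ m) := by
        refine ge_of_tendsto hlim ?_
        filter_upwards [Ioo_mem_nhdsGT (show δ < s by linarith)] with r hr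
        exact hle r hr.1 hr.2
      rw [hδS, ENNReal.rpow_natCast, ← ENNReal.ofReal_pow hδ0]
      rw [ENNReal.ofReal_mul hC.le] at h1
      calc (ENNReal.ofReal C)⁻¹ * μ S ≤
          (ENNReal.ofReal C)⁻¹ * (ENNReal.ofReal C * ENNReal.ofReal (δ ^ m)) := by gcongr
        _ = _ := by rw [← mul_assoc, ENNReal.inv_mul_cancel hC0 ENNReal.ofReal_ne_top, one_mul]
  calc μ = ENNReal.ofReal C • ((ENNReal.ofReal C)⁻¹ • μ) := by
        rw [smul_smul, ENNReal.mul_inv_cancel hC0 ENNReal.ofReal_ne_top, one_smul]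
    _ ≤ _ := by gcongr

/-- Along a suitable filter the boundary layers converge weakly, and the limit is dominated by a
multiple of the surface measure. -/
theorem exists_layerMeasure_limit (hΩ : IsOpen Ω) (hb : Bornology.IsBounded Ω)
    (hρ : ContDiff ℝ 1 ρ) (hneg : ∀ x ∈ Ω, ρ x < 0) (h0 : ∀ z ∈ frontier Ω, ρ z = 0)
    (hz : ∀ z ∈ frontier Ω, fderiv ℝ ρ z ≠ 0) :
    ∃ l : Filter ℕ, NeBot l ∧ l ≤ atTop ∧ ∃ K : ℝ, 0 ≤ K ∧
      ∀ D : E (m + 1) → ℝ, ContinuousOn D (closure Ω) → (∀ x ∈ closure Ω, 0 ≤ D x) →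
        ∃ L, Tendsto (fun j => ∫ x, D x ∂layerMeasure Ω ρ j) l (𝓝 L) ∧
          L ≤ K * ∫ x, D x ∂surfaceMeasure Ω := by
  have hcpt : IsCompact (closure Ω) := hb.isCompact_closure
  obtain ⟨s, C, hs, hC, hball⟩ := exists_layerMeasure_closedBall_le hΩ.measurableSet hb hρ hz
  obtain ⟨M, hM, hmass⟩ := exists_layerMeasure_univ_le hΩ hb hρ hneg hz
  have hσ := isFiniteMeasure_surfaceMeasure hb hΩ.measurableSet hρ h0 hz
  let μs : ℕ → FiniteMeasure (E (m + 1)) := fun j =>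
    ⟨layerMeasure Ω ρ j, isFiniteMeasure_layerMeasure hΩ.measurableSet hb hρ.continuous j⟩
  have hsupp : ∀ j, layerMeasure Ω ρ j (closure Ω)ᶜ = 0 := by
    intro j
    refine (withDensity_absolutelyContinuous _ _) ?_
    rw [Measure.restrict_apply isClosed_closure.isOpen_compl.measurableSet]
    convert measure_empty (μ := (volume : Measure (E (m + 1))))
    exact (disjoint_compl_left_iff_subset.2 subset_closure).inter_eq
  -- Prokhorov: the masses are eventually bounded and all layers are carried by the compact closure.
  -- Passing to an ultrafilter gives one limit measure for all test functions, without subsequences.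
  have hprok := isCompact_setOfPred_finiteMeasure_mass_le_compl_isCompact_le
    (u := fun _ => 0) (K := fun _ => closure Ω) M.toNNReal tendsto_const_nhds (fun _ => hcpt)
    (Or.inl inferInstance)
  obtain ⟨μ, -, hμ⟩ := hprok.ultrafilter_le_nhds' ((hyperfilter ℕ).map μs) (by
    rw [Ultrafilter.mem_map]
    refine (Nat.hyperfilter_le_atTop) (hmass.mono fun j hj => ⟨?_, fun _ => ?_⟩)
    · have : ((μs j).mass : ℝ≥0∞) ≤ (M.toNNReal : ℝ≥0∞) := by
        rw [FiniteMeasure.ennreal_mass]; exact hj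
      exact_mod_cast this
    · have : ((μs j) (closure Ω)ᶜ : ℝ≥0∞) ≤ ((0 : NNReal) : ℝ≥0∞) := by
        rw [FiniteMeasure.ennreal_coeFn_eq_coeFn_toMeasure]; exact (hsupp j).le
      exact_mod_cast this)
  have hlim : Tendsto μs (hyperfilter ℕ : Filter ℕ) (𝓝 μ) := hμ
  -- A point off the boundary has a ball that the layers eventually leave, so the limit does not
  -- charge it.
  have hfr : (μ : Measure (E (m + 1))) (frontier Ω)ᶜ = 0 := by
    refine measure_null_of_locally_null _ fun x hx => ?_
    obtain ⟨r, hr, hsub⟩ := Metric.nhds_basis_closedBall.mem_iff.1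
      (isClosed_frontier.isOpen_compl.mem_nhds hx)
    refine ⟨Metric.ball x r, mem_nhdsWithin_of_mem_nhds (Metric.ball_mem_nhds x hr), ?_⟩
    have := measure_isOpen_le_of_tendsto hlim (Metric.isOpen_ball (x := x) (ε := r)) le_rfl (by
      have := layerMeasure_eventually_eq_zero hΩ hb hρ.continuous hneg
        (O := (Metric.closedBall x r)ᶜ) Metric.isClosed_closedBall.isOpen_compl
        (fun y hy hyr => hsub hyr hy)
      refine Nat.hyperfilter_le_atTop (this.mono fun j hj => ?_)
      rw [compl_compl] at hj
      exact (measure_mono Metric.ball_subset_closedBall).trans (hj.le.trans zero_le))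
    simpa using this
  have hle : (μ : Measure (E (m + 1))) ≤ ENNReal.ofReal C • Measure.hausdorffMeasure (m : ℝ) :=
    le_smul_hausdorffMeasure_of_closedBall_le hfr hs hC fun x hx r hr hrs =>
      measure_isOpen_le_of_tendsto hlim Metric.isOpen_ball (by positivity)
        (.of_forall fun j => (measure_mono Metric.ball_subset_closedBall).trans
          (hball x hx j r hr hrs))
  set a := (Measure.addHaarScalarFactor (volume : Measure (EuclideanSpace ℝ (Fin m)))
    (Measure.hausdorffMeasure (m : ℝ))) with ha
  have ha0 : a ≠ 0 := Measure.addHaarScalarFactor_volume_hausdorffMeasure_ne_zero m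
  have hsurf : (surfaceMeasure Ω) = a • (Measure.hausdorffMeasure (m : ℝ)).restrict (frontier Ω) := by
    rw [surfaceMeasure, Measure.euclideanHausdorffMeasure_def, Measure.restrict_smul,
      Nat.add_sub_cancel]
  have hle' : (μ : Measure (E (m + 1))) ≤ (C.toNNReal * a⁻¹) • surfaceMeasure Ω := by
    have h1 : (μ : Measure (E (m + 1))) = (μ : Measure (E (m + 1))).restrict (frontier Ω) := by
      rw [Measure.restrict_eq_self_of_ae_mem]
      exact hfr
    have h2 : (C.toNNReal * a⁻¹) • surfaceMeasure Ω =
        (ENNReal.ofReal C • Measure.hausdorffMeasure (m : ℝ)).restrict (frontier Ω) := by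
      rw [hsurf, smul_smul, mul_assoc, inv_mul_cancel₀ ha0, mul_one, Measure.restrict_smul]
      rfl
    rw [h1, h2]
    exact Measure.restrict_mono_measure hle _
  refine ⟨hyperfilter ℕ, inferInstance, Nat.hyperfilter_le_atTop, (C.toNNReal * a⁻¹ : NNReal),
    NNReal.coe_nonneg _, fun D hD hD0 => ?_⟩
  have : CompactSpace (closure Ω) := isCompact_iff_compactSpace.1 hcpt
  -- Tietze extension: weak convergence needs a bounded continuous function on the whole space, and
  -- all measures involved see only the closure.
  obtain ⟨g, -, hg⟩ := BoundedContinuousFunction.exists_norm_eq_domRestrict_eq_of_closed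
    (BoundedContinuousFunction.mkOfCompact ⟨_, hD.domRestrict⟩) isClosed_closure
  have hgD : ∀ x ∈ closure Ω, g x = D x := fun x hx => DFunLike.congr_fun hg ⟨x, hx⟩
  refine ⟨∫ x, g x ∂(μ : Measure (E (m + 1))), ?_, ?_⟩
  · have := (FiniteMeasure.tendsto_iff_forall_integral_tendsto.1 hlim) g
    refine this.congr fun j => integral_congr_ae ?_
    have : ∀ᵐ x ∂layerMeasure Ω ρ j, x ∈ closure Ω := hsupp j
    exact this.mono fun x hx => hgD x hx
  · have hσae : ∀ᵐ x ∂surfaceMeasure Ω, x ∈ closure Ω :=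
      (ae_restrict_mem isClosed_frontier.measurableSet).mono fun x hx => frontier_subset_closure hx
    have h3 : ∫ x, D x ∂surfaceMeasure Ω = ∫ x, g x ∂surfaceMeasure Ω :=
      integral_congr_ae (hσae.mono fun x hx => (hgD x hx).symm)
    rw [h3, ← smul_eq_mul, ← NNReal.smul_def, ← integral_smul_nnreal_measure]
    refine integral_mono_measure hle' ?_ (g.integrable _)
    refine Measure.ae_smul_measure (hσae.mono fun x hx => ?_) _
    simp only [Pi.zero_apply]
    rw [hgD x hx]
    exact hD0 x hx

end ParabolicISS

namespace ParabolicISS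

open Filter Topology

/-! ### Cutoff functions and integration by parts -/

/-- A primitive of `layerBump`, increasing from `0` to `1`. -/
noncomputable def layerStep (r : ℝ) : ℝ := ∫ t in (1 : ℝ)..r, layerBump t

lemma hasDerivAt_layerStep (r : ℝ) : HasDerivAt layerStep (layerBump r) r :=
  intervalIntegral.integral_hasDerivAt_right (continuous_layerBump.intervalIntegrable 1 r)
    (continuous_layerBump.stronglyMeasurableAtFilter _ _) continuous_layerBump.continuousAt

lemma contDiff_layerStep : ContDiff ℝ 1 layerStep := by
  rw [contDiff_one_iff_deriv]
  refine ⟨fun r => (hasDerivAt_layerStep r).differentiableAt, ?_⟩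
  rw [show deriv layerStep = layerBump from funext fun r => (hasDerivAt_layerStep r).deriv]
  exact continuous_layerBump

lemma monotone_layerStep : Monotone layerStep :=
  monotone_of_deriv_nonneg (fun r => (hasDerivAt_layerStep r).differentiableAt) fun r => by
    rw [(hasDerivAt_layerStep r).deriv]; exact layerBump_nonneg r

lemma layerStep_of_le {r : ℝ} (h : r ≤ 1) : layerStep r = 0 := by
  rw [layerStep, intervalIntegral.integral_symm, neg_eq_zero]
  refine intervalIntegral.integral_zero_ae (.of_forall fun t ht => ?_)
  rw [uIoc_of_le h] at ht
  rw [layerBump, max_eq_left]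
  nlinarith [ht.2]

/-- This normalisation is the reason for the factor 6 in `layerBump`. -/
lemma layerStep_two : layerStep 2 = 1 := by
  have : ∀ t ∈ uIcc (1 : ℝ) 2, layerBump t = -12 + 18 * t - 6 * t ^ 2 := by
    intro t ht
    rw [uIcc_of_le (by norm_num)] at ht
    rw [layerBump, max_eq_right (mul_nonneg (by norm_num)
      (mul_nonneg (by linarith [ht.1]) (by linarith [ht.2])))]
    ring
  rw [layerStep, intervalIntegral.integral_congr this, intervalIntegral.integral_sub,
    intervalIntegral.integral_add, intervalIntegral.integral_const_mul,
    intervalIntegral.integral_const_mul, integral_id, integral_pow]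
  · norm_num
  all_goals exact Continuous.intervalIntegrable (by fun_prop) _ _

lemma layerStep_of_ge {r : ℝ} (h : 2 ≤ r) : layerStep r = 1 := by
  rw [← layerStep_two, ← sub_eq_zero, layerStep, layerStep,
    intervalIntegral.integral_interval_sub_left (continuous_layerBump.intervalIntegrable _ _)
    (continuous_layerBump.intervalIntegrable _ _)]
  refine intervalIntegral.integral_zero_ae (.of_forall fun t ht => ?_)
  rw [uIoc_of_le h] at ht
  rw [layerBump, max_eq_left]
  nlinarith [ht.1]

lemma layerStep_nonneg (r : ℝ) : 0 ≤ layerStep r := by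
  rw [← layerStep_of_le (min_le_left 1 r)]
  exact monotone_layerStep (min_le_right 1 r)

lemma layerStep_le_one (r : ℝ) : layerStep r ≤ 1 := by
  rw [← layerStep_of_ge (le_max_left 2 r)]
  exact monotone_layerStep (le_max_right 2 r)

variable {n : ℕ} {Ω : Set (E n)} {ρ : E n → ℝ}

/-- A cutoff function on `Ω`, equal to `1` away from a boundary layer of width `∼ 1/j`. -/
noncomputable def cutoff (Ω : Set (E n)) (ρ : E n → ℝ) (j : ℕ) : E n → ℝ :=
  Ω.indicator fun x => layerStep (-(j * ρ x))

lemma cutoff_nonneg (j : ℕ) (x : E n) : 0 ≤ cutoff Ω ρ j x :=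
  indicator_nonneg (fun _ _ => layerStep_nonneg _) x

lemma cutoff_le_one (j : ℕ) (x : E n) : cutoff Ω ρ j x ≤ 1 :=
  indicator_le' (fun _ _ => layerStep_le_one _) (fun _ _ => zero_le_one) x

lemma support_cutoff_subset (j : ℕ) :
    Function.support (cutoff Ω ρ j) ⊆ closure Ω ∩ {x | 1 ≤ -(j * ρ x)} := by
  intro x hx
  rw [Function.mem_support, cutoff] at hx
  have hxΩ : x ∈ Ω := by
    by_contra hc; exact hx (indicator_of_notMem hc _)
  rw [indicator_of_mem hxΩ] at hx
  refine ⟨subset_closure hxΩ, ?_⟩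
  by_contra hc
  exact hx (layerStep_of_le (not_le.1 hc).le)

lemma tsupport_cutoff_subset' (hρ : Continuous ρ) (j : ℕ) :
    tsupport (cutoff Ω ρ j) ⊆ closure Ω ∩ {x | 1 ≤ -(j * ρ x)} :=
  closure_minimal (support_cutoff_subset j) (isClosed_closure.inter
    (isClosed_le continuous_const (by fun_prop)))

lemma tsupport_cutoff_subset (hΩ : IsOpen Ω) (hρ : Continuous ρ)
    (h0 : ∀ x ∈ frontier Ω, ρ x = 0) (j : ℕ) : tsupport (cutoff Ω ρ j) ⊆ Ω := by
  intro x hx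
  obtain ⟨hxc, hx1⟩ := tsupport_cutoff_subset' hρ j hx
  by_contra hc
  have := h0 x (by rw [hΩ.frontier_eq]; exact ⟨hxc, hc⟩)
  rw [mem_ofPred_eq, this] at hx1
  norm_num at hx1

lemma hasCompactSupport_cutoff (hb : Bornology.IsBounded Ω) (hρ : Continuous ρ) (j : ℕ) :
    HasCompactSupport (cutoff Ω ρ j) :=
  hb.isCompact_closure.of_isClosed_subset (isClosed_tsupport _)
    ((tsupport_cutoff_subset' hρ j).trans inter_subset_left)

/-- The indicator does no harm: since ρ = 0 on the boundary, the function already vanishes near it,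
and outside Ω it is locally zero. -/
lemma contDiff_cutoff (hΩ : IsOpen Ω) (hρ : ContDiff ℝ 1 ρ)
    (h0 : ∀ x ∈ frontier Ω, ρ x = 0) (j : ℕ) : ContDiff ℝ 1 (cutoff Ω ρ j) := by
  rw [contDiff_iff_contDiffAt]
  intro x
  by_cases hx : x ∈ Ω
  · have h1 : ContDiff ℝ 1 fun x => layerStep (-(j * ρ x)) :=
      contDiff_layerStep.comp (contDiff_const.mul hρ).neg
    refine h1.contDiffAt.congr_of_eventuallyEq ?_
    filter_upwards [hΩ.mem_nhds hx] with y hy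
    exact indicator_of_mem hy _
  · have : x ∉ tsupport (cutoff Ω ρ j) :=
      fun hc => hx (tsupport_cutoff_subset hΩ hρ.continuous h0 j hc)
    exact contDiffAt_const.congr_of_eventuallyEq (notMem_tsupport_iff_eventuallyEq.1 this)

/-- The minus sign turns -∇χ·F into the flux of F along ∇ρ, the outward direction, weighted with the
density of `layerMeasure`. -/
lemma fderiv_cutoff (hΩ : IsOpen Ω) (hρ : ContDiff ℝ 1 ρ) (j : ℕ) {x : E n} (hx : x ∈ Ω) :
    fderiv ℝ (cutoff Ω ρ j) x = -((j * layerBump (-(j * ρ x))) • fderiv ℝ ρ x) := by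
  have hd : HasFDerivAt ρ (fderiv ℝ ρ x) x :=
    (hρ.differentiable (by norm_num)).differentiableAt.hasFDerivAt
  have h1 := (hasDerivAt_layerStep (-(j * ρ x))).comp_hasFDerivAt x (hd.const_mul (j : ℝ)).neg
  have h2 := h1.congr_of_eventuallyEq (f₁ := cutoff Ω ρ j) (by
    filter_upwards [hΩ.mem_nhds hx] with y hy
    exact indicator_of_mem hy _)
  rw [h2.fderiv]
  ext v
  simp
  ring

lemma tendsto_cutoff (hneg : ∀ x ∈ Ω, ρ x < 0) {x : E n} (hx : x ∈ Ω) :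
    Tendsto (fun j => cutoff Ω ρ j x) atTop (𝓝 1) := by
  refine tendsto_const_nhds.congr' ?_
  have := hneg x hx
  filter_upwards [eventually_ge_atTop ⌈2 / (-ρ x)⌉₊] with j hj
  have hj' : 2 / (-ρ x) ≤ j := (Nat.le_ceil _).trans (by exact_mod_cast hj)
  rw [div_le_iff₀ (by linarith)] at hj'
  rw [cutoff, indicator_of_mem hx, layerStep_of_ge (by linarith)]

lemma continuous_mul_of_tsupport_subset {X : Type*} [TopologicalSpace X] {Ω : Set X}
    (hΩ : IsOpen Ω) {χ u : X → ℝ} (hχ : Continuous χ) (hs : tsupport χ ⊆ Ω)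
    (hu : ContinuousOn u Ω) : Continuous fun x => χ x * u x :=
  (hχ.continuousOn.mul hu).continuous_of_tsupport_subset hΩ ((tsupport_mul_subset_left).trans hs)

lemma integrable_mul_of_tsupport_subset (hΩ : IsOpen Ω) {χ u : E n → ℝ} (hχ : Continuous χ)
    (hc : HasCompactSupport χ) (hs : tsupport χ ⊆ Ω) (hu : ContinuousOn u Ω) :
    Integrable (fun x => χ x * u x) :=
  (continuous_mul_of_tsupport_subset hΩ hχ hs hu).integrable_of_hasCompactSupport hc.mul_right

lemma integral_fderiv_apply_eq_zero {f : E n → ℝ} (hf : ContDiff ℝ 1 f)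
    (hc : HasCompactSupport f) (v : E n) : ∫ x, fderiv ℝ f x v = 0 := by
  have h1 : Integrable fun x => fderiv ℝ f x v :=
    ((hf.continuous_fderiv (by norm_num)).clm_apply continuous_const).integrable_of_hasCompactSupport
      (hc.fderiv_apply ℝ v)
  have := integral_mul_fderiv_eq_neg_fderiv_mul_of_integrable (μ := (volume : Measure (E n)))
    (f := f) (g := fun _ => (1 : ℝ)) (v := v) (by simpa using h1) (by simp)
    (by simpa using hf.continuous.integrable_of_hasCompactSupport hc)
    (fun x _ => (hf.differentiable (by norm_num)).differentiableAt)
    (fun x _ => differentiableAt_const _)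
  simpa using this

lemma divergence_smul {χ : E n → ℝ} {F : E n → E n} {x : E n} (hχ : DifferentiableAt ℝ χ x)
    (hF : DifferentiableAt ℝ F x) : divergence (fun x => χ x • F x) x =
      χ x * divergence F x + fderiv ℝ χ x (F x) := by
  have h1 : fderiv ℝ (fun x => χ x • F x) x =
      χ x • fderiv ℝ F x + (fderiv ℝ χ x).smulRight (F x) :=
    (hχ.hasFDerivAt.smul hF.hasFDerivAt).fderiv
  have h2 : fderiv ℝ χ x (F x) = ∑ i, fderiv ℝ χ x (EuclideanSpace.single i 1) * F x i := by
    have : F x = ∑ i, F x i • EuclideanSpace.single i (1 : ℝ) := by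
      ext l
      simp [Pi.single_apply]
    conv_lhs => rw [this, map_sum]
    refine Finset.sum_congr rfl fun i _ => ?_
    rw [map_smul, smul_eq_mul, mul_comm]
  rw [divergence, divergence, h1, h2, Finset.mul_sum, ← Finset.sum_add_distrib]
  refine Finset.sum_congr rfl fun i _ => ?_
  simp

lemma continuousOn_divergence (hΩ : IsOpen Ω) {F : E n → E n} (hF : ContDiffOn ℝ 1 F Ω) :
    ContinuousOn (divergence F) Ω := by
  have := hF.continuousOn_fderiv_of_isOpen hΩ (by norm_num)
  refine continuousOn_finsetSum _ fun i _ => ?_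
  exact (EuclideanSpace.proj (𝕜 := ℝ) i : E n →L[ℝ] ℝ).continuous.comp_continuousOn
    (this.clm_apply continuousOn_const)

lemma integrable_fderiv_apply (hΩ : IsOpen Ω) {χ : E n → ℝ} (hχ : ContDiff ℝ 1 χ)
    (hc : HasCompactSupport χ) (hs : tsupport χ ⊆ Ω) {F : E n → E n} (hF : ContinuousOn F Ω) :
    Integrable fun x => fderiv ℝ χ x (F x) := by
  have hcont : Continuous fun x => fderiv ℝ χ x (F x) := by
    refine (((hχ.continuous_fderiv (by norm_num)).continuousOn.clm_apply
      hF)).continuous_of_tsupport_subset hΩ ?_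
    refine (closure_mono ?_).trans ((tsupport_fderiv_subset ℝ (f := χ)).trans hs)
    intro x hx hx'
    exact hx (by simp [hx'])
  refine hcont.integrable_of_hasCompactSupport ((hc.fderiv ℝ).mono ?_)
  intro x hx hx'
  exact hx (by simp [hx'])

/-- Integration by parts for a compactly supported weight. -/
theorem integral_mul_divergence (hΩ : IsOpen Ω) {χ : E n → ℝ} (hχ : ContDiff ℝ 1 χ)
    (hc : HasCompactSupport χ) (hs : tsupport χ ⊆ Ω) {F : E n → E n} (hF : ContDiffOn ℝ 1 F Ω) :
    ∫ x in Ω, χ x * divergence F x = -∫ x in Ω, fderiv ℝ χ x (F x) := by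
  have hFd : ∀ x ∈ Ω, DifferentiableAt ℝ F x := fun x hx =>
    (hF.contDiffAt (hΩ.mem_nhds hx)).differentiableAt (by norm_num)
  have hχd : ∀ x, DifferentiableAt ℝ χ x := fun x =>
    (hχ.differentiable (by norm_num)).differentiableAt
  have hH : ContDiff ℝ 1 fun x => χ x • F x := by
    rw [contDiff_iff_contDiffAt]
    intro x
    by_cases hx : x ∈ Ω
    · exact hχ.contDiffAt.smul (hF.contDiffAt (hΩ.mem_nhds hx))
    · have : x ∉ tsupport χ := fun h => hx (hs h)
      refine (contDiffAt_const (c := 0)).congr_of_eventuallyEq ?_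
      filter_upwards [notMem_tsupport_iff_eventuallyEq.1 this] with y hy
      simp [hy]
  have hHc : HasCompactSupport fun x => χ x • F x := hc.smul_right
  have hHi : ∀ i, ContDiff ℝ 1 fun x => (χ x • F x) i := fun i => contDiff_euclidean.1 hH i
  have hHic : ∀ i, HasCompactSupport fun x => (χ x • F x) i := fun i =>
    hHc.comp_left (g := fun y : E n => y i) rfl
  have hdiv0 : ∫ x, divergence (fun x => χ x • F x) x = 0 := by
    have e : ∀ x i, fderiv ℝ (fun x => χ x • F x) x (EuclideanSpace.single i 1) i =
        fderiv ℝ (fun x => (χ x • F x) i) x (EuclideanSpace.single i 1) := by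
      intro x i
      have h1 : HasFDerivAt (fun x => χ x • F x) (fderiv ℝ (fun x => χ x • F x) x) x :=
        (hH.differentiable (by norm_num)).differentiableAt.hasFDerivAt
      have h2 := (EuclideanSpace.proj (𝕜 := ℝ) i : E n →L[ℝ] ℝ).hasFDerivAt.comp x h1
      have h3 : fderiv ℝ (fun x => (χ x • F x) i) x = _ := h2.fderiv
      rw [h3]
      rfl
    simp only [divergence, e]
    rw [integral_finsetSum]
    · exact Finset.sum_eq_zero fun i _ => integral_fderiv_apply_eq_zero (hHi i) (hHic i) _
    · intro i _
      exact (((hHi i).continuous_fderiv (by norm_num)).clm_apply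
        continuous_const).integrable_of_hasCompactSupport ((hHic i).fderiv_apply ℝ _)
  have hpt : ∀ x ∈ Ω, divergence (fun x => χ x • F x) x =
      χ x * divergence F x + fderiv ℝ χ x (F x) :=
    fun x hx => divergence_smul (hχd x) (hFd x hx)
  have hout : ∀ x, x ∉ Ω → divergence (fun x => χ x • F x) x = 0 := by
    intro x hx
    have : x ∉ tsupport χ := fun h => hx (hs h)
    have h0 : (fun x => χ x • F x) =ᶠ[𝓝 x] fun _ => 0 := by
      filter_upwards [notMem_tsupport_iff_eventuallyEq.1 this] with y hy
      simp [hy]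
    simp [divergence, h0.fderiv_eq]
  rw [← setIntegral_eq_integral_of_forall_compl_eq_zero (s := Ω) hout,
    setIntegral_congr_fun hΩ.measurableSet hpt, integral_add] at hdiv0
  · linarith
  · exact (integrable_mul_of_tsupport_subset hΩ hχ.continuous hc hs
      (continuousOn_divergence hΩ hF)).integrableOn
  · exact (integrable_fderiv_apply hΩ hχ hc hs hF.continuousOn).integrableOn

end ParabolicISS

namespace ParabolicISS

open Filter Topology

/-! ### The energy inequality with a weight -/

variable {n : ℕ} {Ω : Set (E n)}

lemma fderiv_apply_eq_inner_gradient (u : E n → ℝ) (x v : E n) :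
    fderiv ℝ u x v = inner ℝ (gradient u x) v := by
  rw [gradient, InnerProductSpace.toDual_symm_apply]

lemma contDiffOn_gradient (hΩ : IsOpen Ω) {u : E n → ℝ} (hu : ContDiffOn ℝ 2 u Ω) :
    ContDiffOn ℝ 1 (gradient u) Ω :=
  (InnerProductSpace.toDual ℝ (E n)).symm.contDiff.comp_contDiffOn
    (hu.fderiv_of_isOpen hΩ (by norm_num))

/-- Testing the diffusion with g(u) produces the dissipation A g'(u)|∇u|², which dominates the drift
κ x·∇u by completing a square; the price is the zeroth-order term with coefficient (κR)²/(4 aLow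
min(1,δ₀)). As g need not be differentiable at 0, this is done for `oddReg φ δ`, followed by δ → 0.
-/
lemma integral_diffusion_le (hΩ : IsOpen Ω) {χ : E n → ℝ} (hχ : ContDiff ℝ 1 χ)
    (hc : HasCompactSupport χ) (hs : tsupport χ ⊆ Ω) (hχ0 : ∀ x, 0 ≤ χ x)
    {φ : ℝ → ℝ} {δ₀ δ₁ : ℝ} (hφ : IsTolksdorf φ δ₀ δ₁) {u A : E n → ℝ}
    (hu : ContDiffOn ℝ 2 u Ω) (hA : ContDiffOn ℝ 1 A Ω) {M aLow R κ : ℝ}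
    (hM : ∀ x ∈ Ω, |u x| ≤ M) (ha : 0 < aLow) (haA : ∀ x ∈ Ω, aLow ≤ A x)
    (hR : ∀ x ∈ Ω, ‖x‖ ≤ R) (hκ : 0 ≤ κ) :
    ∫ x in Ω, (χ x * (divergence (fun y => A y • gradient u y) x - κ * inner ℝ x (gradient u x)
      - (κ * R) ^ 2 / (4 * (aLow * min 1 δ₀)) * u x) + fderiv ℝ χ x (A x • gradient u x)) *
        oddExt φ (u x) ≤ 0 := by
  have hgr := contDiffOn_gradient hΩ hu
  have hV : ContDiffOn ℝ 1 (fun y => A y • gradient u y) Ω := hA.smul hgr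
  have hdiv := continuousOn_divergence hΩ hV
  set B := (κ * R) ^ 2 / (4 * (aLow * min 1 δ₀)) with hB
  have hm : 0 < min 1 δ₀ := lt_min one_pos hφ.δ₀_pos
  have hP : ContinuousOn (fun x => divergence (fun y => A y • gradient u y) x
      - κ * inner ℝ x (gradient u x) - B * u x) Ω :=
    (hdiv.sub (continuousOn_const.mul (continuousOn_id.inner hgr.continuousOn))).sub
      (continuousOn_const.mul hu.continuousOn)
  set Q : E n → ℝ := fun x => χ x * (divergence (fun y => A y • gradient u y) x
    - κ * inner ℝ x (gradient u x) - B * u x) + fderiv ℝ χ x (A x • gradient u x) with hQ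
  have hQi : IntegrableOn Q Ω :=
    ((integrable_mul_of_tsupport_subset hΩ hχ.continuous hc hs hP).add
      (integrable_fderiv_apply hΩ hχ hc hs hV.continuousOn)).integrableOn
  have hreg : ∀ δ : ℝ, 0 < δ → ∫ x in Ω, Q x * oddReg φ δ (u x) ≤ 0 := by
    intro δ hδ
    obtain ⟨g', hg'c, hg', hg'le⟩ := hφ.exists_hasDerivAt_oddReg hδ
    have hgC : ContDiff ℝ 1 (oddReg φ δ) := by
      rw [contDiff_one_iff_deriv]
      refine ⟨fun s => (hg' s).differentiableAt, ?_⟩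
      rwa [show deriv (oddReg φ δ) = g' from funext fun s => (hg' s).deriv]
    have hgu : ContDiffOn ℝ 1 (fun x => oddReg φ δ (u x)) Ω :=
      hgC.comp_contDiffOn (hu.of_le (by norm_num))
    have hF : ContDiffOn ℝ 1 (fun x => oddReg φ δ (u x) • (A x • gradient u x)) Ω := hgu.smul hV
    have hibp := integral_mul_divergence hΩ hχ hc hs hF
    have hpt : ∀ x ∈ Ω, Q x * oddReg φ δ (u x) ≤
        χ x * divergence (fun x => oddReg φ δ (u x) • (A x • gradient u x)) x +
          fderiv ℝ χ x (oddReg φ δ (u x) • (A x • gradient u x)) := by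
      intro x hx
      have hud : DifferentiableAt ℝ u x :=
        (hu.contDiffAt (hΩ.mem_nhds hx)).differentiableAt (by norm_num)
      have hVd : DifferentiableAt ℝ (fun y => A y • gradient u y) x :=
        (hV.contDiffAt (hΩ.mem_nhds hx)).differentiableAt (by norm_num)
      have hgd := (hg' (u x)).comp_hasFDerivAt x hud.hasFDerivAt
      have hgd' : HasFDerivAt (fun x => oddReg φ δ (u x)) (g' (u x) • fderiv ℝ u x) x := hgd
      rw [divergence_smul hgd'.differentiableAt hVd, hgd'.fderiv]
      simp only [smul_apply, map_smul, smul_eq_mul,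
        fderiv_apply_eq_inner_gradient u x, real_inner_self_eq_norm_sq]
      have key : 0 ≤ g' (u x) * (A x * ‖gradient u x‖ ^ 2)
          + (κ * inner ℝ x (gradient u x) + B * u x) * oddReg φ δ (u x) := by
        have hr : 0 < √(u x ^ 2 + δ) := Real.sqrt_pos.2 (by positivity)
        have hq : 0 < φ √(u x ^ 2 + δ) / √(u x ^ 2 + δ) := div_pos (hφ.pos _ hr) hr
        have h1 := hg'le (u x)
        rw [oddReg]
        set q := φ √(u x ^ 2 + δ) / √(u x ^ 2 + δ)
        have h2 : |inner ℝ x (gradient u x)| ≤ R * ‖gradient u x‖ :=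
          (abs_real_inner_le_norm _ _).trans (by gcongr; exact hR x hx)
        set N := ‖gradient u x‖ with hN
        have hN0 : 0 ≤ N := norm_nonneg _
        have hR0 : 0 ≤ R := (norm_nonneg x).trans (hR x hx)
        have h3 : aLow * (min 1 δ₀ * q) * N ^ 2 ≤ g' (u x) * (A x * N ^ 2) := by
          have h5 : aLow * (min 1 δ₀ * q) ≤ A x * g' (u x) :=
            mul_le_mul (haA x hx) h1 (by positivity) (ha.le.trans (haA x hx))
          nlinarith [sq_nonneg N]
        have h4 : -(κ * R * N * |u x|) ≤ κ * inner ℝ x (gradient u x) * u x := by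
          have : |κ * inner ℝ x (gradient u x) * u x| ≤ κ * (R * N) * |u x| := by
            rw [abs_mul, abs_mul, abs_of_nonneg hκ]
            gcongr
          have := (abs_le.1 this).1
          linarith
        set e := aLow * min 1 δ₀ with he
        have he0 : 0 < e := by positivity
        -- The difference of the two sides is the square (2eN - κR|u|)²/(4e), which determines B.
        -- Dissipation, drift and the B-term all carry the common factor q.
        have h6 : κ * R * N * |u x| ≤ e * N ^ 2 + B * u x ^ 2 := by
          rw [hB, ← sq_abs (u x), div_mul_eq_mul_div, ← sub_nonneg]
          have : e * N ^ 2 + (κ * R) ^ 2 * |u x| ^ 2 / (4 * e) - κ * R * N * |u x| =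
              (2 * e * N - κ * R * |u x|) ^ 2 / (4 * e) := by
            field_simp; ring
          rw [this]; positivity
        have h7 : 0 ≤ (e * N ^ 2 + κ * inner ℝ x (gradient u x) * u x + B * u x ^ 2) * q :=
          mul_nonneg (by linarith) hq.le
        nlinarith
      have := mul_nonneg (hχ0 x) key
      simp only [hQ, map_smul, smul_eq_mul]
      linarith
    have hi1 : IntegrableOn (fun x => χ x *
        divergence (fun x => oddReg φ δ (u x) • (A x • gradient u x)) x) Ω :=
      (integrable_mul_of_tsupport_subset hΩ hχ.continuous hc hs
        (continuousOn_divergence hΩ hF)).integrableOn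
    have hi2 : IntegrableOn (fun x => fderiv ℝ χ x (oddReg φ δ (u x) • (A x • gradient u x))) Ω :=
      (integrable_fderiv_apply hΩ hχ hc hs hF.continuousOn).integrableOn
    have hi3 : IntegrableOn (fun x => Q x * oddReg φ δ (u x)) Ω := by
      have h1 := integrable_mul_of_tsupport_subset hΩ hχ.continuous hc hs
        (hP.mul hgu.continuousOn)
      have h2 := integrable_fderiv_apply hΩ hχ hc hs hF.continuousOn
      refine (h1.add h2).integrableOn.congr_fun (fun x _ => ?_) hΩ.measurableSet
      simp only [hQ, Pi.add_apply, Pi.mul_apply, map_smul, smul_eq_mul]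
      ring
    have := setIntegral_mono_on hi3 (hi1.add hi2) hΩ.measurableSet hpt
    rw [integral_add' hi1 hi2, hibp] at this
    linarith
  have hlim : Tendsto (fun δ => ∫ x in Ω, Q x * oddReg φ δ (u x)) (𝓝[>] 0)
      (𝓝 (∫ x in Ω, Q x * oddExt φ (u x))) := by
    -- The majorant uses |u| ≤ M, the monotonicity of φ and δ < 1.
    refine tendsto_integral_filter_of_dominated_convergence
      (fun x => |Q x| * φ √(M ^ 2 + 1)) ?_ ?_ (hQi.abs.mul_const _) ?_
    · filter_upwards [self_mem_nhdsWithin] with δ hδ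
      obtain ⟨g', -, hg', -⟩ := hφ.exists_hasDerivAt_oddReg hδ
      have hcg : Continuous (oddReg φ δ) :=
        continuous_iff_continuousAt.2 fun s => (hg' s).continuousAt
      exact hQi.aestronglyMeasurable.mul
        ((hcg.comp_continuousOn hu.continuousOn).aestronglyMeasurable hΩ.measurableSet)
    · filter_upwards [Ioo_mem_nhdsGT (zero_lt_one' ℝ)] with δ hδ
      refine (ae_restrict_mem hΩ.measurableSet).mono fun x hx => ?_
      rw [Real.norm_eq_abs, abs_mul]
      refine mul_le_mul_of_nonneg_left ((hφ.abs_oddReg_le δ (u x) hδ.1.le).trans ?_) (abs_nonneg _)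
      refine hφ.monotoneOn (Real.sqrt_nonneg _) (Real.sqrt_nonneg _) (Real.sqrt_le_sqrt ?_)
      have : u x ^ 2 ≤ M ^ 2 := sq_le_sq' (by linarith [(abs_le.1 (hM x hx)).1])
        (abs_le.1 (hM x hx)).2
      linarith [hδ.2]
    · exact .of_forall fun x => (hφ.tendsto_oddReg (u x)).const_mul (Q x)
  exact le_of_tendsto hlim (eventually_mem_nhdsWithin.mono fun δ hδ => hreg δ hδ)

/-- The bracket is the divergence of Φ(|u|) b. Since Φ(|·|) is C¹, no regularisation is needed here.
-/
lemma integral_advection (hΩ : IsOpen Ω) {χ : E n → ℝ} (hχ : ContDiff ℝ 1 χ)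
    (hc : HasCompactSupport χ) (hs : tsupport χ ⊆ Ω)
    {φ : ℝ → ℝ} {δ₀ δ₁ : ℝ} (hφ : IsTolksdorf φ δ₀ δ₁) {u : E n → ℝ} {b : E n → E n}
    (hu : ContDiffOn ℝ 1 u Ω) (hb : ContDiffOn ℝ 1 b Ω) :
    ∫ x in Ω, χ x * (youngFunction φ |u x| * divergence b x +
        oddExt φ (u x) * inner ℝ (b x) (gradient u x)) =
      -∫ x in Ω, fderiv ℝ χ x (youngFunction φ |u x| • b x) := by
  have hG : ContDiff ℝ 1 fun s => youngFunction φ |s| := by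
    rw [contDiff_one_iff_deriv]
    refine ⟨fun s => (hφ.hasDerivAt_youngFunction_abs s).differentiableAt, ?_⟩
    rw [show deriv (fun s => youngFunction φ |s|) = oddExt φ from
      funext fun s => (hφ.hasDerivAt_youngFunction_abs s).deriv]
    exact hφ.continuous_oddExt
  have hF : ContDiffOn ℝ 1 (fun x => youngFunction φ |u x| • b x) Ω :=
    (hG.comp_contDiffOn hu).smul hb
  rw [← integral_mul_divergence hΩ hχ hc hs hF]
  refine setIntegral_congr_fun hΩ.measurableSet fun x hx => ?_
  have hud : DifferentiableAt ℝ u x :=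
    (hu.contDiffAt (hΩ.mem_nhds hx)).differentiableAt (by norm_num)
  have hbd : DifferentiableAt ℝ b x :=
    (hb.contDiffAt (hΩ.mem_nhds hx)).differentiableAt (by norm_num)
  have hgd : HasFDerivAt (fun x => youngFunction φ |u x|) (oddExt φ (u x) • fderiv ℝ u x) x :=
    (hφ.hasDerivAt_youngFunction_abs (u x)).comp_hasFDerivAt x hud.hasFDerivAt
  have := divergence_smul hgd.differentiableAt hbd
  rw [hgd.fderiv] at this
  simp only [this, smul_apply, smul_eq_mul, fderiv_apply_eq_inner_gradient]
  rw [real_inner_comm]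

lemma divergence_sub_smul_id {b : E n → E n} {x : E n} (hb : DifferentiableAt ℝ b x) (κ : ℝ) :
    divergence (fun y => b y - κ • y) x = divergence b x - κ * n := by
  have h : fderiv ℝ (fun y => b y - κ • y) x = fderiv ℝ b x - κ • ContinuousLinearMap.id ℝ (E n) :=
    (hb.hasFDerivAt.sub ((hasFDerivAt_id x).const_smul κ)).fderiv
  simp [divergence, h, mul_comm]

/-- The energy inequality with a compactly supported weight. -/
theorem integral_energy_le (hΩ : IsOpen Ω) {χ : E n → ℝ} (hχ : ContDiff ℝ 1 χ)
    (hc : HasCompactSupport χ) (hs : tsupport χ ⊆ Ω) (hχ0 : ∀ x, 0 ≤ χ x)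
    {φ : ℝ → ℝ} {δ₀ δ₁ : ℝ} (hφ : IsTolksdorf φ δ₀ δ₁) {u A r : E n → ℝ} {b : E n → E n}
    (hu : ContDiffOn ℝ 2 u Ω) (hA : ContDiffOn ℝ 1 A Ω) (hb : ContDiffOn ℝ 1 b Ω)
    (hr : ContinuousOn r Ω) {M aLow R κ : ℝ}
    (hM : ∀ x ∈ Ω, |u x| ≤ M) (ha : 0 < aLow) (haA : ∀ x ∈ Ω, aLow ≤ A x)
    (hR : ∀ x ∈ Ω, ‖x‖ ≤ R) (hκ : 0 ≤ κ) :
    ∫ x in Ω, χ x * (oddExt φ (u x) * (divergence (fun y => A y • gradient u y) x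
        - inner ℝ (b x) (gradient u x) - r x)) ≤
      (∫ x in Ω, χ x * ((κ * R) ^ 2 / (4 * (aLow * min 1 δ₀)) * (u x * oddExt φ (u x))
        + youngFunction φ |u x| * (divergence b x - κ * n) - oddExt φ (u x) * r x))
      + ∫ x in Ω, -fderiv ℝ χ x ((oddExt φ (u x) * A x) • gradient u x
          - youngFunction φ |u x| • (b x - κ • x)) := by
  have h1 := integral_diffusion_le hΩ hχ hc hs hχ0 hφ hu hA hM ha haA hR hκ
  -- Advection by b - κx yields the additional damping κnΦ; the discrepancy κ x·∇u is exactly the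
  -- drift included in `integral_diffusion_le`, so the two cancel in the identity below.
  have hb' : ContDiffOn ℝ 1 (fun y => b y - κ • y) Ω := hb.sub (contDiffOn_id.const_smul κ)
  have h2 := integral_advection hΩ hχ hc hs hφ (hu.of_le (by norm_num)) hb'
  set B := (κ * R) ^ 2 / (4 * (aLow * min 1 δ₀)) with hB
  have hgr := contDiffOn_gradient hΩ hu
  have hV : ContDiffOn ℝ 1 (fun y => A y • gradient u y) Ω := hA.smul hgr
  have hdiv := continuousOn_divergence hΩ hV
  have hdivb := continuousOn_divergence hΩ hb
  have hdivb' := continuousOn_divergence hΩ hb'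
  have hgu : ContinuousOn (fun x => oddExt φ (u x)) Ω :=
    hφ.continuous_oddExt.comp_continuousOn hu.continuousOn
  have hGu : ContinuousOn (fun x => youngFunction φ |u x|) Ω :=
    hφ.continuous_youngFunction_abs.comp_continuousOn hu.continuousOn
  have I1 : ∀ f : E n → ℝ, ContinuousOn f Ω → IntegrableOn (fun x => χ x * f x) Ω :=
    fun f hf => (integrable_mul_of_tsupport_subset hΩ hχ.continuous hc hs hf).integrableOn
  have I2 : ∀ F : E n → E n, ContinuousOn F Ω → IntegrableOn (fun x => fderiv ℝ χ x (F x)) Ω :=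
    fun F hF => (integrable_fderiv_apply hΩ hχ hc hs hF).integrableOn
  have hbgr : ContinuousOn (fun x => inner ℝ (b x) (gradient u x)) Ω :=
    hb.continuousOn.inner hgr.continuousOn
  have hbgr' : ContinuousOn (fun x => inner ℝ (b x - κ • x) (gradient u x)) Ω :=
    hb'.continuousOn.inner hgr.continuousOn
  have hL := I1 (fun x => oddExt φ (u x) * (divergence (fun y => A y • gradient u y) x
      - inner ℝ (b x) (gradient u x) - r x)) (hgu.mul ((hdiv.sub hbgr).sub hr))
  have hR1 := I1 (fun x => B * (u x * oddExt φ (u x)) + youngFunction φ |u x| *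
      (divergence b x - κ * n) - oddExt φ (u x) * r x)
    (((continuousOn_const.mul (hu.continuousOn.mul hgu)).add
      (hGu.mul (hdivb.sub continuousOn_const))).sub (hgu.mul hr))
  have hR2a := I2 (fun x => (oddExt φ (u x) * A x) • gradient u x)
    ((hgu.mul hA.continuousOn).smul hgr.continuousOn)
  have hR2b := I2 (fun x => youngFunction φ |u x| • (b x - κ • x))
    (hGu.smul hb'.continuousOn)
  have hR2 : IntegrableOn (fun x => -fderiv ℝ χ x ((oddExt φ (u x) * A x) • gradient u x
          - youngFunction φ |u x| • (b x - κ • x))) Ω := by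
    refine (hR2a.sub hR2b).neg.congr_fun (fun x _ => ?_) hΩ.measurableSet
    simp
  have h3 := I1 (fun x => youngFunction φ |u x| * divergence (fun y => b y - κ • y) x +
        oddExt φ (u x) * inner ℝ (b x - κ • x) (gradient u x))
    ((hGu.mul hdivb').add (hgu.mul hbgr'))
  have h4 : 0 = (∫ x in Ω, χ x * (youngFunction φ |u x| * divergence (fun y => b y - κ • y) x +
        oddExt φ (u x) * inner ℝ (b x - κ • x) (gradient u x))) +
      ∫ x in Ω, fderiv ℝ χ x (youngFunction φ |u x| • (b x - κ • x)) := by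
    rw [h2]; ring
  rw [← integral_add h3 hR2b] at h4
  have h5 : ∫ x in Ω, (χ x * (divergence (fun y => A y • gradient u y) x
      - κ * inner ℝ x (gradient u x) - B * u x) + fderiv ℝ χ x (A x • gradient u x)) *
        oddExt φ (u x) =
      (∫ x in Ω, χ x * (oddExt φ (u x) * (divergence (fun y => A y • gradient u y) x
        - inner ℝ (b x) (gradient u x) - r x))) -
      ((∫ x in Ω, χ x * (B * (u x * oddExt φ (u x))
        + youngFunction φ |u x| * (divergence b x - κ * n) - oddExt φ (u x) * r x))
      + ∫ x in Ω, -fderiv ℝ χ x ((oddExt φ (u x) * A x) • gradient u x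
          - youngFunction φ |u x| • (b x - κ • x))) +
      ∫ x in Ω, (χ x * (youngFunction φ |u x| * divergence (fun y => b y - κ • y) x +
        oddExt φ (u x) * inner ℝ (b x - κ • x) (gradient u x)) +
        fderiv ℝ χ x (youngFunction φ |u x| • (b x - κ • x))) := by
    have gen : ∀ p q r s : E n → ℝ, IntegrableOn p Ω → IntegrableOn q Ω → IntegrableOn r Ω →
        IntegrableOn s Ω → ∫ x in Ω, (p x - (q x + r x) + s x) =
          (∫ x in Ω, p x) - ((∫ x in Ω, q x) + ∫ x in Ω, r x) + ∫ x in Ω, s x := by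
      intro p q r s hp hq hr hs
      rw [integral_add (f := fun x => p x - (q x + r x)) (hp.sub (hq.add hr)) hs,
        integral_sub (g := fun x => q x + r x) hp (hq.add hr), integral_add hq hr]
    refine Eq.trans ?_ (gen _ _ _ _ hL hR1 hR2 (h3.add hR2b))
    refine setIntegral_congr_fun hΩ.measurableSet fun x hx => ?_
    have hbd : DifferentiableAt ℝ b x :=
      (hb.contDiffAt (hΩ.mem_nhds hx)).differentiableAt (by norm_num)
    simp only [divergence_sub_smul_id hbd, map_smul, map_sub, smul_eq_mul,
      inner_sub_left, real_inner_smul_left]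
    ring
  linarith

end ParabolicISS

namespace ParabolicISS

open Filter Topology

/-! ### The energy inequality for solutions -/

/-- The constant in Young's inequality. -/
noncomputable def youngCoeff (δ₁ τ : ℝ) : ℝ := (max 1 τ⁻¹) ^ δ₁ * (1 + δ₁)

lemma youngCoeff_pos {δ₁ : ℝ} (h : 0 < δ₁) (τ : ℝ) : 0 < youngCoeff δ₁ τ :=
  mul_pos (Real.rpow_pos_of_pos (lt_of_lt_of_le one_pos (le_max_left _ _)) _) (by linarith)

/-- Φ lies between s g(s)/(1+δ₁) and s g(s)/(1+δ₀), and the sign of β decides which end is used.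
This is the source of the maximum in `InteriorCondition` and, with -β, of the minimum in
`psiQuotients`. -/
lemma youngFunction_mul_le_max {φ : ℝ → ℝ} {δ₀ δ₁ : ℝ} (hφ : IsTolksdorf φ δ₀ δ₁) (s β : ℝ) :
    youngFunction φ |s| * β ≤ s * oddExt φ s * max (β / (1 + δ₀)) (β / (1 + δ₁)) := by
  have h0 := hφ.δ₀_pos
  have h1 := hφ.δ₁_pos
  have hl := hφ.youngFunction_abs_le s
  have hu := hφ.le_youngFunction_abs s
  have hp := hφ.mul_oddExt_nonneg s
  rcases le_total 0 β with h | h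
  · calc youngFunction φ |s| * β = (1 + δ₀) * youngFunction φ |s| * (β / (1 + δ₀)) := by
          field_simp
      _ ≤ s * oddExt φ s * (β / (1 + δ₀)) := by gcongr
      _ ≤ _ := by gcongr; exact le_max_left _ _
  · calc youngFunction φ |s| * β = (1 + δ₁) * youngFunction φ |s| * (β / (1 + δ₁)) := by
          field_simp
      _ ≤ s * oddExt φ s * (β / (1 + δ₁)) :=
          mul_le_mul_of_nonpos_right hu (div_nonpos_of_nonpos_of_nonneg h (by linarith))
      _ ≤ _ := by gcongr; exact le_max_right _ _

lemma mul_min_le_youngFunction_mul {φ : ℝ → ℝ} {δ₀ δ₁ : ℝ} (hφ : IsTolksdorf φ δ₀ δ₁) (s β : ℝ) :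
    s * oddExt φ s * min (β / (1 + δ₀)) (β / (1 + δ₁)) ≤ youngFunction φ |s| * β := by
  have := youngFunction_mul_le_max hφ s (-β)
  rw [neg_div, neg_div, max_neg_neg] at this
  linarith

/-- The damping k pays for both the drift term B and the Young loss τ, so the full rate `cLow * (1 +
δ₀)` survives. -/
lemma interior_le {φ : ℝ → ℝ} {δ₀ δ₁ : ℝ} (hφ : IsTolksdorf φ δ₀ δ₁) {s divb c μ h f cLow B τ k : ℝ}
    (hh : -h * s ≤ μ * s ^ 2) (hc0 : 0 < cLow)
    (hc : cLow ≤ c - μ - max (divb / (1 + δ₀)) (divb / (1 + δ₁)))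
    (hτ : 0 < τ) (hB : 0 ≤ B) (hk : (B + τ) * (1 + δ₁) ≤ k) :
    B * (s * oddExt φ s) + youngFunction φ |s| * (divb - k) - oddExt φ s * (c * s + h - f) ≤
      -(cLow * (1 + δ₀)) * youngFunction φ |s| + youngCoeff δ₁ τ * youngFunction φ |f| := by
  have hp := hφ.mul_oddExt_nonneg s
  have h1 := youngFunction_mul_le_max hφ s divb
  have h2 := hφ.mul_oddExt_le hτ f s
  have h3 := hφ.le_youngFunction_abs s
  have h4 := hφ.youngFunction_abs_le s
  have hG := hφ.youngFunction_nonneg (abs_nonneg s)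
  -- The one-sided condition on h is multiplied by φ(|s|)/|s| ≥ 0, which is 0 at s = 0 by the
  -- convention for division by zero.
  have h5 : -(oddExt φ s * h) ≤ μ * (s * oddExt φ s) := by
    have hq : 0 ≤ φ |s| / |s| := div_nonneg (hφ.nonneg (abs_nonneg s)) (abs_nonneg s)
    have := mul_le_mul_of_nonneg_right hh hq
    rw [oddExt]
    linarith
  have h6 : cLow * (s * oddExt φ s) ≤
      (c - μ - max (divb / (1 + δ₀)) (divb / (1 + δ₁))) * (s * oddExt φ s) := by gcongr
  have h7 : (B + τ) * (s * oddExt φ s) ≤ k * youngFunction φ |s| := by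
    calc (B + τ) * (s * oddExt φ s) ≤ (B + τ) * ((1 + δ₁) * youngFunction φ |s|) := by gcongr
      _ = (B + τ) * (1 + δ₁) * youngFunction φ |s| := by ring
      _ ≤ _ := by gcongr
  have h8 := mul_le_mul_of_nonneg_left h4 hc0.le
  rw [youngCoeff]
  linarith

/-- The coercivity ψLow pays for the shift κx of the vector field and for the Young loss τ. -/
lemma boundary_le {φ : ℝ → ℝ} {δ₀ δ₁ : ℝ} (hφ : IsTolksdorf φ δ₀ δ₁) {s ψ bν d X R κ τ ψLow : ℝ}
    (hψ : s ≠ 0 → ψLow ≤ (ψ + s * min (bν / (1 + δ₀)) (bν / (1 + δ₁))) / s)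
    (hX : X ≤ R) (hκ : 0 ≤ κ) (hτ : 0 < τ) (hk : κ * R + τ ≤ ψLow) (hR : 0 ≤ R) :
    oddExt φ s * (d - ψ) - youngFunction φ |s| * (bν - κ * X) ≤
      youngCoeff δ₁ τ * youngFunction φ |d| := by
  have hp := hφ.mul_oddExt_nonneg s
  have h1 := mul_min_le_youngFunction_mul hφ s bν
  have h2 := hφ.mul_oddExt_le hτ d s
  have h4 := hφ.youngFunction_abs_le s
  have hG := hφ.youngFunction_nonneg (abs_nonneg s)
  have h5 : ψLow * (s * oddExt φ s) ≤ oddExt φ s * ψ +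
      s * oddExt φ s * min (bν / (1 + δ₀)) (bν / (1 + δ₁)) := by
    rcases eq_or_ne s 0 with rfl | hs
    · simp [oddExt_zero]
    · calc ψLow * (s * oddExt φ s) ≤
          (ψ + s * min (bν / (1 + δ₀)) (bν / (1 + δ₁))) / s * (s * oddExt φ s) := by
            gcongr; exact hψ hs
        _ = _ := by field_simp
  have h6 : youngFunction φ |s| * (κ * X) ≤ κ * R * (s * oddExt φ s) := by
    have : youngFunction φ |s| ≤ s * oddExt φ s := by
      have := mul_nonneg hφ.δ₀_pos.le hG
      linarith
    calc youngFunction φ |s| * (κ * X) ≤ youngFunction φ |s| * (κ * R) := by gcongr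
      _ ≤ s * oddExt φ s * (κ * R) := by gcongr
      _ = _ := by ring
  have h7 := mul_le_mul_of_nonneg_right hk hp
  rw [youngCoeff]
  linarith

lemma exists_coupling_constants {aLow δ₀ δ₁ ψLow R : ℝ} (ha : 0 < aLow) (h0 : 0 < δ₀) (h1 : 0 < δ₁)
    (hψ : 0 < ψLow) (hR : 0 < R) : ∃ κ τ τ' : ℝ, 0 < κ ∧ 0 < τ ∧ 0 < τ' ∧
      ((κ * R) ^ 2 / (4 * (aLow * min 1 δ₀)) + τ) * (1 + δ₁) ≤ κ ∧ κ * R + τ' ≤ ψLow := by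
  have hm : 0 < min 1 δ₀ := lt_min one_pos h0
  set e := aLow * min 1 δ₀
  have he : 0 < e := by positivity
  -- The drift cost is quadratic in κ and the gain linear, so a small κ works. The first entry makes
  -- the cost at most κ/2, the second makes κR at most ψLow/2; the other halves are left for τ and
  -- τ'.
  set κ := min (2 * e / (R ^ 2 * (1 + δ₁))) (ψLow / (2 * R)) with hκ
  have hκ0 : 0 < κ := by positivity
  refine ⟨κ, κ / (2 * (1 + δ₁)), ψLow / 2, hκ0, by positivity, by positivity, ?_, ?_⟩
  · have h2 : κ ≤ 2 * e / (R ^ 2 * (1 + δ₁)) := min_le_left _ _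
    rw [le_div_iff₀ (by positivity)] at h2
    have h3 : (κ * R) ^ 2 / (4 * e) * (1 + δ₁) ≤ κ / 2 := by
      rw [div_mul_eq_mul_div, div_le_div_iff₀ (by positivity) (by positivity)]
      nlinarith [mul_le_mul_of_nonneg_left h2 hκ0.le]
    have h4 : κ / (2 * (1 + δ₁)) * (1 + δ₁) = κ / 2 := by field_simp
    rw [add_mul, h4]
    linarith
  · have h2 : κ ≤ ψLow / (2 * R) := min_le_right _ _
    rw [le_div_iff₀ (by positivity)] at h2
    linarith

namespace System

variable {n : ℕ} {S : System n}

lemma IsSolution.fderivWithin_eq (hΩ : IsC2Domain S.Ω) (w : E n → ℝ) {x : E n} (hx : x ∈ S.Ω) :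
    fderivWithin ℝ w (closure S.Ω) x = fderiv ℝ w x :=
  fderivWithin_of_mem_nhds (mem_of_superset (hΩ.isOpen.mem_nhds hx) subset_closure)

/-- The density of the flux through the boundary layer. -/
noncomputable def flux (S : System n) (φ : ℝ → ℝ) (ρ : E n → ℝ) (κ : ℝ) (w : E n → ℝ → ℝ)
    (p : E n × ℝ) : ℝ :=
  oddExt φ (w p.1 p.2) * S.a p.1 p.2 *
      fderivWithin ℝ (fun x => w x p.2) (closure S.Ω) p.1 (gradient ρ p.1)
    - youngFunction φ |w p.1 p.2| * fderiv ℝ ρ p.1 (S.b p.1 p.2 - κ • p.1)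

lemma continuousOn_flux (hS : S.Regular) {φ : ℝ → ℝ} {δ₀ δ₁ : ℝ} (hφ : IsTolksdorf φ δ₀ δ₁)
    {ρ : E n → ℝ} (hρ : ContDiff ℝ 1 ρ) (κ : ℝ) {w0 : E n → ℝ} {d f : E n → ℝ → ℝ} {T : ℝ}
    {w : E n → ℝ → ℝ} (hw : S.IsSolution w0 d f T w) :
    ContinuousOn (S.flux φ ρ κ w) (closure S.Ω ×ˢ Ioo 0 T) := by
  have hw' : ContinuousOn (fun p : E n × ℝ => w p.1 p.2) (closure S.Ω ×ˢ Ioo 0 T) :=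
    hw.continuousOn.mono (prod_mono_right Ioo_subset_Icc_self)
  have hsub : closure S.Ω ×ˢ Ioo 0 T ⊆ closure S.Ω ×ˢ Ici 0 :=
    prod_mono_right fun t ht => ht.1.le
  have hρ' : Continuous (fderiv ℝ ρ) := hρ.continuous_fderiv (by norm_num)
  have hgr : Continuous (gradient ρ) :=
    (InnerProductSpace.toDual ℝ (E n)).symm.continuous.comp hρ'
  refine ContinuousOn.sub (ContinuousOn.mul (ContinuousOn.mul ?_ ?_) ?_) (ContinuousOn.mul ?_ ?_)
  · exact hφ.continuous_oddExt.comp_continuousOn hw'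
  · exact hS.contDiff_a.continuousOn.mono hsub
  · exact hw.continuous_gradient.clm_apply (hgr.comp continuous_fst).continuousOn
  · exact hφ.continuous_youngFunction_abs.comp_continuousOn hw'
  · exact (hρ'.comp continuous_fst).continuousOn.clm_apply
      ((hS.contDiff_b.continuousOn.mono hsub).sub (by fun_prop))

/-- On the boundary ∇ρ = cν with 0 < c ≤ P, so the flux is c times the expression in `boundary_le`,
after a ∂w/∂ν is replaced by d - ψ. As the bound is nonnegative, c may be enlarged to P. -/
lemma flux_le_of_mem_frontier (hΩ : IsC2Domain S.Ω) {φ : ℝ → ℝ} {δ₀ δ₁ : ℝ}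
    (hφ : IsTolksdorf φ δ₀ δ₁) {ρ : E n → ℝ} {ψLow R κ τ P : ℝ} (hψ : ∀ x ∈ frontier S.Ω, ∀ t, 0 < t →
      BddBelow (S.psiQuotients δ₀ δ₁ x t) ∧ ψLow ≤ sInf (S.psiQuotients δ₀ δ₁ x t))
    (hκ : 0 ≤ κ) (hτ : 0 < τ) (hk : κ * R + τ ≤ ψLow) {x : E n} (hx : x ∈ frontier S.Ω)
    (hR : ‖x‖ ≤ R) (hP : ‖fderiv ℝ ρ x‖ ≤ P)
    (hρ : ∃ c : ℝ, 0 < c ∧ HasFDerivAt ρ (c • innerSL ℝ (outerNormal S.Ω x)) x)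
    {w0 : E n → ℝ} {d f : E n → ℝ → ℝ} {T : ℝ}
    {w : E n → ℝ → ℝ} (hw : S.IsSolution w0 d f T w) {t : ℝ} (ht : t ∈ Ioo 0 T) :
    S.flux φ ρ κ w (x, t) ≤ P * youngCoeff δ₁ τ * youngFunction φ |d x t| := by
  obtain ⟨c, hc, hd⟩ := hρ
  have hν := hΩ.norm_outerNormal hx
  have hcP : c ≤ P := by
    rw [hd.fderiv, norm_smul, innerSL_apply_norm, hν, mul_one, Real.norm_of_nonneg hc.le] at hP
    exact hP
  have hgr : gradient ρ x = c • outerNormal S.Ω x := by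
    apply ext_inner_right ℝ
    intro v
    rw [← fderiv_apply_eq_inner_gradient, hd.fderiv]
    simp [real_inner_smul_left]
  have hbc := hw.boundary x hx t ht
  rw [boundaryOp, normalDeriv] at hbc
  have hb := boundary_le hφ (s := w x t) (ψ := S.ψ x t (w x t))
    (bν := inner ℝ (S.b x t) (outerNormal S.Ω x)) (d := d x t)
    (X := inner ℝ x (outerNormal S.Ω x)) (R := R) (κ := κ) (τ := τ) (ψLow := ψLow) (fun hs => by
      obtain ⟨hbd, hle⟩ := hψ x hx t ht.1
      exact hle.trans (csInf_le hbd ⟨w x t, hs, rfl⟩))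
    ((real_inner_le_norm _ _).trans (by rw [hν, mul_one]; exact hR)) hκ hτ hk
    ((norm_nonneg x).trans hR)
  have hY : 0 ≤ youngCoeff δ₁ τ * youngFunction φ |d x t| :=
    mul_nonneg (youngCoeff_pos hφ.δ₁_pos τ).le (hφ.youngFunction_nonneg (abs_nonneg _))
  calc S.flux φ ρ κ w (x, t) = c * (oddExt φ (w x t) * (d x t - S.ψ x t (w x t)) -
        youngFunction φ |w x t| * (inner ℝ (S.b x t) (outerNormal S.Ω x) -
          κ * inner ℝ x (outerNormal S.Ω x))) := by
        rw [← hbc]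
        simp only [flux, hgr, hd.fderiv, map_smul, smul_eq_mul, smul_apply,
          innerSL_apply_apply, inner_sub_right, real_inner_smul_right]
        rw [real_inner_comm (S.b x t), real_inner_comm x]
        ring
    _ ≤ c * (youngCoeff δ₁ τ * youngFunction φ |d x t|) := by gcongr
    _ ≤ P * (youngCoeff δ₁ τ * youngFunction φ |d x t|) := by gcongr
    _ = _ := by ring

lemma contDiffOn_slice {F : Type*} [NormedAddCommGroup F] [NormedSpace ℝ F] {Ω : Set (E n)}
    {u : E n → ℝ → F}
    (hu : ContDiffOn ℝ 2 (fun p : E n × ℝ => u p.1 p.2) (closure Ω ×ˢ Ici 0)) {t : ℝ}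
    (ht : 0 ≤ t) : ContDiffOn ℝ 2 (fun x => u x t) Ω :=
  hu.comp (f := fun x => (x, t)) (by fun_prop) fun _ hx => ⟨subset_closure hx, ht⟩

/-- The weighted energy inequality at a fixed time: the equation replaces w_t, the pointwise bound
`interior_le` treats the bulk, and the gradient of the cutoff becomes the layer measure. -/
lemma integral_deriv_le (hΩ : IsC2Domain S.Ω) (hS : S.Regular) {φ : ℝ → ℝ} {δ₀ δ₁ cLow : ℝ}
    (hφ : IsTolksdorf φ δ₀ δ₁) (hint : S.InteriorCondition δ₀ δ₁ cLow)
    {ρ : E n → ℝ} (hρ : ContDiff ℝ 1 ρ) (h0 : ∀ x ∈ frontier S.Ω, ρ x = 0)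
    {aLow R κ τ : ℝ} (ha : 0 < aLow) (haA : ∀ x ∈ closure S.Ω, ∀ t, 0 ≤ t → aLow ≤ S.a x t)
    (hR : ∀ x ∈ closure S.Ω, ‖x‖ ≤ R) (hκ : 0 ≤ κ) (hτ : 0 < τ)
    (hk : ((κ * R) ^ 2 / (4 * (aLow * min 1 δ₀)) + τ) * (1 + δ₁) ≤ κ * n)
    {w0 : E n → ℝ} {d f : E n → ℝ → ℝ} {T : ℝ} (hin : S.IsInput w0 d f)
    {w : E n → ℝ → ℝ} (hw : S.IsSolution w0 d f T w) {t : ℝ} (ht : t ∈ Ioo 0 T) (j : ℕ) :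
    ∫ x in S.Ω, cutoff S.Ω ρ j x * (oddExt φ (w x t) * deriv (w x) t) ≤
      -(cLow * (1 + δ₀)) * (∫ x in S.Ω, cutoff S.Ω ρ j x * youngFunction φ |w x t|)
      + youngCoeff δ₁ τ * (∫ x in S.Ω, youngFunction φ |f x t|)
      + ∫ x, S.flux φ ρ κ w (x, t) ∂layerMeasure S.Ω ρ j := by
  have ho := hΩ.isOpen
  have hcpt : IsCompact (closure S.Ω) := hΩ.isBounded.isCompact_closure
  have ht0 : 0 ≤ t := ht.1.le
  have htI : t ∈ Icc 0 T := Ioo_subset_Icc_self ht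
  obtain ⟨hc0, μ, -, hμ, hcμ⟩ := hint
  have hu := hw.contDiff_space t ht
  have hgr := contDiffOn_gradient ho hu
  have huc : ContinuousOn (fun x => w x t) (closure S.Ω) :=
    hw.continuousOn.comp (f := fun x => (x, t)) (by fun_prop) fun x hx => ⟨hx, htI⟩
  have hfc : ContinuousOn (fun x => f x t) (closure S.Ω) :=
    hin.contDiff_f.continuousOn.comp (f := fun x => (x, t)) (by fun_prop) fun x hx => ⟨hx, ht0⟩
  obtain ⟨M, hM⟩ := hcpt.exists_bound_of_continuousOn huc
  have hχ := contDiff_cutoff ho hρ h0 j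
  have hc := hasCompactSupport_cutoff (Ω := S.Ω) hΩ.isBounded hρ.continuous j
  have hs := tsupport_cutoff_subset ho hρ.continuous h0 j
  have hAc : ContDiffOn ℝ 1 (fun x => S.a x t) S.Ω :=
    (contDiffOn_slice hS.contDiff_a ht0).of_le (by norm_num)
  have hbc : ContDiffOn ℝ 1 (fun x => S.b x t) S.Ω :=
    (contDiffOn_slice hS.contDiff_b ht0).of_le (by norm_num)
  have hr : ContinuousOn (fun x => S.c x t * w x t + S.h x t (w x t) (gradient (fun z => w z t) x)
      - f x t) S.Ω := by
    refine (((contDiffOn_slice hS.contDiff_c ht0).continuousOn.mul hu.continuousOn).add ?_).sub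
      (hfc.mono subset_closure)
    exact hS.contDiff_h.continuousOn.comp
      (f := fun x => (x, t, w x t, gradient (fun z => w z t) x))
      (continuousOn_id.prodMk (continuousOn_const.prodMk (hu.continuousOn.prodMk
        hgr.continuousOn))) fun x hx => ⟨subset_closure hx, ht0, trivial, trivial⟩
  have hmain := integral_energy_le ho hχ hc hs (cutoff_nonneg j) hφ hu hAc hbc hr
    (fun x hx => hM x (subset_closure hx)) ha (fun x hx => haA x (subset_closure hx) t ht0)
    (fun x hx => hR x (subset_closure hx)) hκ
  have e1 : ∫ x in S.Ω, cutoff S.Ω ρ j x * (oddExt φ (w x t) * deriv (w x) t) =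
      ∫ x in S.Ω, cutoff S.Ω ρ j x * (oddExt φ (w x t) *
        (divergence (fun y => S.a y t • gradient (fun z => w z t) y) x
          - inner ℝ (S.b x t) (gradient (fun z => w z t) x)
          - (S.c x t * w x t + S.h x t (w x t) (gradient (fun z => w z t) x) - f x t))) := by
    refine setIntegral_congr_fun ho.measurableSet fun x hx => ?_
    rw [← hw.equation x hx t ht]
    ring
  have e2 : ∫ x in S.Ω, -fderiv ℝ (cutoff S.Ω ρ j) x ((oddExt φ (w x t) * S.a x t) •
      gradient (fun z => w z t) x - youngFunction φ |w x t| • (S.b x t - κ • x)) =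
      ∫ x, S.flux φ ρ κ w (x, t) ∂layerMeasure S.Ω ρ j := by
    rw [integral_layerMeasure hρ.continuous]
    refine setIntegral_congr_fun ho.measurableSet fun x hx => ?_
    simp only [flux, fderiv_cutoff ho hρ j hx, IsSolution.fderivWithin_eq hΩ _ hx]
    rw [fderiv_apply_eq_inner_gradient (fun x => w x t), real_inner_comm,
      ← fderiv_apply_eq_inner_gradient ρ]
    simp
  have hG : ContinuousOn (fun x => youngFunction φ |w x t|) S.Ω :=
    hφ.continuous_youngFunction_abs.comp_continuousOn hu.continuousOn
  have hgu : ContinuousOn (fun x => oddExt φ (w x t)) S.Ω :=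
    hφ.continuous_oddExt.comp_continuousOn hu.continuousOn
  have hGf : ContinuousOn (fun x => youngFunction φ |f x t|) (closure S.Ω) :=
    hφ.continuous_youngFunction_abs.comp_continuousOn hfc
  have I1 : ∀ g : E n → ℝ, ContinuousOn g S.Ω →
      IntegrableOn (fun x => cutoff S.Ω ρ j x * g x) S.Ω :=
    fun g hg => (integrable_mul_of_tsupport_subset ho hχ.continuous hc hs hg).integrableOn
  have hGfi : IntegrableOn (fun x => youngFunction φ |f x t|) S.Ω :=
    (hGf.integrableOn_compact hcpt).mono_set subset_closure
  have e3 : ∫ x in S.Ω, cutoff S.Ω ρ j x * ((κ * R) ^ 2 / (4 * (aLow * min 1 δ₀)) *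
        (w x t * oddExt φ (w x t)) + youngFunction φ |w x t| *
        (divergence (fun x => S.b x t) x - κ * n) - oddExt φ (w x t) *
        (S.c x t * w x t + S.h x t (w x t) (gradient (fun z => w z t) x) - f x t)) ≤
      ∫ x in S.Ω, (-(cLow * (1 + δ₀)) * (cutoff S.Ω ρ j x * youngFunction φ |w x t|) +
        youngCoeff δ₁ τ * youngFunction φ |f x t|) := by
    refine setIntegral_mono_on (I1 _ ?_) (((I1 _ hG).const_mul _).add (hGfi.const_mul _))
      ho.measurableSet fun x hx => ?_
    · exact ((continuousOn_const.mul (hu.continuousOn.mul hgu)).add (hG.mul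
        ((continuousOn_divergence ho hbc).sub continuousOn_const))).sub (hgu.mul hr)
    · have hm : 0 < min 1 δ₀ := lt_min one_pos hφ.δ₀_pos
      have hi := interior_le hφ (s := w x t) (f := f x t)
        (hμ x hx t ht.1 (w x t) (gradient (fun z => w z t) x)) hc0 (hcμ x hx t ht.1) hτ
        (by positivity : 0 ≤ (κ * R) ^ 2 / (4 * (aLow * min 1 δ₀))) hk
      have h1 := mul_le_mul_of_nonneg_left hi (cutoff_nonneg (Ω := S.Ω) (ρ := ρ) j x)
      have h2 : cutoff S.Ω ρ j x * (youngCoeff δ₁ τ * youngFunction φ |f x t|) ≤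
          youngCoeff δ₁ τ * youngFunction φ |f x t| :=
        mul_le_of_le_one_left (mul_nonneg (youngCoeff_pos hφ.δ₁_pos τ).le
          (hφ.youngFunction_nonneg (abs_nonneg _))) (cutoff_le_one j x)
      linarith
  rw [integral_add ((I1 _ hG).const_mul _) (hGfi.const_mul _), integral_const_mul,
    integral_const_mul] at e3
  rw [e1, ← e2]
  linarith

end System

end ParabolicISS

namespace ParabolicISS

open Filter Topology

/-! ### Parametric integrals -/

section Parametric

variable {X Y : Type*} [MetricSpace X]

/-- The set where H ≥ ε is compact and avoids the zeros of r, so r has a negative maximum on it. -/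
lemma exists_forall_lt_of_le_on_zero {A : Set X} (hA : IsCompact A) {r H : X → ℝ}
    (hr : ContinuousOn r A) (hH : ContinuousOn H A) (hr0 : ∀ x ∈ A, r x ≤ 0)
    (h : ∀ x ∈ A, r x = 0 → H x ≤ 0) {ε : ℝ} (hε : 0 < ε) :
    ∃ η : ℝ, 0 < η ∧ ∀ x ∈ A, -η < r x → H x < ε := by
  have hB : IsCompact (A ∩ H ⁻¹' Ici ε) :=
    hA.of_isClosed_subset (hH.preimage_isClosed_of_isClosed hA.isClosed isClosed_Ici)
      inter_subset_left
  rcases (A ∩ H ⁻¹' Ici ε).eq_empty_or_nonempty with he | hne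
  · refine ⟨1, one_pos, fun x hx _ => ?_⟩
    by_contra! hc
    exact (he ▸ (⟨hx, hc⟩ : x ∈ A ∩ H ⁻¹' Ici ε) : x ∈ (∅ : Set X))
  · obtain ⟨x, hx, hmax⟩ := hB.exists_isMaxOn hne (hr.mono inter_subset_left)
    have hneg : r x < 0 := by
      refine lt_of_le_of_ne (hr0 x hx.1) fun h0 => ?_
      have h1 := h x hx.1 h0
      have h2 : ε ≤ H x := hx.2
      linarith
    refine ⟨-r x, by linarith, fun y hy hyr => ?_⟩
    by_contra! hc
    have : r y ≤ r x := hmax ⟨hy, hc⟩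
    linarith

variable [MetricSpace Y]

lemma continuousOn_integral_of_isCompact [MeasurableSpace Y] [BorelSpace Y] {μ : Measure Y} [IsFiniteMeasure μ] {A : Set X}
    {K : Set Y} (hA : IsCompact A) (hK : IsCompact K) (hμ : ∀ᵐ y ∂μ, y ∈ K) {v : X × Y → ℝ}
    (hv : ContinuousOn v (A ×ˢ K)) : ContinuousOn (fun x => ∫ y, v (x, y) ∂μ) A := by
  obtain ⟨C, hC⟩ := (hA.prod hK).exists_bound_of_continuousOn hv
  refine continuousOn_of_dominated (bound := fun _ => C) ?_ ?_ (integrable_const C) ?_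
  · intro x hx
    have h1 : ContinuousOn (fun y => v (x, y)) K :=
      hv.comp (by fun_prop) fun y hy => ⟨hx, hy⟩
    have h2 := h1.aestronglyMeasurable_of_isCompact (μ := μ) hK hK.isClosed.measurableSet
    rwa [Measure.restrict_eq_self_of_ae_mem hμ] at h2
  · exact fun x hx => hμ.mono fun y hy => hC _ ⟨hx, hy⟩
  · exact hμ.mono fun y hy => hv.comp (by fun_prop) fun x hx => ⟨hx, hy⟩

variable [MeasurableSpace X] [BorelSpace X]

lemma continuousOn_integral_of_isCompact' {μ : Measure X} [IsFiniteMeasure μ] {A : Set X}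
    {K : Set Y} (hA : IsCompact A) (hK : IsCompact K) (hμ : ∀ᵐ x ∂μ, x ∈ A) {v : X × Y → ℝ}
    (hv : ContinuousOn v (A ×ˢ K)) : ContinuousOn (fun y => ∫ x, v (x, y) ∂μ) K :=
  continuousOn_integral_of_isCompact (v := fun p : Y × X => v (p.2, p.1)) hK hA hμ
    (hv.comp (by fun_prop) fun _ hp => ⟨hp.2, hp.1⟩)

lemma integral_integral_swap_of_isCompact [SecondCountableTopology X] {μ : Measure X}
    [IsFiniteMeasure μ] {A : Set X} (hA : IsCompact A) (hμ : ∀ᵐ x ∂μ, x ∈ A) {a b : ℝ}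
    (hab : a ≤ b) {v : X × ℝ → ℝ} (hv : ContinuousOn v (A ×ˢ Icc a b)) :
    ∫ t in a..b, ∫ x, v (x, t) ∂μ = ∫ x, (∫ t in a..b, v (x, t)) ∂μ := by
  simp only [intervalIntegral.integral_of_le hab, ← integral_Icc_eq_integral_Ioc]
  refine integral_integral_swap ?_
  have h1 : IntegrableOn v (A ×ˢ Icc a b) (μ.prod volume) :=
    hv.integrableOn_compact (hA.prod isCompact_Icc)
  rw [IntegrableOn, ← Measure.prod_restrict, Measure.restrict_eq_self_of_ae_mem hμ] at h1
  exact h1.swap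

end Parametric

/-! ### Boundary layer data -/

/-- A defining function of `Ω` together with a filter along which the corresponding boundary
layers converge to a measure dominated by the surface measure. -/
structure BoundaryLayer {n : ℕ} (Ω : Set (E n)) where
  ρ : E n → ℝ
  contDiff : ContDiff ℝ 1 ρ
  neg : ∀ x ∈ Ω, ρ x < 0
  zero : ∀ x ∈ frontier Ω, ρ x = 0
  normal : ∀ x ∈ frontier Ω, ∃ c : ℝ, 0 < c ∧ HasFDerivAt ρ (c • innerSL ℝ (outerNormal Ω x)) x
  finite_surface : IsFiniteMeasure (surfaceMeasure Ω)
  P : ℝ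
  P_nonneg : 0 ≤ P
  norm_fderiv_le : ∀ x ∈ frontier Ω, ‖fderiv ℝ ρ x‖ ≤ P
  M : ℝ
  M_nonneg : 0 ≤ M
  mass_le : ∀ᶠ j : ℕ in atTop, layerMeasure Ω ρ j univ ≤ ENNReal.ofReal M
  l : Filter ℕ
  neBot : NeBot l
  le_atTop : l ≤ atTop
  K : ℝ
  K_nonneg : 0 ≤ K
  limit_le : ∀ D : E n → ℝ, ContinuousOn D (closure Ω) → (∀ x ∈ closure Ω, 0 ≤ D x) →
    ∃ L, Tendsto (fun j => ∫ x, D x ∂layerMeasure Ω ρ j) l (𝓝 L) ∧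
      L ≤ K * ∫ x, D x ∂surfaceMeasure Ω

theorem IsC2Domain.nonempty_boundaryLayer {n : ℕ} (hn : 1 ≤ n) {Ω : Set (E n)}
    (hΩ : IsC2Domain Ω) : Nonempty (BoundaryLayer Ω) := by
  obtain ⟨m, rfl⟩ : ∃ m, n = m + 1 := ⟨n - 1, by omega⟩
  obtain ⟨ρ, hρ, hneg, h0⟩ := hΩ.exists_defining_function
  have hcpt : IsCompact (frontier Ω) := hΩ.isBounded.isCompact_closure.of_isClosed_subset
    isClosed_frontier frontier_subset_closure
  have hz : ∀ z ∈ frontier Ω, fderiv ℝ ρ z ≠ 0 := by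
    intro z hz hc
    obtain ⟨c, hc0, hd⟩ := (h0 z hz).2
    have h1 := hd.fderiv
    rw [hc] at h1
    have h2 : ‖c • innerSL ℝ (outerNormal Ω z)‖ = c := by
      rw [norm_smul, innerSL_apply_norm, hΩ.norm_outerNormal hz, mul_one,
        Real.norm_of_nonneg hc0.le]
    rw [← h1, norm_zero] at h2
    linarith
  obtain ⟨P, hP⟩ := hcpt.exists_bound_of_continuousOn
    (hρ.continuous_fderiv (by norm_num)).continuousOn
  obtain ⟨M, hM, hmass⟩ := exists_layerMeasure_univ_le hΩ.isOpen hΩ.isBounded hρ hneg hz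
  obtain ⟨l, hl, hle, K, hK, hlim⟩ := exists_layerMeasure_limit hΩ.isOpen hΩ.isBounded hρ hneg
    (fun z hz => (h0 z hz).1) hz
  exact ⟨{
    ρ := ρ
    contDiff := hρ
    neg := hneg
    zero := fun x hx => (h0 x hx).1
    normal := fun x hx => (h0 x hx).2
    finite_surface := isFiniteMeasure_surfaceMeasure hΩ.isBounded hΩ.isOpen.measurableSet hρ
      (fun z hz => (h0 z hz).1) hz
    P := max P 0
    P_nonneg := le_max_right _ _
    norm_fderiv_le := fun x hx => (hP x hx).trans (le_max_left _ _)
    M := M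
    M_nonneg := hM
    mass_le := hmass
    l := l
    neBot := hl
    le_atTop := hle
    K := K
    K_nonneg := hK
    limit_le := hlim }⟩

namespace System

variable {n : ℕ} {S : System n}

/-! ### Integration in time -/

/-- The time derivative of w is continuous only inside the open cylinder. The compact support of χ
confines the integrand to a compact set there, which provides the majorant. -/
lemma hasDerivAt_integral_cutoff (hΩ : IsC2Domain S.Ω) {φ : ℝ → ℝ} {δ₀ δ₁ : ℝ}
    (hφ : IsTolksdorf φ δ₀ δ₁) {χ : E n → ℝ} (hχ : Continuous χ)
    (hc : HasCompactSupport χ) (hs : tsupport χ ⊆ S.Ω) {w0 : E n → ℝ} {d f : E n → ℝ → ℝ} {T : ℝ}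
    {w : E n → ℝ → ℝ} (hw : S.IsSolution w0 d f T w) {t : ℝ} (ht : t ∈ Ioo 0 T) :
    HasDerivAt (fun t => ∫ x in S.Ω, χ x * youngFunction φ |w x t|)
      (∫ x in S.Ω, χ x * (oddExt φ (w x t) * deriv (w x) t)) t := by
  have ho := hΩ.isOpen
  obtain ⟨ε, hε, hsub⟩ := Metric.nhds_basis_closedBall.mem_iff.1 (isOpen_Ioo.mem_nhds ht)
  have hK : IsCompact (tsupport χ ×ˢ Metric.closedBall t ε) := hc.prod (isCompact_closedBall t ε)
  have hsub' : tsupport χ ×ˢ Metric.closedBall t ε ⊆ S.Ω ×ˢ Ioo 0 T := prod_mono hs hsub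
  have hwc : ContinuousOn (fun p : E n × ℝ => w p.1 p.2) (S.Ω ×ˢ Ioo 0 T) :=
    hw.continuousOn.mono (prod_mono subset_closure Ioo_subset_Icc_self)
  have hgc : ContinuousOn (fun p : E n × ℝ => oddExt φ (w p.1 p.2) * deriv (w p.1) p.2)
      (S.Ω ×ˢ Ioo 0 T) :=
    (hφ.continuous_oddExt.comp_continuousOn hwc).mul hw.continuous_deriv_time
  obtain ⟨C, hC⟩ := hK.exists_bound_of_continuousOn (hgc.mono hsub')
  have hslice : ∀ {u : E n × ℝ → ℝ}, ContinuousOn u (S.Ω ×ˢ Ioo 0 T) → ∀ s ∈ Ioo 0 T,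
      IntegrableOn (fun x => χ x * u (x, s)) S.Ω := by
    intro u hu s hsI
    exact (integrable_mul_of_tsupport_subset ho hχ hc hs
      (hu.comp (f := fun x => (x, s)) (by fun_prop) fun x hx => ⟨hx, hsI⟩)).integrableOn
  have hball : Metric.ball t ε ∈ 𝓝 t := Metric.ball_mem_nhds t hε
  have hGc : ContinuousOn (fun p : E n × ℝ => youngFunction φ |w p.1 p.2|) (S.Ω ×ˢ Ioo 0 T) :=
    hφ.continuous_youngFunction_abs.comp_continuousOn hwc
  refine (hasDerivAt_integral_of_dominated_loc_of_deriv_le (bound := fun x => |χ x| * C)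
    (F := fun t x => χ x * youngFunction φ |w x t|)
    (F' := fun t x => χ x * (oddExt φ (w x t) * deriv (w x) t))
    hball ?_ (hslice hGc t ht) (hslice hgc t ht).aestronglyMeasurable ?_ ?_ ?_).2
  · filter_upwards [hball] with s hs'
    exact (hslice hGc s
      (hsub (Metric.ball_subset_closedBall hs'))).aestronglyMeasurable
  · refine .of_forall fun x s hs' => ?_
    rw [norm_mul, Real.norm_eq_abs]
    by_cases hx : x ∈ tsupport χ
    · exact mul_le_mul_of_nonneg_left (hC (x, s) ⟨hx, Metric.ball_subset_closedBall hs'⟩)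
        (abs_nonneg _)
    · simp [image_eq_zero_of_notMem_tsupport hx]
  · exact ((hχ.integrable_of_hasCompactSupport hc).abs.mul_const C).integrableOn
  · refine (ae_restrict_mem ho.measurableSet).mono fun x hx s hs' => ?_
    have hsI := hsub (Metric.ball_subset_closedBall hs')
    have h1 : HasDerivAt (w x) (deriv (w x) s) s :=
      ((hw.differentiable_time x hx).differentiableAt (isOpen_Ioo.mem_nhds hsI)).hasDerivAt
    exact ((hφ.hasDerivAt_youngFunction_abs (w x s)).comp s h1).const_mul (χ x)

/-- Grönwall's argument: multiply by exp(λt) and integrate the derivative of the product. -/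
lemma exp_mul_sub_le_integral {V V' r : ℝ → ℝ} {a b lam : ℝ} (hab : a ≤ b)
    (hV : ∀ t ∈ Icc a b, HasDerivAt V (V' t) t) (hr : ContinuousOn r (Icc a b))
    (h : ∀ t ∈ Icc a b, V' t ≤ -lam * V t + r t) :
    Real.exp (lam * b) * V b - Real.exp (lam * a) * V a ≤
      ∫ t in a..b, Real.exp (lam * t) * r t := by
  have hexp : ∀ t, HasDerivAt (fun t => Real.exp (lam * t)) (Real.exp (lam * t) * lam) t := by
    intro t
    simpa using ((hasDerivAt_id t).const_mul lam).exp
  have hd : ∀ t ∈ Icc a b, HasDerivAt (fun t => Real.exp (lam * t) * V t)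
      (Real.exp (lam * t) * lam * V t + Real.exp (lam * t) * V' t) t :=
    fun t ht => (hexp t).mul (hV t ht)
  refine intervalIntegral.sub_le_integral_of_hasDeriv_right_of_le hab
    (fun t ht => (hd t ht).continuousAt.continuousWithinAt)
    (fun t ht => (hd t (Ioo_subset_Icc_self ht)).hasDerivWithinAt)
    (((by fun_prop : Continuous fun t => Real.exp (lam * t)).continuousOn.mul
      hr).integrableOn_compact isCompact_Icc) fun t ht => ?_
  have := mul_le_mul_of_nonneg_left (h t (Ioo_subset_Icc_self ht)) (Real.exp_pos (lam * t)).le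
  linarith

/-- Within the closure the boundary is {ρ = 0}, so H - D is below ε/(M+1) on a whole neighbourhood
of it, uniformly in t. The layers eventually lie there with mass at most M; the 1 avoids division by
zero. -/
lemma eventually_integral_flux_le (hΩ : IsC2Domain S.Ω) (L : BoundaryLayer S.Ω) {H D : E n × ℝ → ℝ}
    {a b : ℝ} (hH : ContinuousOn H (closure S.Ω ×ˢ Icc a b))
    (hD : ContinuousOn D (closure S.Ω ×ˢ Icc a b))
    (h : ∀ x ∈ frontier S.Ω, ∀ t ∈ Icc a b, H (x, t) ≤ D (x, t)) {ε : ℝ} (hε : 0 < ε) :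
    ∀ᶠ j : ℕ in atTop, ∀ t ∈ Icc a b, ∫ x, H (x, t) ∂layerMeasure S.Ω L.ρ j ≤
      (∫ x, D (x, t) ∂layerMeasure S.Ω L.ρ j) + ε := by
  have ho := hΩ.isOpen
  have hcpt : IsCompact (closure S.Ω) := hΩ.isBounded.isCompact_closure
  have hρle : ∀ x ∈ closure S.Ω, L.ρ x ≤ 0 := fun x hx =>
    closure_minimal (fun y hy => (L.neg y hy).le) (isClosed_le L.contDiff.continuous
      continuous_const) hx
  have hM : 0 < L.M + 1 := by linarith [L.M_nonneg]
  obtain ⟨η, hη, hlt⟩ := exists_forall_lt_of_le_on_zero (hcpt.prod isCompact_Icc)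
    (r := fun p : E n × ℝ => L.ρ p.1) (H := fun p => H p - D p)
    (L.contDiff.continuous.comp continuous_fst).continuousOn (hH.sub hD)
    (fun p hp => hρle p.1 hp.1) (by
      rintro ⟨x, t⟩ ⟨hx, ht⟩ h0
      have hxf : x ∈ frontier S.Ω := by
        rw [ho.frontier_eq]
        exact ⟨hx, fun hc => (L.neg x hc).ne h0⟩
      linarith [h x hxf t ht]) (div_pos hε hM)
  have hO : IsOpen {x : E n | -η < L.ρ x} := isOpen_lt continuous_const L.contDiff.continuous
  filter_upwards [L.mass_le, layerMeasure_eventually_eq_zero ho hΩ.isBounded L.contDiff.continuous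
    L.neg hO (fun x hx => by
      simp only [mem_ofPred_eq, L.zero x hx]; linarith)] with j hj hj0 t ht
  have := isFiniteMeasure_layerMeasure ho.measurableSet hΩ.isBounded L.contDiff.continuous j
  have hmem : ∀ᵐ x ∂layerMeasure S.Ω L.ρ j, x ∈ closure S.Ω := by
    refine (withDensity_absolutelyContinuous _ _).ae_le ?_
    exact (ae_restrict_mem ho.measurableSet).mono fun x hx => subset_closure hx
  have hint : ∀ {u : E n × ℝ → ℝ}, ContinuousOn u (closure S.Ω ×ˢ Icc a b) →
      Integrable (fun x => u (x, t)) (layerMeasure S.Ω L.ρ j) := by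
    intro u hu
    have h1 : ContinuousOn (fun x => u (x, t)) (closure S.Ω) :=
      hu.comp (f := fun x => (x, t)) (by fun_prop) fun x hx => ⟨hx, ht⟩
    have h2 := h1.integrableOn_compact (μ := layerMeasure S.Ω L.ρ j) hcpt
    rwa [IntegrableOn, Measure.restrict_eq_self_of_ae_mem hmem] at h2
  have hreal : (layerMeasure S.Ω L.ρ j).real univ ≤ L.M :=
    ENNReal.toReal_le_of_le_ofReal L.M_nonneg hj
  have hae : ∀ᵐ x ∂layerMeasure S.Ω L.ρ j, H (x, t) ≤ D (x, t) + ε / (L.M + 1) := by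
    have hj0' : ∀ᵐ x ∂layerMeasure S.Ω L.ρ j, x ∈ {x : E n | -η < L.ρ x} := hj0
    filter_upwards [hmem, hj0'] with x hx hxη
    linarith [hlt (x, t) ⟨hx, ht⟩ hxη]
  calc ∫ x, H (x, t) ∂layerMeasure S.Ω L.ρ j ≤
      ∫ x, (D (x, t) + ε / (L.M + 1)) ∂layerMeasure S.Ω L.ρ j :=
        integral_mono_ae (hint hH) ((hint hD).add (integrable_const _)) hae
    _ = (∫ x, D (x, t) ∂layerMeasure S.Ω L.ρ j) +
        (layerMeasure S.Ω L.ρ j).real univ * (ε / (L.M + 1)) := by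
        rw [integral_add (hint hD) (integrable_const _), integral_const, smul_eq_mul]
    _ ≤ (∫ x, D (x, t) ∂layerMeasure S.Ω L.ρ j) + (L.M + 1) * (ε / (L.M + 1)) := by
        gcongr; linarith
    _ = _ := by rw [mul_div_cancel₀ _ hM.ne']

end System

end ParabolicISS

namespace ParabolicISS

open Filter Topology

namespace System

variable {n : ℕ} {S : System n}

/-! ### The energy inequality in integrated form -/

lemma continuousOn_modular {φ : ℝ → ℝ} {δ₀ δ₁ : ℝ} (hφ : IsTolksdorf φ δ₀ δ₁) {X : Type*}
    [MetricSpace X] [MeasurableSpace X] [BorelSpace X] {μ : Measure X} [IsFiniteMeasure μ]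
    {A : Set X} (hA : IsCompact A) (hμ : ∀ᵐ x ∂μ, x ∈ A) {I : Set ℝ} (hI : IsCompact I)
    {v : X → ℝ → ℝ} (hv : ContinuousOn (fun p : X × ℝ => v p.1 p.2) (A ×ˢ I)) :
    ContinuousOn (fun t => modular (youngFunction φ) μ fun x => v x t) I :=
  continuousOn_integral_of_isCompact' (v := fun p : X × ℝ => youngFunction φ |v p.1 p.2|) hA hI hμ
    (hφ.continuous_youngFunction_abs.comp_continuousOn hv)

/-- The inequality is integrated for the cutoff functional on [a,b] inside (0,T), where the flux is
continuous up to the boundary; then j tends to infinity along the filter of the boundary layer, and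
finally ε → 0. -/
lemma exp_mul_modular_sub_le (hΩ : IsC2Domain S.Ω) (hS : S.Regular) {φ : ℝ → ℝ}
    {δ₀ δ₁ cLow : ℝ} (hφ : IsTolksdorf φ δ₀ δ₁) (hint : S.InteriorCondition δ₀ δ₁ cLow)
    (L : BoundaryLayer S.Ω) {aLow R κ τ τ' ψLow : ℝ} (ha : 0 < aLow)
    (haA : ∀ x ∈ closure S.Ω, ∀ t, 0 ≤ t → aLow ≤ S.a x t)
    (hR : ∀ x ∈ closure S.Ω, ‖x‖ ≤ R) (hκ : 0 ≤ κ) (hτ : 0 < τ) (hτ' : 0 < τ')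
    (hk : ((κ * R) ^ 2 / (4 * (aLow * min 1 δ₀)) + τ) * (1 + δ₁) ≤ κ * n)
    (hψ : ∀ x ∈ frontier S.Ω, ∀ t, 0 < t →
      BddBelow (S.psiQuotients δ₀ δ₁ x t) ∧ ψLow ≤ sInf (S.psiQuotients δ₀ δ₁ x t))
    (hk' : κ * R + τ' ≤ ψLow)
    {w0 : E n → ℝ} {d f : E n → ℝ → ℝ} {T : ℝ} (hin : S.IsInput w0 d f)
    {w : E n → ℝ → ℝ} (hw : S.IsSolution w0 d f T w) {lam : ℝ}
    (hlam : lam ≤ cLow * (1 + δ₀)) {a b : ℝ} (h0a : 0 < a) (hab : a ≤ b) (hbT : b < T) :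
    Real.exp (lam * b) * modular (youngFunction φ) (volume.restrict S.Ω) (fun x => w x b)
      - Real.exp (lam * a) * modular (youngFunction φ) (volume.restrict S.Ω) (fun x => w x a) ≤
    ∫ t in a..b, Real.exp (lam * t) *
      (youngCoeff δ₁ τ * modular (youngFunction φ) (volume.restrict S.Ω) (fun x => f x t)
        + L.K * (L.P * youngCoeff δ₁ τ') *
          modular (youngFunction φ) (surfaceMeasure S.Ω) (fun x => d x t)) := by
  have ho := hΩ.isOpen
  have hcpt : IsCompact (closure S.Ω) := hΩ.isBounded.isCompact_closure
  have := L.finite_surface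
  have hvol : IsFiniteMeasure (volume.restrict S.Ω) :=
    ⟨by simpa using hΩ.isBounded.measure_lt_top⟩
  have hmem : ∀ᵐ x ∂volume.restrict S.Ω, x ∈ closure S.Ω :=
    (ae_restrict_mem ho.measurableSet).mono fun x hx => subset_closure hx
  have hmemS : ∀ᵐ x ∂surfaceMeasure S.Ω, x ∈ closure S.Ω :=
    (ae_restrict_mem isClosed_frontier.measurableSet).mono fun x hx => frontier_subset_closure hx
  have hlay : ∀ j, IsFiniteMeasure (layerMeasure S.Ω L.ρ j) := fun j =>
    isFiniteMeasure_layerMeasure ho.measurableSet hΩ.isBounded L.contDiff.continuous j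
  have hmemL : ∀ j, ∀ᵐ x ∂layerMeasure S.Ω L.ρ j, x ∈ closure S.Ω := fun j =>
    (withDensity_absolutelyContinuous _ _).ae_le hmem
  have hsub : Icc a b ⊆ Ioo 0 T := fun t ht => ⟨h0a.trans_le ht.1, ht.2.trans_lt hbT⟩
  have hsub0 : Icc a b ⊆ Ici 0 := fun t ht => (hsub ht).1.le
  have hexp : Continuous fun t => Real.exp (lam * t) := by fun_prop
  set Y := youngCoeff δ₁ τ
  set Z := L.P * youngCoeff δ₁ τ'
  have hZ : 0 ≤ Z := mul_nonneg L.P_nonneg (youngCoeff_pos hφ.δ₁_pos _).le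
  set D : E n × ℝ → ℝ := fun p => Z * youngFunction φ |d p.1 p.2| with hD
  have hDc : ContinuousOn D (closure S.Ω ×ˢ Icc a b) :=
    continuousOn_const.mul (hφ.continuous_youngFunction_abs.comp_continuousOn
      (hin.contDiff_d.continuousOn.mono (prod_mono_right hsub0)))
  have hEDc : ContinuousOn (fun p : E n × ℝ => Real.exp (lam * p.2) * D p)
      (closure S.Ω ×ˢ Icc a b) := (hexp.comp continuous_snd).continuousOn.mul hDc
  have hHc : ContinuousOn (S.flux φ L.ρ κ w) (closure S.Ω ×ˢ Icc a b) :=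
    (continuousOn_flux hS hφ L.contDiff κ hw).mono (prod_mono_right hsub)
  set F : ℝ → ℝ := fun t => modular (youngFunction φ) (volume.restrict S.Ω) fun x => f x t
    with hF
  have hFc : ContinuousOn F (Icc a b) := continuousOn_modular hφ hcpt hmem isCompact_Icc
    (hin.contDiff_f.continuousOn.mono (prod_mono_right hsub0))
  have hEF : ContinuousOn (fun t => Real.exp (lam * t) * (Y * F t)) (Icc a b) :=
    hexp.continuousOn.mul (continuousOn_const.mul hFc)
  set V : ℕ → ℝ → ℝ := fun j t => ∫ x in S.Ω, cutoff S.Ω L.ρ j x * youngFunction φ |w x t|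
    with hV
  set W : ℝ → ℝ := fun t => modular (youngFunction φ) (volume.restrict S.Ω) fun x => w x t
    with hW
  set B : ℝ := ∫ t in a..b, Real.exp (lam * t)
  -- Integrating the boundary data in time before the limit reduces the weak convergence of the
  -- layers to a single continuous function of x.
  set Q : E n → ℝ := fun x => ∫ t in a..b, Real.exp (lam * t) * D (x, t) with hQ
  have hQc : ContinuousOn Q (closure S.Ω) := by
    simp only [hQ, intervalIntegral.integral_of_le hab, ← integral_Icc_eq_integral_Ioc]
    exact continuousOn_integral_of_isCompact hcpt isCompact_Icc
      (ae_restrict_mem measurableSet_Icc) hEDc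
  have hQ0 : ∀ x ∈ closure S.Ω, 0 ≤ Q x := fun x _ =>
    intervalIntegral.integral_nonneg hab fun t _ => mul_nonneg (Real.exp_pos _).le
      (mul_nonneg hZ (hφ.youngFunction_nonneg (abs_nonneg _)))
  have hVlim : ∀ t ∈ Icc a b, Tendsto (fun j => V j t) L.l (𝓝 (W t)) := by
    intro t ht
    refine Tendsto.mono_left ?_ L.le_atTop
    have hwt : ContinuousOn (fun x => youngFunction φ |w x t|) (closure S.Ω) :=
      hφ.continuous_youngFunction_abs.comp_continuousOn
        (hw.continuousOn.comp (f := fun x => (x, t)) (by fun_prop)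
          fun x hx => ⟨hx, Ioo_subset_Icc_self (hsub ht)⟩)
    have hwi : IntegrableOn (fun x => youngFunction φ |w x t|) S.Ω :=
      (hwt.integrableOn_compact hcpt).mono_set subset_closure
    refine tendsto_integral_of_dominated_convergence (fun x => youngFunction φ |w x t|)
      (fun j => ?_) hwi (fun j => .of_forall fun x => ?_)
      ((ae_restrict_mem ho.measurableSet).mono fun x hx => ?_)
    · exact (contDiff_cutoff ho L.contDiff L.zero j).continuous.aestronglyMeasurable.mul
        hwi.aestronglyMeasurable
    · have h1 := hφ.youngFunction_nonneg (abs_nonneg (w x t))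
      rw [Real.norm_of_nonneg (mul_nonneg (cutoff_nonneg j x) h1)]
      exact mul_le_of_le_one_left h1 (cutoff_le_one j x)
    · simpa using (tendsto_cutoff L.neg hx).mul_const (youngFunction φ |w x t|)
  obtain ⟨ℓ, hℓ, hℓK⟩ := L.limit_le Q hQc hQ0
  have key : ∀ ε : ℝ, 0 < ε → Real.exp (lam * b) * W b - Real.exp (lam * a) * W a ≤
      (∫ t in a..b, Real.exp (lam * t) * (Y * F t)) + ε * B + ℓ := by
    intro ε hε
    have := L.neBot
    refine le_of_tendsto_of_tendsto
      (((hVlim b (right_mem_Icc.2 hab)).const_mul _).sub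
        ((hVlim a (left_mem_Icc.2 hab)).const_mul _)) (tendsto_const_nhds.add hℓ) ?_
    have hev := eventually_integral_flux_le hΩ L hHc hDc (fun x hx t ht =>
      flux_le_of_mem_frontier hΩ hφ hψ hκ hτ' hk' hx (hR x (frontier_subset_closure hx))
        (L.norm_fderiv_le x hx) (L.normal x hx) hw (hsub ht)) hε
    filter_upwards [hev.filter_mono L.le_atTop] with j hj
    have hDj : ContinuousOn (fun t => ∫ x, D (x, t) ∂layerMeasure S.Ω L.ρ j) (Icc a b) :=
      continuousOn_integral_of_isCompact' hcpt isCompact_Icc (hmemL j) hDc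
    have hder : ∀ t ∈ Icc a b, HasDerivAt (V j)
        (∫ x in S.Ω, cutoff S.Ω L.ρ j x * (oddExt φ (w x t) * deriv (w x) t)) t := fun t ht =>
      hasDerivAt_integral_cutoff hΩ hφ (contDiff_cutoff ho L.contDiff L.zero j).continuous
        (hasCompactSupport_cutoff hΩ.isBounded L.contDiff.continuous j)
        (tsupport_cutoff_subset ho L.contDiff.continuous L.zero j) hw (hsub ht)
    refine (exp_mul_sub_le_integral (lam := lam)
      (r := fun t => Y * F t + ((∫ x, D (x, t) ∂layerMeasure S.Ω L.ρ j) + ε)) hab hder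
      ((continuousOn_const.mul hFc).add (hDj.add continuousOn_const)) fun t ht => ?_).trans_eq ?_
    · have h1 := integral_deriv_le hΩ hS hφ hint L.contDiff L.zero ha haA hR hκ hτ hk hin hw
        (hsub ht) j
      have h2 : 0 ≤ V j t := integral_nonneg fun x =>
        mul_nonneg (cutoff_nonneg j x) (hφ.youngFunction_nonneg (abs_nonneg _))
      have h3 := mul_le_mul_of_nonneg_right hlam h2
      have h4 := hj t ht
      have h5 : F t = ∫ x in S.Ω, youngFunction φ |f x t| := rfl
      have h6 : V j t = ∫ x in S.Ω, cutoff S.Ω L.ρ j x * youngFunction φ |w x t| := rfl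
      rw [← h5, ← h6] at h1
      linarith
    · have hswap := integral_integral_swap_of_isCompact hcpt (hmemL j) hab hEDc
      simp only [integral_const_mul] at hswap
      rw [← hswap, ← intervalIntegral.integral_const_mul, ← intervalIntegral.integral_add,
        ← intervalIntegral.integral_add]
      · refine intervalIntegral.integral_congr fun t _ => ?_
        ring
      · exact ((hEF.add (continuousOn_const.mul hexp.continuousOn)).intervalIntegrable_of_Icc hab)
      · exact (hexp.continuousOn.mul hDj).intervalIntegrable_of_Icc hab
      · exact hEF.intervalIntegrable_of_Icc hab
      · exact (continuous_const.mul hexp).intervalIntegrable _ _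
  have hlim0 : Tendsto (fun ε : ℝ => (∫ t in a..b, Real.exp (lam * t) * (Y * F t)) + ε * B + ℓ)
      (𝓝[>] 0) (𝓝 ((∫ t in a..b, Real.exp (lam * t) * (Y * F t)) + 0 * B + ℓ)) :=
    ((by fun_prop : Continuous fun ε : ℝ =>
      (∫ t in a..b, Real.exp (lam * t) * (Y * F t)) + ε * B + ℓ).tendsto 0).mono_left
      nhdsWithin_le_nhds
  have hmain := ge_of_tendsto hlim0 (eventually_mem_nhdsWithin.mono key)
  have hswap := integral_integral_swap_of_isCompact hcpt hmemS hab hEDc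
  simp only [integral_const_mul] at hswap
  have hDS : ContinuousOn (fun t => ∫ x, D (x, t) ∂surfaceMeasure S.Ω) (Icc a b) :=
    continuousOn_integral_of_isCompact' hcpt isCompact_Icc hmemS hDc
  rw [← hswap] at hℓK
  have hfin : (∫ t in a..b, Real.exp (lam * t) * (Y * F t)) +
      L.K * ∫ t in a..b, Real.exp (lam * t) * ∫ x, D (x, t) ∂surfaceMeasure S.Ω =
      ∫ t in a..b, Real.exp (lam * t) * (Y * F t + L.K * Z *
        modular (youngFunction φ) (surfaceMeasure S.Ω) (fun x => d x t)) := by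
    rw [← intervalIntegral.integral_const_mul, ← intervalIntegral.integral_add]
    · refine intervalIntegral.integral_congr fun t _ => ?_
      simp only [hD, modular, integral_const_mul]
      ring
    · exact hEF.intervalIntegrable_of_Icc hab
    · exact (continuousOn_const.mul (hexp.continuousOn.mul hDS)).intervalIntegrable_of_Icc hab
  rw [← hfin]
  linarith

/-- The equation holds only for 0 < t < T; both endpoints are reached by continuity on the closed
interval. -/
lemma le_add_of_forall_Ioo {U : ℝ → ℝ} {T G : ℝ} (hT : 0 < T) (hU : ContinuousOn U (Icc 0 T))
    (h : ∀ a b, 0 < a → a ≤ b → b < T → U b ≤ U a + G) : U T ≤ U 0 + G := by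
  have h1 : Tendsto U (𝓝[<] T) (𝓝 (U T)) :=
    (hU T (right_mem_Icc.2 hT.le)).tendsto.mono_left
      ((nhdsWithin_le_of_mem (Icc_mem_nhdsLT hT)))
  have h2 : Tendsto U (𝓝[>] 0) (𝓝 (U 0)) :=
    (hU 0 (left_mem_Icc.2 hT.le)).tendsto.mono_left
      ((nhdsWithin_le_of_mem (Icc_mem_nhdsGT hT)))
  refine ge_of_tendsto (h2.add_const G) ?_
  filter_upwards [Ioo_mem_nhdsGT hT] with a ha
  refine le_of_tendsto h1 ?_
  filter_upwards [Ioo_mem_nhdsLT ha.2] with b hb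
  exact h a b ha.1 hb.1.le hb.2

/-- The order of the quantifiers matters: C is chosen before φ, depending on it only through δ₀ and
δ₁, so it is invariant under the rescaling used for the Luxemburg norm. It is also independent of
the weight exponent. -/
theorem exists_exp_mul_modular_le (hn : 1 ≤ n) (hΩ : IsC2Domain S.Ω) (hS : S.Regular)
    (hgrowth : S.GrowthConditions) {δ₀ δ₁ cLow : ℝ} (h0 : 0 < δ₀) (h1 : 0 < δ₁)
    (hint : S.InteriorCondition δ₀ δ₁ cLow) (hbdry : S.BoundaryCondition δ₀ δ₁) :
    ∃ C : ℝ, 0 < C ∧ ∀ φ : ℝ → ℝ, IsTolksdorf φ δ₀ δ₁ → ∀ (w0 : E n → ℝ) (d f : E n → ℝ → ℝ),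
      S.IsInput w0 d f → ∀ T : ℝ, 0 < T → ∀ w : E n → ℝ → ℝ, S.IsSolution w0 d f T w →
      ∀ lam : ℝ, lam ≤ cLow * (1 + δ₀) →
      Real.exp (lam * T) * modular (youngFunction φ) (volume.restrict S.Ω) (fun x => w x T) ≤
        modular (youngFunction φ) (volume.restrict S.Ω) w0 +
        C * ((∫ t in 0..T, Real.exp (lam * t) *
            modular (youngFunction φ) (surfaceMeasure S.Ω) (fun x => d x t)) +
          ∫ t in 0..T, Real.exp (lam * t) *
            modular (youngFunction φ) (volume.restrict S.Ω) (fun x => f x t)) := by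
  obtain ⟨aLow, aUp, ha, -, haA⟩ := hgrowth.elliptic
  obtain ⟨ψLow, hψ0, hψ⟩ := hbdry
  obtain ⟨L⟩ := hΩ.nonempty_boundaryLayer hn
  have hcpt : IsCompact (closure S.Ω) := hΩ.isBounded.isCompact_closure
  obtain ⟨R, hR0, hR⟩ : ∃ R, 0 < R ∧ ∀ x ∈ closure S.Ω, ‖x‖ ≤ R := by
    obtain ⟨R, hR⟩ := hcpt.isBounded.exists_norm_le
    exact ⟨max R 1, lt_of_lt_of_le one_pos (le_max_right _ _),
      fun x hx => (hR x hx).trans (le_max_left _ _)⟩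
  obtain ⟨κ, τ, τ', hκ, hτ, hτ', hk, hk'⟩ := exists_coupling_constants ha h0 h1 hψ0 hR0
  -- The divergence of x is n ≥ 1, so the damping obtained is at least κ.
  have hκn : κ ≤ κ * n := le_mul_of_one_le_right hκ.le (by exact_mod_cast hn)
  set Y := youngCoeff δ₁ τ
  set Z := L.K * (L.P * youngCoeff δ₁ τ')
  have hY : 0 < Y := youngCoeff_pos h1 τ
  refine ⟨max Y Z, lt_max_of_lt_left hY, fun φ hφ w0 d f hin T hT w hw lam hlam => ?_⟩
  have := L.finite_surface
  have hvol : IsFiniteMeasure (volume.restrict S.Ω) :=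
    ⟨by simpa using hΩ.isBounded.measure_lt_top⟩
  have hmem : ∀ᵐ x ∂volume.restrict S.Ω, x ∈ closure S.Ω :=
    (ae_restrict_mem hΩ.isOpen.measurableSet).mono fun x hx => subset_closure hx
  have hmemS : ∀ᵐ x ∂surfaceMeasure S.Ω, x ∈ closure S.Ω :=
    (ae_restrict_mem isClosed_frontier.measurableSet).mono fun x hx => frontier_subset_closure hx
  have hexp : Continuous fun t => Real.exp (lam * t) := by fun_prop
  have hnn : ∀ {X : Type _} [MeasurableSpace X] (μ : Measure X) (u : X → ℝ),
      0 ≤ modular (youngFunction φ) μ u := fun μ u =>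
    integral_nonneg fun x => hφ.youngFunction_nonneg (abs_nonneg _)
  set F : ℝ → ℝ := fun t => modular (youngFunction φ) (volume.restrict S.Ω) fun x => f x t
  set D : ℝ → ℝ := fun t => modular (youngFunction φ) (surfaceMeasure S.Ω) fun x => d x t
  have hFc : ContinuousOn F (Icc 0 T) := continuousOn_modular hφ hcpt hmem isCompact_Icc
    (hin.contDiff_f.continuousOn.mono (prod_mono_right fun t ht => ht.1))
  have hDc : ContinuousOn D (Icc 0 T) := continuousOn_modular hφ hcpt hmemS isCompact_Icc
    (hin.contDiff_d.continuousOn.mono (prod_mono_right fun t ht => ht.1))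
  have hWc : ContinuousOn (fun t => Real.exp (lam * t) *
      modular (youngFunction φ) (volume.restrict S.Ω) fun x => w x t) (Icc 0 T) :=
    hexp.continuousOn.mul (continuousOn_modular hφ hcpt hmem isCompact_Icc hw.continuousOn)
  have hint1 : ContinuousOn (fun t => Real.exp (lam * t) * (Y * F t + Z * D t)) (Icc 0 T) :=
    hexp.continuousOn.mul ((continuousOn_const.mul hFc).add (continuousOn_const.mul hDc))
  have hZ : 0 ≤ Z := mul_nonneg L.K_nonneg (mul_nonneg L.P_nonneg (youngCoeff_pos h1 τ').le)
  have hU := le_add_of_forall_Ioo (G := ∫ t in 0..T, Real.exp (lam * t) * (Y * F t + Z * D t))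
    hT hWc fun a b h0a hab hbT => by
      have h2 := exp_mul_modular_sub_le hΩ hS hφ hint L ha (fun x hx t ht => (haA x hx t ht).1)
        hR hκ.le hτ hτ' (hk.trans hκn) hψ hk' hin hw hlam h0a hab hbT
      have h3 : ∫ t in a..b, Real.exp (lam * t) * (Y * F t + Z * D t) ≤
          ∫ t in 0..T, Real.exp (lam * t) * (Y * F t + Z * D t) := by
        refine intervalIntegral.integral_mono_interval h0a.le hab hbT.le
          (.of_forall fun t => ?_) (hint1.intervalIntegrable_of_Icc hT.le)
        exact mul_nonneg (Real.exp_pos _).le (add_nonneg (mul_nonneg hY.le (hnn _ _))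
          (mul_nonneg hZ (hnn _ _)))
      linarith
  have hw0 : modular (youngFunction φ) (volume.restrict S.Ω) (fun x => w x 0) =
      modular (youngFunction φ) (volume.restrict S.Ω) w0 :=
    setIntegral_congr_fun hΩ.isOpen.measurableSet fun x hx => by
      simp only [hw.initial x (subset_closure hx)]
  rw [mul_zero, Real.exp_zero, one_mul, hw0] at hU
  refine hU.trans (add_le_add_right ?_ _)
  have hiD : IntervalIntegrable (fun t => Real.exp (lam * t) * D t) volume 0 T :=
    (hexp.continuousOn.mul hDc).intervalIntegrable_of_Icc hT.le
  have hiF : IntervalIntegrable (fun t => Real.exp (lam * t) * F t) volume 0 T :=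
    (hexp.continuousOn.mul hFc).intervalIntegrable_of_Icc hT.le
  rw [← intervalIntegral.integral_add hiD hiF, ← intervalIntegral.integral_const_mul]
  refine intervalIntegral.integral_mono_on hT.le (hint1.intervalIntegrable_of_Icc hT.le)
    ((hiD.add hiF).const_mul _) fun t _ => ?_
  have h2 := mul_le_mul_of_nonneg_right (le_max_left Y Z) (hnn (volume.restrict S.Ω) fun x => f x t)
  have h3 := mul_le_mul_of_nonneg_right (le_max_right Y Z) (hnn (surfaceMeasure S.Ω) fun x => d x t)
  calc Real.exp (lam * t) * (Y * F t + Z * D t)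
      ≤ Real.exp (lam * t) * (max Y Z * F t + max Y Z * D t) := by
        have := Real.exp_pos (lam * t)
        gcongr
    _ = _ := by ring

end System

end ParabolicISS

namespace ParabolicISS

open Filter Topology

/-! ### Hölder's inequality in time -/

lemma gainFactor_pos {lam : ℝ} (hlam : 0 < lam) {q' : ℝ≥0∞} (hq' : q' ≠ 0) :
    0 < gainFactor lam q' := by
  rw [gainFactor]
  split_ifs with h
  · exact one_pos
  · have := ENNReal.toReal_pos hq' h
    positivity

/-- Bounding the integral of exp(λq't) over (0,T) by exp(λq'T)/(λq') and taking the root separates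
exp(λT) from a factor independent of T. -/
lemma eLpNorm_exp_le {lam T : ℝ} (hlam : 0 < lam) (hT : 0 < T) {q' : ℝ≥0∞} (hq' : q' ≠ 0) :
    eLpNorm (fun t => Real.exp (lam * t)) q' (volume.restrict (Ioo 0 T)) ≤
      ENNReal.ofReal (Real.exp (lam * T) * gainFactor lam q') := by
  rcases eq_or_ne q' ∞ with rfl | hfin
  · rw [eLpNorm_exponent_top, gainFactor, if_pos rfl, mul_one]
    refine eLpNormEssSup_le_of_ae_enorm_bound ((ae_restrict_mem measurableSet_Ioo).mono
      fun t ht => ?_)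
    rw [Real.enorm_of_nonneg (Real.exp_pos _).le]
    exact ENNReal.ofReal_le_ofReal (Real.exp_le_exp.2 (mul_le_mul_of_nonneg_left ht.2.le hlam.le))
  · have hp : 0 < q'.toReal := ENNReal.toReal_pos hq' hfin
    rw [eLpNorm_eq_lintegral_rpow_enorm_toReal hq' hfin, gainFactor, if_neg hfin]
    set p := q'.toReal
    have ha : 0 < lam * p := mul_pos hlam hp
    have hc : Continuous fun t => Real.exp (lam * p * t) := by fun_prop
    have h1 : ∀ t : ℝ, ‖Real.exp (lam * t)‖ₑ ^ p = ENNReal.ofReal (Real.exp (lam * p * t)) := by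
      intro t
      rw [Real.enorm_of_nonneg (Real.exp_pos _).le, ENNReal.ofReal_rpow_of_pos (Real.exp_pos _),
        ← Real.exp_mul]
      ring_nf
    have h2 : ∫ t in Ioo 0 T, Real.exp (lam * p * t) ≤ Real.exp (lam * p * T) * (1 / (lam * p)) := by
      rw [← integral_Ioc_eq_integral_Ioo, ← intervalIntegral.integral_of_le hT.le,
        intervalIntegral.integral_comp_mul_left (fun t => Real.exp t) ha.ne', integral_exp,
        smul_eq_mul, mul_zero, Real.exp_zero, mul_comm, one_div]
      gcongr
      linarith
    simp only [h1]
    rw [← ofReal_integral_eq_lintegral_ofReal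
      ((hc.integrableOn_Icc (a := 0) (b := T)).mono_set Ioo_subset_Icc_self)
      (.of_forall fun t => (Real.exp_pos _).le),
      ENNReal.ofReal_rpow_of_nonneg (integral_nonneg fun t => (Real.exp_pos _).le) (by positivity)]
    refine ENNReal.ofReal_le_ofReal ((Real.rpow_le_rpow (integral_nonneg fun t =>
      (Real.exp_pos _).le) h2 (by positivity)).trans_eq ?_)
    rw [Real.mul_rpow (Real.exp_pos _).le (by positivity), ← Real.exp_mul]
    congr 2
    field_simp

lemma memLp_of_continuousOn_Icc {I : ℝ → ℝ} {T : ℝ} (hI : ContinuousOn I (Icc 0 T)) (q : ℝ≥0∞) :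
    MemLp I q (volume.restrict (Ioo 0 T)) := by
  obtain ⟨C, hC⟩ := isCompact_Icc.exists_bound_of_continuousOn hI
  exact MemLp.of_bound ((hI.mono Ioo_subset_Icc_self).aestronglyMeasurable measurableSet_Ioo) C
    ((ae_restrict_mem measurableSet_Ioo).mono fun t ht => hC t (Ioo_subset_Icc_self ht))

lemma integral_exp_mul_le {lam T : ℝ} (hlam : 0 < lam) (hT : 0 < T) {q q' : ℝ≥0∞}
    (hq : ENNReal.HolderConjugate q q') {I : ℝ → ℝ} (hI : ContinuousOn I (Icc 0 T))
    (hI0 : ∀ t, 0 ≤ I t) :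
    ∫ t in 0..T, Real.exp (lam * t) * I t ≤
      Real.exp (lam * T) * (gainFactor lam q' *
        (eLpNorm I q (volume.restrict (Ioo 0 T))).toReal) := by
  have hq'0 : q' ≠ 0 := ENNReal.HolderConjugate.ne_zero q' q
  have hg := gainFactor_pos hlam hq'0
  have hmem := memLp_of_continuousOn_Icc hI q
  have := hq.symm
  have hexp : Continuous fun t => Real.exp (lam * t) := by fun_prop
  have h1 := eLpNorm_smul_le_mul_eLpNorm (p := q') (q := q) (r := 1) (f := I)
    (φ := fun t => Real.exp (lam * t)) (μ := volume.restrict (Ioo 0 T)) hmem.1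
    hexp.aestronglyMeasurable
  have h2 := h1.trans (mul_le_mul_left (eLpNorm_exp_le hlam hT hq'0) _)
  have h3 : 0 ≤ Real.exp (lam * T) * gainFactor lam q' := mul_nonneg (Real.exp_pos _).le hg.le
  rw [intervalIntegral.integral_of_le hT.le, integral_Ioc_eq_integral_Ioo, ← mul_assoc]
  have hint : IntegrableOn (fun t => Real.exp (lam * t) * I t) (Ioo 0 T) :=
    ((hexp.continuousOn.mul hI).integrableOn_compact isCompact_Icc).mono_set Ioo_subset_Icc_self
  have h4 : eLpNorm ((fun t => Real.exp (lam * t)) • I) 1 (volume.restrict (Ioo 0 T)) =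
      ENNReal.ofReal (∫ t in Ioo 0 T, Real.exp (lam * t) * I t) := by
    rw [eLpNorm_one_eq_lintegral_enorm, ofReal_integral_eq_lintegral_ofReal hint
      (.of_forall fun t => mul_nonneg (Real.exp_pos _).le (hI0 t))]
    refine lintegral_congr fun t => ?_
    exact Real.enorm_of_nonneg (mul_nonneg (Real.exp_pos _).le (hI0 t))
  rw [h4, ← ENNReal.ofReal_toReal hmem.2.ne, ← ENNReal.ofReal_mul h3] at h2
  exact (ENNReal.ofReal_le_ofReal_iff (mul_nonneg h3 ENNReal.toReal_nonneg)).1 h2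

/-- The exponent in C(ε) is negative, so C(ε) → ∞ as ε → 0 and eventually exceeds any fixed
constant. -/
lemma exists_forall_le_youngConst {δ₀ δ₁ : ℝ} (h0 : 0 < δ₀) (h1 : 0 < δ₁) (C : ℝ) :
    ∃ ε₀ : ℝ, 0 < ε₀ ∧ ∀ ε, 0 < ε → ε < ε₀ → C ≤ youngConst δ₀ δ₁ ε := by
  have hA : 0 < δ₁ * (1 + δ₀) / (δ₀ * (1 + δ₁)) := by positivity
  have hB : 0 < (1 + δ₀) / (1 + δ₁) := by positivity
  have hp : -((1 + δ₀) / (δ₀ * (1 + δ₁))) < 0 := neg_lt_zero.2 (by positivity)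
  have hlin : Tendsto (fun ε => (1 + δ₀) / (1 + δ₁) * ε) (𝓝[>] 0) (𝓝[>] 0) := by
    refine tendsto_nhdsWithin_iff.2 ⟨?_, eventually_mem_nhdsWithin.mono fun ε hε => ?_⟩
    · exact ((by fun_prop : Continuous fun ε => (1 + δ₀) / (1 + δ₁) * ε).tendsto' 0 0
        (mul_zero _)).mono_left nhdsWithin_le_nhds
    · exact mul_pos hB hε
  have ht : Tendsto (youngConst δ₀ δ₁) (𝓝[>] 0) atTop :=
    ((tendsto_rpow_neg_nhdsGT_zero hp).comp hlin).const_mul_atTop hA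
  obtain ⟨ε₀, hε₀, h⟩ := mem_nhdsGT_iff_exists_Ioo_subset.1 (ht.eventually_ge_atTop C)
  exact ⟨ε₀, hε₀, fun ε hε hlt => h ⟨hε, hlt⟩⟩

/-! ### Classes of comparison functions -/

lemma isClassK_const_mul {c : ℝ} (hc : 0 < c) : IsClassK fun s => c * s where
  continuousOn := by fun_prop
  strictMonoOn := fun _ _ _ _ h => mul_lt_mul_of_pos_left h hc
  zero := mul_zero c

lemma isClassK_rpow_add_rpow {c α β : ℝ} (hc : 0 < c) (hα : 0 < α) (hβ : 0 < β) :
    IsClassK fun s => (c * s) ^ α + (c * s) ^ β where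
  continuousOn := by
    have hlin : Continuous fun s : ℝ => c * s := by fun_prop
    exact (((Real.continuous_rpow_const hα.le).comp hlin).add
      ((Real.continuous_rpow_const hβ.le).comp hlin)).continuousOn
  strictMonoOn := fun s hs t _ hst => by
    have h1 : c * s < c * t := mul_lt_mul_of_pos_left hst hc
    have h2 : 0 ≤ c * s := mul_nonneg hc.le hs
    exact add_lt_add (Real.rpow_lt_rpow h2 h1 hα) (Real.rpow_lt_rpow h2 h1 hβ)
  zero := by simp [Real.zero_rpow hα.ne', Real.zero_rpow hβ.ne']

end ParabolicISS

namespace ParabolicISS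

open Filter Topology

/-! ### Finiteness and support of the measures -/

namespace IsC2Domain

variable {n : ℕ} {Ω : Set (E n)}

lemma isFiniteMeasure_surfaceMeasure (hΩ : IsC2Domain Ω) (hn : 1 ≤ n) :
    IsFiniteMeasure (surfaceMeasure Ω) := by
  obtain ⟨L⟩ := hΩ.nonempty_boundaryLayer hn
  exact L.finite_surface

lemma isFiniteMeasure_volume (hΩ : IsC2Domain Ω) : IsFiniteMeasure (volume.restrict Ω) :=
  ⟨by simpa using hΩ.isBounded.measure_lt_top⟩

lemma ae_mem_closure_volume (hΩ : IsC2Domain Ω) : ∀ᵐ x ∂volume.restrict Ω, x ∈ closure Ω :=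
  (ae_restrict_mem hΩ.isOpen.measurableSet).mono fun _ hx => subset_closure hx

lemma ae_mem_closure_surfaceMeasure : ∀ᵐ x ∂surfaceMeasure Ω, x ∈ closure Ω :=
  (ae_restrict_mem isClosed_frontier.measurableSet).mono fun _ hx => frontier_subset_closure hx

end IsC2Domain

namespace IsTolksdorf

variable {φ : ℝ → ℝ} {δ₀ δ₁ : ℝ}

/-! ### Modulars and Luxemburg norms -/

lemma monotoneOn_youngFunction (hφ : IsTolksdorf φ δ₀ δ₁) :
    MonotoneOn (youngFunction φ) (Ici 0) := by
  intro s hs t ht hst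
  refine intervalIntegral.integral_mono_interval le_rfl hs hst ?_
    ((hφ.continuousOn.mono Icc_subset_Ici_self).intervalIntegrable_of_Icc ht)
  exact (ae_restrict_mem measurableSet_Ioc).mono fun r hr => hφ.nonneg hr.1.le

lemma modular_nonneg (hφ : IsTolksdorf φ δ₀ δ₁) {X : Type*} [MeasurableSpace X] (μ : Measure X)
    (u : X → ℝ) : 0 ≤ modular (youngFunction φ) μ u :=
  integral_nonneg fun _ => hφ.youngFunction_nonneg (abs_nonneg _)

lemma integrable_youngFunction_abs (hφ : IsTolksdorf φ δ₀ δ₁) {X : Type*} [MetricSpace X]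
    [MeasurableSpace X] [BorelSpace X] {μ : Measure X} [IsFiniteMeasure μ] {A : Set X}
    (hA : IsCompact A) (hμ : ∀ᵐ x ∂μ, x ∈ A) {u : X → ℝ} (hu : ContinuousOn u A) :
    Integrable (fun x => youngFunction φ |u x|) μ := by
  have h1 := (hφ.continuous_youngFunction_abs.comp_continuousOn hu).integrableOn_compact
    (μ := μ) hA
  rwa [IntegrableOn, Measure.restrict_eq_self_of_ae_mem hμ] at h1

lemma modular_rescale_le (hφ : IsTolksdorf φ δ₀ δ₁) {X : Type*} [MeasurableSpace X]
    {μ : Measure X} {u : X → ℝ} (hu : Integrable (fun x => youngFunction φ |u x|) μ) {k : ℝ}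
    (hk : 0 < k) :
    modular (youngFunction fun s => φ (s / k) / k) μ u ≤
      max (k⁻¹ ^ (1 + δ₀)) (k⁻¹ ^ (1 + δ₁)) * modular (youngFunction φ) μ u := by
  rw [modular, modular, ← integral_const_mul]
  refine integral_mono_of_nonneg (.of_forall fun x => ?_) (hu.const_mul _)
    (.of_forall fun x => ?_)
  · exact (hφ.rescale hk).youngFunction_nonneg (abs_nonneg _)
  · simp only [youngFunction_rescale _ hk]
    exact hφ.youngFunction_div_le (abs_nonneg _) hk

lemma timeModular_rescale_le (hφ : IsTolksdorf φ δ₀ δ₁) {X : Type*} [MetricSpace X]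
    [MeasurableSpace X] [BorelSpace X] {μ : Measure X} [IsFiniteMeasure μ] {A : Set X}
    (hA : IsCompact A) (hμ : ∀ᵐ x ∂μ, x ∈ A) {T : ℝ} {v : X → ℝ → ℝ}
    (hv : ContinuousOn (fun p : X × ℝ => v p.1 p.2) (A ×ˢ Icc 0 T)) (q : ℝ≥0∞) {k : ℝ}
    (hk : 0 < k) :
    timeModular (youngFunction fun s => φ (s / k) / k) μ q T v ≤
      max (k⁻¹ ^ (1 + δ₀)) (k⁻¹ ^ (1 + δ₁)) * timeModular (youngFunction φ) μ q T v := by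
  set c := max (k⁻¹ ^ (1 + δ₀)) (k⁻¹ ^ (1 + δ₁))
  have hc : 0 ≤ c := le_max_of_le_left (by positivity)
  have hmem := memLp_of_continuousOn_Icc
    (System.continuousOn_modular hφ hA hμ isCompact_Icc hv) q
  have h1 : eLpNorm (fun t => modular (youngFunction fun s => φ (s / k) / k) μ fun x => v x t) q
      (volume.restrict (Ioo 0 T)) ≤
      eLpNorm (c • fun t => modular (youngFunction φ) μ fun x => v x t) q
        (volume.restrict (Ioo 0 T)) := by
    refine eLpNorm_mono_ae ((ae_restrict_mem measurableSet_Ioo).mono fun t ht => ?_)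
    have hvt : ContinuousOn (fun x => v x t) A :=
      hv.comp (f := fun x => (x, t)) (by fun_prop) fun x hx => ⟨hx, Ioo_subset_Icc_self ht⟩
    rw [Pi.smul_apply, smul_eq_mul, Real.norm_of_nonneg ((hφ.rescale hk).modular_nonneg _ _),
      Real.norm_of_nonneg (mul_nonneg hc (hφ.modular_nonneg _ _))]
    exact hφ.modular_rescale_le (hφ.integrable_youngFunction_abs hA hμ hvt) hk
  have h2 := h1.trans eLpNorm_const_smul_le
  rw [Real.enorm_of_nonneg hc] at h2
  have h3 := ENNReal.toReal_mono (ENNReal.mul_ne_top ENNReal.ofReal_ne_top hmem.2.ne) h2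
  rwa [ENNReal.toReal_mul, ENNReal.toReal_ofReal hc] at h3

lemma luxemburgNorm_le (hφ : IsTolksdorf φ δ₀ δ₁) {X : Type*} [MeasurableSpace X]
    {μ : Measure X} {u : X → ℝ} {k : ℝ} (hk : 0 < k)
    (hu : Integrable (fun x => youngFunction (fun s => φ (s / k) / k) |u x|) μ)
    (h : modular (youngFunction fun s => φ (s / k) / k) μ u ≤ 1) :
    luxemburgNorm (youngFunction φ) μ u ≤ k := by
  refine csInf_le ⟨0, fun r hr => hr.1.le⟩ ⟨hk, ?_⟩
  simp only [youngFunction_rescale _ hk] at hu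
  rw [← ofReal_integral_eq_lintegral_ofReal hu
    (.of_forall fun x => hφ.youngFunction_nonneg (div_nonneg (abs_nonneg _) hk.le))]
  simp only [modular, youngFunction_rescale _ hk] at h
  exact ENNReal.ofReal_le_one.2 h

/-- Admissible k exist arbitrarily close to the infimum, once the admissible set is known to be
nonempty; `sInf` of the empty set would be 0 and carry no information. -/
lemma exists_modular_rescale_le_one (hφ : IsTolksdorf φ δ₀ δ₁) {X : Type*} [MetricSpace X]
    [MeasurableSpace X] [BorelSpace X] {μ : Measure X} [IsFiniteMeasure μ] {A : Set X}
    (hA : IsCompact A) (hμ : ∀ᵐ x ∂μ, x ∈ A) {u : X → ℝ} (hu : ContinuousOn u A) {r : ℝ}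
    (hr : luxemburgNorm (youngFunction φ) μ u < r) :
    ∃ k, 0 < k ∧ k < r ∧ modular (youngFunction fun s => φ (s / k) / k) μ u ≤ 1 := by
  have hint : ∀ k : ℝ, 0 < k → ∫⁻ x, ENNReal.ofReal (youngFunction φ (|u x| / k)) ∂μ =
      ENNReal.ofReal (modular (youngFunction fun s => φ (s / k) / k) μ u) := by
    intro k hk
    have h1 := (hφ.rescale hk).integrable_youngFunction_abs hA hμ hu
    rw [modular, ofReal_integral_eq_lintegral_ofReal h1
      (.of_forall fun x => (hφ.rescale hk).youngFunction_nonneg (abs_nonneg _))]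
    simp only [youngFunction_rescale _ hk]
  have hne : {k : ℝ | 0 < k ∧
      ∫⁻ x, ENNReal.ofReal (youngFunction φ (|u x| / k)) ∂μ ≤ 1}.Nonempty := by
    have hV := hφ.modular_nonneg μ u
    set V := modular (youngFunction φ) μ u
    have hk : 0 < max 1 V := lt_max_of_lt_left one_pos
    -- For k ≥ 1 both powers of 1/k are at most 1/k, so the rescaled modular is at most V/k ≤ 1.
    refine ⟨max 1 V, hk, ?_⟩
    rw [hint _ hk]
    refine ENNReal.ofReal_le_one.2 ((hφ.modular_rescale_le
      (hφ.integrable_youngFunction_abs hA hμ hu) hk).trans ?_)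
    have hpow : ∀ δ : ℝ, 0 < δ → (max 1 V)⁻¹ ^ (1 + δ) ≤ (max 1 V)⁻¹ := fun δ hδ => by
      simpa using Real.rpow_le_rpow_of_exponent_ge (inv_pos.2 hk)
        (inv_le_one_of_one_le₀ (le_max_left 1 V)) (by linarith : (1 : ℝ) ≤ 1 + δ)
    calc _ ≤ (max 1 V)⁻¹ * max 1 V :=
          mul_le_mul (max_le (hpow _ hφ.δ₀_pos) (hpow _ hφ.δ₁_pos)) (le_max_right _ _) hV
            (inv_pos.2 hk).le
      _ = 1 := inv_mul_cancel₀ hk.ne'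
  obtain ⟨k, ⟨hk, hk1⟩, hkr⟩ := exists_lt_of_csInf_lt hne hr
  rw [hint k hk] at hk1
  exact ⟨k, hk, hkr, ENNReal.ofReal_le_one.1 hk1⟩

end IsTolksdorf

lemma inv_rpow_mul_le {k c α B : ℝ} (hk : 0 < k) (hα : 0 < α) (hB : 0 ≤ B) (hc : 0 < c)
    (h : (c * B) ^ α⁻¹ ≤ k) : k⁻¹ ^ α * B ≤ c⁻¹ := by
  have hcB : 0 ≤ c * B := by positivity
  have h1 : c * B ≤ k ^ α := by
    have := Real.rpow_le_rpow (by positivity) h hα.le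
    rwa [← Real.rpow_mul hcB, inv_mul_cancel₀ hα.ne', Real.rpow_one] at this
  have h2 : 0 < k ^ α := by positivity
  rw [Real.inv_rpow hk.le, ← div_eq_inv_mul, div_le_iff₀ h2, ← div_eq_inv_mul, le_div_iff₀ hc]
  linarith

namespace System

variable {n : ℕ} {S : System n}

/-! ### Input-to-state stability -/

/-- Hölder in time produces a factor exp(λT) on the inputs, which cancels against the one in front
of the modular of w(·,T). The constant C serves all admissible λ, all q and all φ with the same δ₀,
δ₁. -/
theorem exists_modular_le (hn : 1 ≤ n) (hΩ : IsC2Domain S.Ω) (hS : S.Regular)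
    (hgrowth : S.GrowthConditions) {δ₀ δ₁ cLow : ℝ} (h0 : 0 < δ₀) (h1 : 0 < δ₁)
    (hint : S.InteriorCondition δ₀ δ₁ cLow) (hbdry : S.BoundaryCondition δ₀ δ₁) :
    ∃ C : ℝ, 0 < C ∧ ∀ lam : ℝ, 0 < lam → lam ≤ cLow * (1 + δ₀) → ∀ q q' : ℝ≥0∞,
      ENNReal.HolderConjugate q q' → ∀ φ : ℝ → ℝ, IsTolksdorf φ δ₀ δ₁ →
      ∀ (w0 : E n → ℝ) (d f : E n → ℝ → ℝ), S.IsInput w0 d f → ∀ T : ℝ, 0 < T →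
      ∀ w : E n → ℝ → ℝ, S.IsSolution w0 d f T w →
      modular (youngFunction φ) (volume.restrict S.Ω) (fun x => w x T) ≤
        Real.exp (-lam * T) * modular (youngFunction φ) (volume.restrict S.Ω) w0 +
        C * gainFactor lam q' * timeModular (youngFunction φ) (surfaceMeasure S.Ω) q T d +
        C * gainFactor lam q' * timeModular (youngFunction φ) (volume.restrict S.Ω) q T f := by
  obtain ⟨C, hC, h⟩ := exists_exp_mul_modular_le hn hΩ hS hgrowth h0 h1 hint hbdry
  refine ⟨C, hC, fun lam hlam hle q q' hq φ hφ w0 d f hin T hT w hw => ?_⟩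
  have hcpt : IsCompact (closure S.Ω) := hΩ.isBounded.isCompact_closure
  have := hΩ.isFiniteMeasure_surfaceMeasure hn
  have := hΩ.isFiniteMeasure_volume
  have hmod := h φ hφ w0 d f hin T hT w hw lam hle
  have hd := integral_exp_mul_le hlam hT hq (continuousOn_modular hφ hcpt
    IsC2Domain.ae_mem_closure_surfaceMeasure isCompact_Icc
    (hin.contDiff_d.continuousOn.mono (prod_mono_right fun t ht => ht.1)))
    fun t => hφ.modular_nonneg _ _
  have hf := integral_exp_mul_le hlam hT hq (continuousOn_modular hφ hcpt
    hΩ.ae_mem_closure_volume isCompact_Icc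
    (hin.contDiff_f.continuousOn.mono (prod_mono_right fun t ht => ht.1)))
    fun t => hφ.modular_nonneg _ _
  have hsum := hmod.trans (add_le_add_right (mul_le_mul_of_nonneg_left (add_le_add hd hf) hC.le) _)
  refine le_of_mul_le_mul_left (hsum.trans_eq ?_) (Real.exp_pos (lam * T))
  have hexp : Real.exp (lam * T) * Real.exp (-lam * T) = 1 := by
    rw [← Real.exp_add, neg_mul, add_neg_cancel, Real.exp_zero]
  simp only [timeModular]
  linear_combination -modular (youngFunction φ) (volume.restrict S.Ω) w0 * hexp

/-- The endpoint rate `cLow * (1 + δ₀)` is itself admissible, so no ε is spent; the gains are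
linear. -/
theorem expISSClass (hn : 1 ≤ n) (hΩ : IsC2Domain S.Ω) (hS : S.Regular)
    (hgrowth : S.GrowthConditions) {φ : ℝ → ℝ} {δ₀ δ₁ cLow : ℝ} (hφ : IsTolksdorf φ δ₀ δ₁)
    (hint : S.InteriorCondition δ₀ δ₁ cLow) (hbdry : S.BoundaryCondition δ₀ δ₁) {q : ℝ≥0∞}
    (hq : 1 ≤ q) : ExpISSClass S (youngFunction φ) q := by
  obtain ⟨C, hC, h⟩ := exists_modular_le hn hΩ hS hgrowth hφ.δ₀_pos hφ.δ₁_pos hint hbdry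
  have hlam : 0 < cLow * (1 + δ₀) := mul_pos hint.1 (by linarith [hφ.δ₀_pos])
  have hconj : q.HolderConjugate q.conjExponent := .conjExponent hq
  have hG := mul_pos hC (gainFactor_pos hlam (ENNReal.HolderConjugate.ne_zero q.conjExponent q))
  refine ⟨1, cLow * (1 + δ₀), _, _, one_pos, hlam, isClassK_const_mul hG, isClassK_const_mul hG,
    fun w0 d f hin T hT w hw => ?_⟩
  have := h _ hlam le_rfl q _ hconj φ hφ w0 d f hin T hT w hw
  rwa [one_mul, mul_comm (modular _ _ _)]

/-- The modular estimate is applied to φ(·/k)/k, with k the desired right-hand side. The three parts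
of k make the initial term at most 1/2 and each input term at most 1/4, so the modular of w(·,T)/k
is at most 1. -/
theorem expISSNorm (hn : 1 ≤ n) (hΩ : IsC2Domain S.Ω) (hS : S.Regular)
    (hgrowth : S.GrowthConditions) {φ : ℝ → ℝ} {δ₀ δ₁ cLow : ℝ} (hφ : IsTolksdorf φ δ₀ δ₁)
    (hint : S.InteriorCondition δ₀ δ₁ cLow) (hbdry : S.BoundaryCondition δ₀ δ₁) {q : ℝ≥0∞}
    (hq : 1 ≤ q) : ExpISSNorm S (youngFunction φ) q := by
  have h0 := hφ.δ₀_pos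
  have h1 := hφ.δ₁_pos
  have h01 := hφ.le_delta
  obtain ⟨C, hC, h⟩ := exists_modular_le hn hΩ hS hgrowth h0 h1 hint hbdry
  have hlam : 0 < cLow * (1 + δ₀) := mul_pos hint.1 (by linarith)
  have hconj : q.HolderConjugate q.conjExponent := .conjExponent hq
  have hG := mul_pos hC (gainFactor_pos hlam (ENNReal.HolderConjugate.ne_zero q.conjExponent q))
  set lam := cLow * (1 + δ₀)
  set G := C * gainFactor lam q.conjExponent
  -- The factor 4 yields the bound 1/4 for an input term. Both exponents are present because
  -- rescaling by k costs the maximum of two powers of 1/k.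
  have hγ : IsClassK fun s => (4 * G * s) ^ (1 + δ₀)⁻¹ + (4 * G * s) ^ (1 + δ₁)⁻¹ :=
    isClassK_rpow_add_rpow (by positivity) (by positivity) (by positivity)
  refine ⟨2, lam / (1 + δ₁), _, _, two_pos, by positivity, hγ, hγ,
    fun w0 d f hin T hT w hw => ?_⟩
  have hcpt : IsCompact (closure S.Ω) := hΩ.isBounded.isCompact_closure
  have := hΩ.isFiniteMeasure_surfaceMeasure hn
  have := hΩ.isFiniteMeasure_volume
  have hId : 0 ≤ timeModular (youngFunction φ) (surfaceMeasure S.Ω) q T d :=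
    ENNReal.toReal_nonneg
  have hIf : 0 ≤ timeModular (youngFunction φ) (volume.restrict S.Ω) q T f :=
    ENNReal.toReal_nonneg
  set Id := timeModular (youngFunction φ) (surfaceMeasure S.Ω) q T d
  set If := timeModular (youngFunction φ) (volume.restrict S.Ω) q T f
  set m := Real.exp (-(lam / (1 + δ₁)) * T) with hm
  have hm0 : 0 < m := Real.exp_pos _
  have hm1 : m ≤ 1 := Real.exp_le_one_iff.2 (by
    have : 0 < lam / (1 + δ₁) * T := by positivity
    linarith)
  have hterm : ∀ I : ℝ, 0 ≤ I →
      0 ≤ (4 * G * I) ^ (1 + δ₀)⁻¹ ∧ 0 ≤ (4 * G * I) ^ (1 + δ₁)⁻¹ := fun I hI =>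
    ⟨by positivity, by positivity⟩
  obtain ⟨hd0, hd1⟩ := hterm Id hId
  obtain ⟨hf0, hf1⟩ := hterm If hIf
  -- The infimum in the norm of w⁰ need not be positive or attained, so any larger r is used and
  -- then lowered to it.
  suffices hr : ∀ r, luxemburgNorm (youngFunction φ) (volume.restrict S.Ω) w0 < r →
      luxemburgNorm (youngFunction φ) (volume.restrict S.Ω) (fun x => w x T) ≤
        2 * r * m + ((4 * G * Id) ^ (1 + δ₀)⁻¹ + (4 * G * Id) ^ (1 + δ₁)⁻¹)
          + ((4 * G * If) ^ (1 + δ₀)⁻¹ + (4 * G * If) ^ (1 + δ₁)⁻¹) by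
    refine ge_of_tendsto (x := 𝓝[>] luxemburgNorm (youngFunction φ) (volume.restrict S.Ω) w0)
      ?_ (eventually_mem_nhdsWithin.mono hr)
    exact ((by fun_prop : Continuous fun r : ℝ => 2 * r * m +
      ((4 * G * Id) ^ (1 + δ₀)⁻¹ + (4 * G * Id) ^ (1 + δ₁)⁻¹)
          + ((4 * G * If) ^ (1 + δ₀)⁻¹ + (4 * G * If) ^ (1 + δ₁)⁻¹)).tendsto _).mono_left
      nhdsWithin_le_nhds
  intro r hr
  have hw0 : ContinuousOn w0 (closure S.Ω) := hin.contDiff_w0.continuousOn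
  obtain ⟨N, hN, hNr, hN1⟩ := hφ.exists_modular_rescale_le_one hcpt hΩ.ae_mem_closure_volume hw0 hr
  set k := 2 * N * m + ((4 * G * Id) ^ (1 + δ₀)⁻¹ + (4 * G * Id) ^ (1 + δ₁)⁻¹)
          + ((4 * G * If) ^ (1 + δ₀)⁻¹ + (4 * G * If) ^ (1 + δ₁)⁻¹) with hkdef
  have hNm : 0 < 2 * N * m := by positivity
  have hk : 0 < k := by linarith
  have hφk := hφ.rescale hk
  have hwT : ContinuousOn (fun x => w x T) (closure S.Ω) :=
    hw.continuousOn.comp (f := fun x => (x, T)) (by fun_prop)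
      fun x hx => ⟨hx, right_mem_Icc.2 hT.le⟩
  refine (hφ.luxemburgNorm_le hk
    (hφk.integrable_youngFunction_abs hcpt hΩ.ae_mem_closure_volume hwT) ?_).trans
    (b := k) (by have := mul_le_mul_of_nonneg_right hNr.le hm0.le; linarith)
  have hmain := h lam hlam le_rfl q _ hconj _ hφk w0 d f hin T hT w hw
  have hinput : ∀ I J : ℝ, 0 ≤ I → (4 * G * I) ^ (1 + δ₀)⁻¹ ≤ k → (4 * G * I) ^ (1 + δ₁)⁻¹ ≤ k →
      J ≤ max (k⁻¹ ^ (1 + δ₀)) (k⁻¹ ^ (1 + δ₁)) * I → G * J ≤ 4⁻¹ := by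
    intro I J hI hI0 hI1 hJ
    rw [mul_assoc] at hI0 hI1
    have hGI : 0 ≤ G * I := by positivity
    have e0 := inv_rpow_mul_le hk (by linarith) hGI (by norm_num) hI0
    have e1 := inv_rpow_mul_le hk (by linarith) hGI (by norm_num) hI1
    calc G * J ≤ G * (max (k⁻¹ ^ (1 + δ₀)) (k⁻¹ ^ (1 + δ₁)) * I) := by gcongr
      _ = max (k⁻¹ ^ (1 + δ₀) * (G * I)) (k⁻¹ ^ (1 + δ₁) * (G * I)) := by
          rw [← max_mul_of_nonneg _ _ hGI]; ring
      _ ≤ 4⁻¹ := max_le e0 e1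
  have hGd := hinput Id _ hId (by linarith) (by linarith)
    (hφ.timeModular_rescale_le hcpt IsC2Domain.ae_mem_closure_surfaceMeasure
      (hin.contDiff_d.continuousOn.mono (prod_mono_right fun t ht => ht.1)) q hk)
  have hGf := hinput If _ hIf (by linarith) (by linarith)
    (hφ.timeModular_rescale_le hcpt hΩ.ae_mem_closure_volume
      (hin.contDiff_f.continuousOn.mono (prod_mono_right fun t ht => ht.1)) q hk)
  -- Since k ≥ 2mN, the rescaled modular of w⁰ costs at most (2m)^(-(1+δ)) with δ = δ₀ or δ₁. The
  -- rate λ/(1+δ₁) in m is the largest for which exp(-λT) m^(-(1+δ)) ≤ 1 in both cases, and the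
  -- factor 2 leaves 1/2.
  have hinit : Real.exp (-lam * T) *
      modular (youngFunction fun s => φ (s / k) / k) (volume.restrict S.Ω) w0 ≤ 2⁻¹ := by
    have hl : 0 < 2 * m := by positivity
    have hφN := hφ.rescale hN
    have e1 : modular (youngFunction fun s => φ (s / k) / k) (volume.restrict S.Ω) w0 ≤
        max ((2 * m)⁻¹ ^ (1 + δ₀)) ((2 * m)⁻¹ ^ (1 + δ₁)) *
          modular (youngFunction fun s => φ (s / N) / N) (volume.restrict S.Ω) w0 := by
      rw [modular, modular, ← integral_const_mul]
      refine integral_mono_of_nonneg (.of_forall fun x => hφk.youngFunction_nonneg (abs_nonneg _))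
        ((hφN.integrable_youngFunction_abs hcpt hΩ.ae_mem_closure_volume hw0).const_mul _)
        (.of_forall fun x => ?_)
      simp only [IsTolksdorf.youngFunction_rescale _ hk, IsTolksdorf.youngFunction_rescale _ hN]
      refine le_trans ?_ (hφ.youngFunction_div_le (div_nonneg (abs_nonneg (w0 x)) hN.le) hl)
      rw [div_div]
      refine hφ.monotoneOn_youngFunction (mem_Ici.2 (by positivity)) (mem_Ici.2 (by positivity)) ?_
      gcongr
      linarith
    have hpow : ∀ δ : ℝ, 0 < δ → δ ≤ δ₁ →
        Real.exp (-lam * T) * (2 * m)⁻¹ ^ (1 + δ) ≤ 2⁻¹ := by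
      intro δ hδ hδ1
      have e2 : (2 : ℝ)⁻¹ ^ (1 + δ) ≤ 2⁻¹ := by
        simpa using Real.rpow_le_rpow_of_exponent_ge (by norm_num : (0 : ℝ) < 2⁻¹) (by norm_num)
          (by linarith : (1 : ℝ) ≤ 1 + δ)
      have e3 : Real.exp (-lam * T) * m⁻¹ ^ (1 + δ) ≤ 1 := by
        rw [hm, ← Real.exp_neg, ← Real.exp_mul, ← Real.exp_add]
        refine Real.exp_le_one_iff.2 ?_
        have : -lam * T + -(-(lam / (1 + δ₁)) * T) * (1 + δ) =
            -(lam * T * ((δ₁ - δ) / (1 + δ₁))) := by field_simp; ring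
        rw [this]
        have : 0 ≤ (δ₁ - δ) / (1 + δ₁) := div_nonneg (by linarith) (by linarith)
        have : 0 ≤ lam * T * ((δ₁ - δ) / (1 + δ₁)) := by positivity
        linarith
      rw [mul_inv, Real.mul_rpow (by norm_num) (by positivity)]
      calc _ = 2⁻¹ ^ (1 + δ) * (Real.exp (-lam * T) * m⁻¹ ^ (1 + δ)) := by ring
        _ ≤ 2⁻¹ * 1 := mul_le_mul e2 e3 (by positivity) (by norm_num)
        _ = 2⁻¹ := mul_one _
    calc _ ≤ Real.exp (-lam * T) *
          (max ((2 * m)⁻¹ ^ (1 + δ₀)) ((2 * m)⁻¹ ^ (1 + δ₁)) * 1) := by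
          gcongr
          exact e1.trans (mul_le_mul_of_nonneg_left hN1 (le_max_of_le_left (by positivity)))
      _ = max (Real.exp (-lam * T) * (2 * m)⁻¹ ^ (1 + δ₀))
          (Real.exp (-lam * T) * (2 * m)⁻¹ ^ (1 + δ₁)) := by
          rw [mul_one, mul_max_of_nonneg _ _ (Real.exp_pos _).le]
      _ ≤ 2⁻¹ := max_le (hpow _ h0 h01) (hpow _ h1 le_rfl)
  linarith

end System

end ParabolicISS

/-! ### The main theorem -/

theorem mainTheorem5 {n : ℕ} (hn : 1 ≤ n) (S : System n)
    (hΩ : IsC2Domain S.Ω) (hS : S.Regular) (hgrowth : S.GrowthConditions)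
    (φ : ℝ → ℝ) (δ₀ δ₁ cLow : ℝ) (hφ : IsTolksdorf φ δ₀ δ₁)
    (hint : S.InteriorCondition δ₀ δ₁ cLow) (hbdry : S.BoundaryCondition δ₀ δ₁) :
    (∃ ε₀ : ℝ, 0 < ε₀ ∧ ∀ ε lam : ℝ, 0 < ε → ε < ε₀ → lam = cLow * (1 + δ₀) - ε →
      0 < lam ∧ ∀ q q' : ENNReal, ENNReal.HolderConjugate q q' →
      ∀ (w0 : E n → ℝ) (d f : E n → ℝ → ℝ), S.IsInput w0 d f →
      ∀ T : ℝ, 0 < T → ∀ w : E n → ℝ → ℝ, S.IsSolution w0 d f T w →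
        modular (youngFunction φ) (volume.restrict S.Ω) (fun x => w x T) ≤
          Real.exp (-lam * T) * modular (youngFunction φ) (volume.restrict S.Ω) w0
            + youngConst δ₀ δ₁ ε * gainFactor lam q' *
              timeModular (youngFunction φ) (surfaceMeasure S.Ω) q T d
            + youngConst δ₀ δ₁ ε * gainFactor lam q' *
              timeModular (youngFunction φ) (volume.restrict S.Ω) q T f) ∧
    ∀ q : ENNReal, 1 ≤ q →
      ExpISSClass S (youngFunction φ) q ∧ ExpISSNorm S (youngFunction φ) q := by
  refine ⟨?_, fun q hq => ⟨System.expISSClass hn hΩ hS hgrowth hφ hint hbdry hq,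
    System.expISSNorm hn hΩ hS hgrowth hφ hint hbdry hq⟩⟩
  obtain ⟨C, hC, h⟩ :=
    System.exists_modular_le hn hΩ hS hgrowth hφ.δ₀_pos hφ.δ₁_pos hint hbdry
  obtain ⟨ε₁, hε₁, hY⟩ := exists_forall_le_youngConst hφ.δ₀_pos hφ.δ₁_pos C
  have hc : 0 < cLow * (1 + δ₀) := mul_pos hint.1 (by linarith [hφ.δ₀_pos])
  -- Below ε₁ the fixed constant C is at most C(ε); below `cLow * (1 + δ₀)` the rate λ stays
  -- positive. The loss of ε in the rate is not used otherwise.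
  refine ⟨min ε₁ (cLow * (1 + δ₀)), lt_min hε₁ hc, fun ε lam hε hlt hlam => ?_⟩
  have hlam0 : 0 < lam := by linarith [hlt.trans_le (min_le_right _ _)]
  refine ⟨hlam0, fun q q' hq w0 d f hin T hT w hw => ?_⟩
  refine (h lam hlam0 (by linarith) q q' hq φ hφ w0 d f hin T hT w hw).trans ?_
  have hCY := hY ε hε (hlt.trans_le (min_le_left _ _))
  have hg := gainFactor_pos hlam0 (ENNReal.HolderConjugate.ne_zero q' q)
  have hId : 0 ≤ timeModular (youngFunction φ) (surfaceMeasure S.Ω) q T d :=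
    ENNReal.toReal_nonneg
  have hIf : 0 ≤ timeModular (youngFunction φ) (volume.restrict S.Ω) q T f :=
    ENNReal.toReal_nonneg
  gcongr
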